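/- Let $M$ be a smooth $n$-dimensional manifold (Hausdorff, second countable) with a measure $dx$ given by a smooth volume, let $X_1,\dots,X_N$ be smooth vector fields on $M$, $\nabla_X=(X_1,\dots,X_N)$, and let $\Omega\subset M$ be open. Let $p\in C^1(\Omega)$ be bounded, $p(x)>1$, with $$1<p^-:=\operatorname*{ess\,inf}_\Omega p\le p^+:=\operatorname*{ess\,sup}_\Omega p<\infty,$$ let $g\ge 0$ be a bounded measurable function on $\Omega$ and let $\lambda\in\mathbb R$. Here $W^{1,p(\cdot)}(\Omega)$ is the space of $u\in L^{p(\cdot)}(\Omega)$ with weak horizontal gradient $\nabla_Xu\in L^{p(\cdot)}(\Omega)$, $W^{1,p(\cdot)}_0(\Omega)$ is the closure of $C_0^\infty(\Omega)$ in it, and $W^{1,p(\cdot)}_{\mathrm{loc}}(\Omega)$ is the space of functions that agree on each compact subset of $\Omega$, together with their horizontal gradient, with an element of $W^{1,p(\cdot)}_0(\Omega)$. Let $v>0$ a.e. be a sup-solution of $-\nabla_X^*(|\nabla_Xv|^{p(x)-2}\nabla_Xv)=\lambda g|v|^{p(x)-2}v$ in $\Omega$, in the sense that $v\in W^{1,p(\cdot)}_{\mathrm{loc}}(\Omega)$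 and $$\int_\Omega|\nabla_Xv|^{p(x)-2}\langle\nabla_Xv,\nabla_X\psi\rangle\,dx-\lambda\int_\Omega g\,|v|^{p(x)-2}v\,\psi\,dx\ \ge 0$$ for all nonnegative $\psi\in W_0^{1,p(\cdot)}(\Omega)$ vanishing outside a compact subset of $\Omega$ (this holds in particular if $v\in W_0^{1,p(\cdot)}(\Omega)$ satisfies the inequality for all nonnegative $\psi\in W_0^{1,p(\cdot)}(\Omega)$). Suppose $\nabla_Xv\cdot\nabla_Xp=0$ a.e. in $\Omega$. (a) Let $q\in C^1(\Omega)$ be bounded above, with $q(x)<p(x)-1$, $\nabla_Xv\cdot\nabla_Xq=0$ a.e., and, with $q^+:=\operatorname{ess\,sup}_\Omega q$, $d:=p^--q^+-1>0$. Then for every nonnegative $\varphi\in C_0^\infty(\Omega)$ $$\int_\Omega v^{q-p}\varphi^p|\nabla_Xv|^p\,dx\le C\int_\Omega v^q|\nabla_X\varphi|^p\,dx-\frac{\lambda p^+}{d}\int_\Omega g\,v^q\varphi^p\,dx ,$$ where $$C=\Big(\frac{p^+}{p^--q^+-1}\Big)^{p^+}$$ if $d\le p^+$ (for example if $q\ge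 -1$) or if $p^-=p^+$, and $C=\max\{(p^+/d)^{p^+},(p^+/d)^{p^-}\}$ in all cases. The inequality holds between elements of $[0,\infty]$ after the last term has been moved to the side on which its coefficient is nonnegative; and if both integrals on the right are finite, then so is the one on the left and the inequality holds as displayed. (b) (The case $q=0$.) For every nonnegative $\varphi\in C_0^\infty(\Omega)$ the function $|\varphi\nabla_X\log v|^{p}$, where $\nabla_X\log v:=v^{-1}\nabla_Xv$, is integrable over $\Omega$ and $$\int_\Omega|\varphi\nabla_X\log v|^{p}\,dx\le\Big(\frac{p^+}{p^--1}\Big)^{p^+}\int_\Omega|\nabla_X\varphi|^{p}\,dx-\frac{\lambda p^+}{p^--1}\int_\Omega g\,\varphi^p\,dx ;$$ for $\lambda=0$ (or $g=0$), i.e. for positive $p(x)$-superharmonic $v$, the last term is absent. -/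

import Mathlib

open MeasureTheory Filter Topology Set
open scoped Manifold ContDiff

noncomputable section

section VariableExponent

variable {n N : ℕ} {M : Type*} [TopologicalSpace M]
  [ChartedSpace (EuclideanSpace ℝ (Fin n)) M]

/-- `μ` is the measure of a smooth volume on `M`: in every chart it has a smooth, strictly
positive density with respect to Lebesgue measure. -/
def IsSmoothVolume [MeasurableSpace M] (μ : Measure M) : Prop :=
  ∀ x : M, ∃ ρ : EuclideanSpace ℝ (Fin n) → ℝ,
    ContDiffOn ℝ ∞ ρ (chartAt (EuclideanSpace ℝ (Fin n)) x).target ∧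
    (∀ y ∈ (chartAt (EuclideanSpace ℝ (Fin n)) x).target, 0 < ρ y) ∧
    (μ.restrict (chartAt (EuclideanSpace ℝ (Fin n)) x).source).map
        (chartAt (EuclideanSpace ℝ (Fin n)) x) =
      (volume.restrict (chartAt (EuclideanSpace ℝ (Fin n)) x).target).withDensity
        (fun y => ENNReal.ofReal (ρ y))

/-- The horizontal gradient `∇_X u = (X₁ u, …, X_N u)` of a differentiable function. -/
def horizontalGradient (X : Fin N → (x : M) → TangentSpace (𝓡 n) x) (u : M → ℝ) (x : M) :
    EuclideanSpace ℝ (Fin N) :=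
  WithLp.toLp 2 (fun k => (mfderiv (𝓡 n) 𝓘(ℝ, ℝ) u x (X k x) : ℝ))

variable (n) in
/-- `φ ∈ C₀^∞(Ω)`. -/
def IsTestFunction (Ω : Set M) (φ : M → ℝ) : Prop :=
  ContMDiff (𝓡 n) 𝓘(ℝ, ℝ) ∞ φ ∧ HasCompactSupport φ ∧ tsupport φ ⊆ Ω

/-- `ξ = X_k^* φ`, where `X_k^*` is the formal adjoint of `X_k` with respect to `μ`:
`∫ ξ η = ∫ φ X_k η` for all `η ∈ C₀^∞(Ω)`. -/
def IsFormalAdjoint [MeasurableSpace M] (X : Fin N → (x : M) → TangentSpace (𝓡 n) x)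
    (μ : Measure M) (Ω : Set M) (k : Fin N) (φ ξ : M → ℝ) : Prop :=
  ∀ η : M → ℝ, IsTestFunction n Ω η →
    ∫ x in Ω, ξ x * η x ∂μ = ∫ x in Ω, φ x * horizontalGradient X η x k ∂μ

/-- `G` is the weak (distributional) horizontal gradient of `u` in `Ω`:
`∫ u X_k^* φ = ∫ G_k φ` for all `φ ∈ C₀^∞(Ω)` and all `k`. -/
def IsWeakHorizontalGradient [MeasurableSpace M]
    (X : Fin N → (x : M) → TangentSpace (𝓡 n) x) (μ : Measure M) (Ω : Set M)
    (u : M → ℝ) (G : M → EuclideanSpace ℝ (Fin N)) : Prop :=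
  LocallyIntegrableOn u Ω μ ∧ LocallyIntegrableOn G Ω μ ∧
  ∀ (k : Fin N) (φ ξ : M → ℝ), IsTestFunction n Ω φ → IsTestFunction n Ω ξ →
    IsFormalAdjoint X μ Ω k φ ξ →
    ∫ x in Ω, u x * ξ x ∂μ = ∫ x in Ω, G x k * φ x ∂μ

/-- The modular `∫_Ω |f(x)|^{p(x)} dμ`. -/
def modular {M F : Type*} [MeasurableSpace M] [NormedAddCommGroup F] (μ : Measure M)
    (Ω : Set M) (p : M → ℝ) (f : M → F) : ENNReal :=
  ∫⁻ x in Ω, ENNReal.ofReal (‖f x‖ ^ p x) ∂μ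

/-- `f ∈ L^{p(·)}(Ω)`. -/
def MemVarLp {M F : Type*} [MeasurableSpace M] [NormedAddCommGroup F] (μ : Measure M)
    (Ω : Set M) (p : M → ℝ) (f : M → F) : Prop :=
  AEStronglyMeasurable f (μ.restrict Ω) ∧ modular μ Ω p f < ⊤

/-- `u ∈ W^{1,p(·)}(Ω)`, with weak horizontal gradient `G`. -/
def MemW1 [MeasurableSpace M] (X : Fin N → (x : M) → TangentSpace (𝓡 n) x)
    (μ : Measure M) (Ω : Set M) (p : M → ℝ)
    (u : M → ℝ) (G : M → EuclideanSpace ℝ (Fin N)) : Prop :=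
  IsWeakHorizontalGradient X μ Ω u G ∧ MemVarLp μ Ω p u ∧ MemVarLp μ Ω p G

/-- `u ∈ W₀^{1,p(·)}(Ω)`, with weak horizontal gradient `G`: the closure of `C₀^∞(Ω)` in
`W^{1,p(·)}(Ω)`. For the bounded exponents considered here convergence in the (Luxemburg) norm is
convergence of the modular to zero. -/
def MemW10 [MeasurableSpace M] (X : Fin N → (x : M) → TangentSpace (𝓡 n) x)
    (μ : Measure M) (Ω : Set M) (p : M → ℝ)
    (u : M → ℝ) (G : M → EuclideanSpace ℝ (Fin N)) : Prop :=
  MemW1 X μ Ω p u G ∧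
  ∃ φ : ℕ → M → ℝ, (∀ j, IsTestFunction n Ω (φ j)) ∧
    Tendsto (fun j => modular μ Ω p (fun x => φ j x - u x)) atTop (𝓝 0) ∧
    Tendsto (fun j => modular μ Ω p (fun x => horizontalGradient X (φ j) x - G x)) atTop (𝓝 0)

/-- `u ∈ W^{1,p(·)}_loc(Ω)`, with weak horizontal gradient `G`: on every compact subset of `Ω` the
pair `(u, G)` agrees with an element of `W₀^{1,p(·)}(Ω)` and its gradient. (For `C¹` exponents and
smooth vector fields this is the same as `u ∈ W^{1,p(·)}(U)` for all `U` compactly contained in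
`Ω`: multiply by a cut-off function and mollify.) -/
def MemW1Loc [MeasurableSpace M] (X : Fin N → (x : M) → TangentSpace (𝓡 n) x)
    (μ : Measure M) (Ω : Set M) (p : M → ℝ)
    (u : M → ℝ) (G : M → EuclideanSpace ℝ (Fin N)) : Prop :=
  ∀ K : Set M, IsCompact K → K ⊆ Ω →
    ∃ (w : M → ℝ) (H : M → EuclideanSpace ℝ (Fin N)),
      MemW10 X μ Ω p w H ∧ ∀ᵐ x ∂(μ.restrict K), w x = u x ∧ H x = G x

/-- The weak form `∫ |∇_X u|^{p-2} ⟨∇_X u, ∇_X ψ⟩ - lam ∫ g |u|^{p-2} u ψ`, where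
`G = ∇_X u` and `H = ∇_X ψ`. -/
def weakForm [MeasurableSpace M] (μ : Measure M) (Ω : Set M) (p g : M → ℝ) (lam : ℝ)
    (u : M → ℝ) (G : M → EuclideanSpace ℝ (Fin N))
    (ψ : M → ℝ) (H : M → EuclideanSpace ℝ (Fin N)) : ℝ :=
  (∫ x in Ω, ‖G x‖ ^ (p x - 2) * inner ℝ (G x) (H x) ∂μ) -
    lam * ∫ x in Ω, g x * |u x| ^ (p x - 2) * u x * ψ x ∂μ

/-- `(u, lam)` is a sup-solution of `-∇_X^*(|∇_X u|^{p-2} ∇_X u) = lam g |u|^{p-2} u`, `u = 0` on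
`∂Ω`: `u ∈ W₀^{1,p(·)}(Ω)`, tested with all nonnegative `ψ ∈ W₀^{1,p(·)}(Ω)`. -/
def IsSupSolution [MeasurableSpace M] (X : Fin N → (x : M) → TangentSpace (𝓡 n) x)
    (μ : Measure M) (Ω : Set M) (p g : M → ℝ) (lam : ℝ)
    (u : M → ℝ) (G : M → EuclideanSpace ℝ (Fin N)) : Prop :=
  MemW10 X μ Ω p u G ∧
  ∀ (ψ : M → ℝ) (H : M → EuclideanSpace ℝ (Fin N)), MemW10 X μ Ω p ψ H →
    (∀ᵐ x ∂(μ.restrict Ω), 0 ≤ ψ x) → 0 ≤ weakForm μ Ω p g lam u G ψ H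

/-- Local sup-solutions: `u ∈ W^{1,p(·)}_loc(Ω)`, tested with all nonnegative
`ψ ∈ W₀^{1,p(·)}(Ω)` that vanish outside a compact subset of `Ω`. No boundary condition is imposed.
For `lam = 0` these are the `p(x)`-superharmonic functions. -/
def IsLocalSupSolution [MeasurableSpace M] (X : Fin N → (x : M) → TangentSpace (𝓡 n) x)
    (μ : Measure M) (Ω : Set M) (p g : M → ℝ) (lam : ℝ)
    (u : M → ℝ) (G : M → EuclideanSpace ℝ (Fin N)) : Prop :=
  MemW1Loc X μ Ω p u G ∧
  ∀ (ψ : M → ℝ) (H : M → EuclideanSpace ℝ (Fin N)), MemW10 X μ Ω p ψ H →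
    (∀ᵐ x ∂(μ.restrict Ω), 0 ≤ ψ x) →
    (∃ K : Set M, IsCompact K ∧ K ⊆ Ω ∧ ∀ x ∉ K, ψ x = 0) →
    0 ≤ weakForm μ Ω p g lam u G ψ H

theorem IsSupSolution.isLocalSupSolution [MeasurableSpace M]
    {X : Fin N → (x : M) → TangentSpace (𝓡 n) x}
    {μ : Measure M} {Ω : Set M} {p g : M → ℝ} {lam : ℝ}
    {u : M → ℝ} {G : M → EuclideanSpace ℝ (Fin N)}
    (h : IsSupSolution X μ Ω p g lam u G) : IsLocalSupSolution X μ Ω p g lam u G :=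
  ⟨fun _ _ _ => ⟨u, G, h.1, Eventually.of_forall fun _ => ⟨rfl, rfl⟩⟩,
    fun ψ H hψ h0 _ => h.2 ψ H hψ h0⟩

/-- The estimate
`∫ v^{q-p} φ^p |∇_X v|^p ≤ C ∫ v^q |∇_X φ|^p - A ∫ g v^q φ^p` over `Ω`, with `G = ∇_X v`.
First clause: with values in `[0, ∞]`, the last term being placed on the side on which it is
nonnegative, so that no finiteness is presupposed. Second clause: as an inequality between
real numbers, whenever the two integrals on the right are finite. -/
def CaccioppoliEstimate [MeasurableSpace M] (X : Fin N → (x : M) → TangentSpace (𝓡 n) x)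
    (μ : Measure M) (Ω : Set M) (p q g : M → ℝ) (v : M → ℝ)
    (G : M → EuclideanSpace ℝ (Fin N)) (φ : M → ℝ) (C A : ℝ) : Prop :=
  ((∫⁻ x in Ω, ENNReal.ofReal (v x ^ (q x - p x) * φ x ^ p x * ‖G x‖ ^ p x) ∂μ) +
      ENNReal.ofReal A * ∫⁻ x in Ω, ENNReal.ofReal (g x * v x ^ q x * φ x ^ p x) ∂μ ≤
    ENNReal.ofReal C *
        (∫⁻ x in Ω, ENNReal.ofReal (v x ^ q x * ‖horizontalGradient X φ x‖ ^ p x) ∂μ) +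
      ENNReal.ofReal (-A) * ∫⁻ x in Ω, ENNReal.ofReal (g x * v x ^ q x * φ x ^ p x) ∂μ) ∧
  (IntegrableOn (fun x => v x ^ q x * ‖horizontalGradient X φ x‖ ^ p x) Ω μ →
    IntegrableOn (fun x => g x * v x ^ q x * φ x ^ p x) Ω μ →
    IntegrableOn (fun x => v x ^ (q x - p x) * φ x ^ p x * ‖G x‖ ^ p x) Ω μ ∧
    ∫ x in Ω, v x ^ (q x - p x) * φ x ^ p x * ‖G x‖ ^ p x ∂μ ≤
      C * (∫ x in Ω, v x ^ q x * ‖horizontalGradient X φ x‖ ^ p x ∂μ) -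
        A * ∫ x in Ω, g x * v x ^ q x * φ x ^ p x ∂μ)

end VariableExponent

end

/-! The sup-solution inequality is tested with `ψ = φ ^ p * (v + ε) ^ (q - p + 1)`. Differentiating
the variable exponents produces logarithmic terms along ∇p and ∇q; ∇v is orthogonal to both, so they
drop out of ⟨∇v, ∇ψ⟩. What remains is a cross term p φ^(p-1) (v+ε)^(q-p+1) |∇v|^(p-2) ⟨∇v, ∇φ⟩ and
the term (q-p+1) (v+ε)^(q-p) φ^p |∇v|^p, whose coefficient is at most -d. Young's inequality with
weight d/p⁺ absorbs the cross term and still leaves -d/p⁺ times the left-hand density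
(`caccioppoli_pointwise`). Dividing by d/p⁺ gives the factor (p⁺/d)^p(x), which the stated constants
dominate.

The shift ε is removed in `CaccioppoliData.estimate`: Fatou's lemma on the left, dominated
convergence for the term with ∇φ, and monotonicity in ε for a zeroth-order term on the right.

The technical weight lies in showing that ψ is an admissible test function (`memW10_mul_comp`, used
in `IsLocalSupSolution.flux_inequality`). On the support of φ, v agrees with an element of W₀ and is
approximated by smooth functions; composing these with a C¹ function that is bounded together with
its derivatives, and multiplying by φ^p, gives C¹ functions of compact support converging in the
modular. Mollification in charts and a partition of unity make them smooth.

For q = 0 the left-hand density is |φ ∇ log v|^p, and both integrals on the right are finite because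
φ is smooth with compact support. -/

/-! ### Calculus of the horizontal gradient. -/

section HorizontalGradient

variable {n N : ℕ} {M : Type*} [TopologicalSpace M]
  [ChartedSpace (EuclideanSpace ℝ (Fin n)) M]

/-- The tangent map of a C¹ map is continuous on the tangent bundle; composed with the continuous
section `Y`, its fibre component is the derivative in question. -/
theorem continuousOn_mfderiv_apply [IsManifold (𝓡 n) ∞ M]
    {Y : (x : M) → TangentSpace (𝓡 n) x}
    (hY : ContMDiff (𝓡 n) (𝓡 n).tangent ∞ (fun x => (⟨x, Y x⟩ : TangentBundle (𝓡 n) M)))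
    {E : Type*} [NormedAddCommGroup E] [NormedSpace ℝ E] {f : M → E} {U : Set M} (hU : IsOpen U)
    (hf : ContMDiffOn (𝓡 n) 𝓘(ℝ, E) 1 f U) :
    ContinuousOn (fun x => (mfderiv (𝓡 n) 𝓘(ℝ, E) f x (Y x) : E)) U := by
  have : IsManifold (𝓡 n) 1 M := IsManifold.of_le (n := ∞) (by norm_cast)
  have h1 := hf.continuousOn_tangentMapWithin le_rfl hU.uniqueMDiffOn
  have h2 : ContinuousOn (fun x => tangentMapWithin (𝓡 n) 𝓘(ℝ, E) f U
      (⟨x, Y x⟩ : TangentBundle (𝓡 n) M)) U :=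
    h1.comp hY.continuous.continuousOn (fun x hx => hx)
  have h3 := ((tangentBundleModelSpaceHomeomorph 𝓘(ℝ, E)).continuous.comp_continuousOn h2).snd
  refine h3.congr fun x hx => ?_
  change _ = (mfderivWithin (𝓡 n) 𝓘(ℝ, E) f U x (Y x) : E)
  rw [mfderivWithin_of_isOpen hU hx]

theorem horizontalGradient_apply (X : Fin N → (x : M) → TangentSpace (𝓡 n) x) (u : M → ℝ) (x : M)
    (k : Fin N) : horizontalGradient X u x k = mfderiv (𝓡 n) 𝓘(ℝ, ℝ) u x (X k x) := rfl

theorem continuousOn_horizontalGradient [IsManifold (𝓡 n) ∞ M]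
    {X : Fin N → (x : M) → TangentSpace (𝓡 n) x}
    (hX : ∀ k, ContMDiff (𝓡 n) (𝓡 n).tangent ∞
      (fun x => (⟨x, X k x⟩ : TangentBundle (𝓡 n) M)))
    {u : M → ℝ} {U : Set M} (hU : IsOpen U) (hu : ContMDiffOn (𝓡 n) 𝓘(ℝ, ℝ) 1 u U) :
    ContinuousOn (horizontalGradient X u) U := by
  refine (PiLp.continuous_toLp 2 (fun _ : Fin N => ℝ)).comp_continuousOn ?_
  exact continuousOn_pi.2 fun k => continuousOn_mfderiv_apply (hX k) hU hu

theorem horizontalGradient_comp_hasFDerivAt {X : Fin N → (x : M) → TangentSpace (𝓡 n) x}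
    {E : Type*} [NormedAddCommGroup E] [NormedSpace ℝ E] {f : M → E} {Ψ : E → ℝ}
    {Ψ' : E →L[ℝ] ℝ} {x : M} (hf : MDifferentiableAt (𝓡 n) 𝓘(ℝ, E) f x)
    (hΨ : HasFDerivAt Ψ Ψ' (f x)) (k : Fin N) :
    horizontalGradient X (fun y => Ψ (f y)) x k =
      Ψ' (mfderiv (𝓡 n) 𝓘(ℝ, E) f x (X k x) : E) := by
  have h := (hΨ.hasMFDerivAt).comp x hf.hasMFDerivAt
  rw [horizontalGradient_apply]
  have h2 := h.mfderiv
  have h3 : (Ψ ∘ f) = fun y => Ψ (f y) := rfl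
  rw [h3] at h2
  rw [h2]; rfl

/-- The chain rule in two variables, needed for powers whose base and exponent both depend on the
point. -/
theorem horizontalGradient_comp₂ {X : Fin N → (x : M) → TangentSpace (𝓡 n) x}
    {f g : M → ℝ} {Ψ : ℝ × ℝ → ℝ} {Ψ' : ℝ × ℝ →L[ℝ] ℝ} {x : M}
    (hf : MDifferentiableAt (𝓡 n) 𝓘(ℝ, ℝ) f x) (hg : MDifferentiableAt (𝓡 n) 𝓘(ℝ, ℝ) g x)
    (hΨ : HasFDerivAt Ψ Ψ' (f x, g x)) :
    horizontalGradient X (fun y => Ψ (f y, g y)) x =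
      Ψ' (1, 0) • horizontalGradient X f x + Ψ' (0, 1) • horizontalGradient X g x := by
  ext k
  have hfg := hf.prodMk_space hg
  rw [horizontalGradient_comp_hasFDerivAt (f := fun y => (f y, g y)) hfg hΨ k]
  have h2 : (mfderiv (𝓡 n) 𝓘(ℝ, ℝ × ℝ) (fun y => (f y, g y)) x (X k x) : ℝ × ℝ) =
      (horizontalGradient X f x k, horizontalGradient X g x k) := by
    have h3 : HasMFDerivAt (𝓡 n) 𝓘(ℝ, ℝ × ℝ) (fun y => (f y, g y)) x
        ((mfderiv (𝓡 n) 𝓘(ℝ, ℝ) f x).prod (mfderiv (𝓡 n) 𝓘(ℝ, ℝ) g x)) :=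
      ⟨hf.hasMFDerivAt.1.prodMk hg.hasMFDerivAt.1, hf.hasMFDerivAt.2.prodMk hg.hasMFDerivAt.2⟩
    rw [h3.mfderiv]; rfl
  rw [h2]
  have h3 : ∀ a b : ℝ, (a, b) = a • ((1 : ℝ), (0 : ℝ)) + b • ((0 : ℝ), (1 : ℝ)) := by
    intro a b; simp
  rw [h3, map_add, map_smul, map_smul]
  simp [mul_comm]

theorem horizontalGradient_add {X : Fin N → (x : M) → TangentSpace (𝓡 n) x}
    {f g : M → ℝ} {x : M}
    (hf : MDifferentiableAt (𝓡 n) 𝓘(ℝ, ℝ) f x) (hg : MDifferentiableAt (𝓡 n) 𝓘(ℝ, ℝ) g x) :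
    horizontalGradient X (fun y => f y + g y) x =
      horizontalGradient X f x + horizontalGradient X g x := by
  have h := (hasFDerivAt_fst (𝕜 := ℝ) (p := (f x, g x))).add
    (hasFDerivAt_snd (𝕜 := ℝ) (p := (f x, g x)))
  rw [horizontalGradient_comp₂ (Ψ := fun z : ℝ × ℝ => z.1 + z.2) hf hg h]
  simp

theorem horizontalGradient_mul {X : Fin N → (x : M) → TangentSpace (𝓡 n) x}
    {f g : M → ℝ} {x : M}
    (hf : MDifferentiableAt (𝓡 n) 𝓘(ℝ, ℝ) f x) (hg : MDifferentiableAt (𝓡 n) 𝓘(ℝ, ℝ) g x) :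
    horizontalGradient X (fun y => f y * g y) x =
      g x • horizontalGradient X f x + f x • horizontalGradient X g x := by
  have h := (hasFDerivAt_fst (𝕜 := ℝ) (p := (f x, g x))).mul
    (hasFDerivAt_snd (𝕜 := ℝ) (p := (f x, g x)))
  rw [horizontalGradient_comp₂ (Ψ := fun z : ℝ × ℝ => z.1 * z.2) hf hg h]
  simp

theorem horizontalGradient_congr {X : Fin N → (x : M) → TangentSpace (𝓡 n) x}
    {f g : M → ℝ} {x : M} (h : f =ᶠ[𝓝 x] g) :
    horizontalGradient X f x = horizontalGradient X g x := by
  ext k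
  rw [horizontalGradient_apply, horizontalGradient_apply, h.mfderiv_eq]; rfl

theorem horizontalGradient_const {X : Fin N → (x : M) → TangentSpace (𝓡 n) x} (c : ℝ) (x : M) :
    horizontalGradient X (fun _ : M => c) x = 0 := by
  ext k
  rw [horizontalGradient_apply, mfderiv_const]; rfl

theorem horizontalGradient_eq_zero_of_notMem_tsupport
    {X : Fin N → (x : M) → TangentSpace (𝓡 n) x} {f : M → ℝ} {x : M} (hx : x ∉ tsupport f) :
    horizontalGradient X f x = 0 := by
  rw [horizontalGradient_congr (notMem_tsupport_iff_eventuallyEq.1 hx)]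
  exact horizontalGradient_const 0 x

theorem tsupport_horizontalGradient_subset (X : Fin N → (x : M) → TangentSpace (𝓡 n) x)
    (f : M → ℝ) : tsupport (horizontalGradient X f) ⊆ tsupport f :=
  closure_minimal (fun _ hx => by_contra fun h =>
    hx (horizontalGradient_eq_zero_of_notMem_tsupport h)) (isClosed_tsupport f)

theorem IsTestFunction.hasCompactSupport_horizontalGradient
    {X : Fin N → (x : M) → TangentSpace (𝓡 n) x} {Ω : Set M} {f : M → ℝ}
    (hf : IsTestFunction n Ω f) : HasCompactSupport (horizontalGradient X f) :=
  hf.2.1.of_isClosed_subset (isClosed_tsupport _) (tsupport_horizontalGradient_subset X f)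

theorem IsTestFunction.continuous_horizontalGradient [IsManifold (𝓡 n) ∞ M]
    {X : Fin N → (x : M) → TangentSpace (𝓡 n) x}
    (hX : ∀ k, ContMDiff (𝓡 n) (𝓡 n).tangent ∞
      (fun x => (⟨x, X k x⟩ : TangentBundle (𝓡 n) M)))
    {Ω : Set M} {f : M → ℝ} (hf : IsTestFunction n Ω f) : Continuous (horizontalGradient X f) :=
  continuousOn_univ.1 (continuousOn_horizontalGradient hX isOpen_univ
    (hf.1.of_le (by norm_cast)).contMDiffOn)

end HorizontalGradient

/-! ### Local finiteness of a smooth volume. -/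

section SmoothVolume

variable {n : ℕ} {M : Type*} [TopologicalSpace M]
  [ChartedSpace (EuclideanSpace ℝ (Fin n)) M]

/-- In a chart the density is continuous, hence bounded on a compact neighbourhood of the image
point. -/
theorem IsSmoothVolume.isLocallyFiniteMeasure [MeasurableSpace M] [BorelSpace M] {μ : Measure M}
    (hμ : IsSmoothVolume (n := n) μ) : IsLocallyFiniteMeasure μ := by
  refine ⟨fun x => ?_⟩
  obtain ⟨ρ, hρ, hpos, hmap⟩ := hμ x
  set e := chartAt (EuclideanSpace ℝ (Fin n)) x with he
  have hx : x ∈ e.source := mem_chart_source _ x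
  have hex : e x ∈ e.target := mem_chart_target _ x
  obtain ⟨L, hL, hLt, hLc⟩ := exists_compact_subset e.open_target hex
  refine ⟨e.source ∩ e ⁻¹' (interior L), ?_, ?_⟩
  · exact (e.continuousOn.isOpen_inter_preimage e.open_source isOpen_interior).mem_nhds ⟨hx, hLt⟩
  · have hem : AEMeasurable e (μ.restrict e.source) :=
      (e.continuousOn.aemeasurable e.open_source.measurableSet)
    have h1 : (μ.restrict e.source).map e (interior L) < ⊤ := by
      rw [hmap, withDensity_apply _ isOpen_interior.measurableSet]
      obtain ⟨c, hc⟩ := (hL.image_of_continuousOn (hρ.continuousOn.mono hLc)).bddAbove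
      calc ∫⁻ a in interior L, ENNReal.ofReal (ρ a) ∂(volume.restrict e.target)
          ≤ ∫⁻ a in interior L, ENNReal.ofReal c ∂(volume.restrict e.target) := by
            refine setLIntegral_mono' isOpen_interior.measurableSet fun y hy => ?_
            exact ENNReal.ofReal_le_ofReal (hc ⟨y, interior_subset hy, rfl⟩)
        _ < ⊤ := by
            rw [setLIntegral_const]
            refine ENNReal.mul_lt_top ENNReal.ofReal_lt_top ?_
            exact (Measure.restrict_apply_le _ _).trans_lt
              ((measure_mono interior_subset).trans_lt hL.measure_lt_top)
    rw [Measure.map_apply_of_aemeasurable hem isOpen_interior.measurableSet] at h1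
    rw [inter_comm]
    rwa [Measure.restrict_apply'] at h1
    exact e.open_source.measurableSet

end SmoothVolume

/-! ### Essential bounds for real functions. -/

section EssSup

/-- For the zero measure every real is an a.e. lower bound, and the supremum of all of `ℝ` has the
default value 0. A positive essential infimum therefore excludes a null domain. -/
theorem essInf_real_measure_zero {α : Type*} [MeasurableSpace α] (f : α → ℝ) :
    essInf f (0 : Measure α) = 0 := by
  simp [essInf, liminf_eq]

theorem restrict_ne_zero_of_essInf_pos {α : Type*} [MeasurableSpace α] {f : α → ℝ} {μ : Measure α}
    (h : 0 < essInf f μ) : μ ≠ 0 := by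
  rintro rfl
  rw [essInf_real_measure_zero] at h
  exact h.false

theorem ae_restrict_le_essSup {α : Type*} [MeasurableSpace α] {f : α → ℝ} {μ : Measure α}
    {s : Set α} (hs : MeasurableSet s) (h : BddAbove (f '' s)) :
    ∀ᵐ x ∂(μ.restrict s), f x ≤ essSup f (μ.restrict s) := by
  obtain ⟨c, hc⟩ := h
  exact ae_le_essSup ⟨c, (ae_restrict_iff' hs).2 (Eventually.of_forall fun x hx => hc ⟨x, hx, rfl⟩)⟩

theorem ae_restrict_essInf_le {α : Type*} [MeasurableSpace α] {f : α → ℝ} {μ : Measure α}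
    {s : Set α} (hs : MeasurableSet s) (h : BddBelow (f '' s)) :
    ∀ᵐ x ∂(μ.restrict s), essInf f (μ.restrict s) ≤ f x := by
  obtain ⟨c, hc⟩ := h
  exact ae_essInf_le ⟨c, (ae_restrict_iff' hs).2 (Eventually.of_forall fun x hx => hc ⟨x, hx, rfl⟩)⟩

end EssSup

/-! ### C¹ mollification in a vector space. -/

section Mollification

/-- Convolution with a bump of radius `δ` is an average over a `δ`-ball. `F` and its derivative are
uniformly continuous, so one `δ` serves both, and it is also taken small enough to keep the support
in `T`. -/
theorem exists_contDiff_approx_of_contDiff_one {E : Type*} [NormedAddCommGroup E]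
    [NormedSpace ℝ E] [FiniteDimensional ℝ E] {F : E → ℝ} (hF : ContDiff ℝ 1 F)
    (hFc : HasCompactSupport F) {T : Set E} (hT : IsOpen T) (hFT : tsupport F ⊆ T)
    {ε : ℝ} (hε : 0 < ε) :
    ∃ F' : E → ℝ, ContDiff ℝ ∞ F' ∧ tsupport F' ⊆ T ∧ (∀ y, |F' y - F y| ≤ ε) ∧
      ∀ y, ‖fderiv ℝ F' y - fderiv ℝ F y‖ ≤ ε := by
  let _ : MeasurableSpace E := borel E
  have _ : BorelSpace E := ⟨rfl⟩
  let μ : Measure E := Measure.addHaar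
  have hF' : Continuous (fderiv ℝ F) := hF.continuous_fderiv one_ne_zero
  have u1 := hFc.uniformContinuous_of_continuous hF.continuous
  have u2 := (hFc.fderiv ℝ).uniformContinuous_of_continuous hF'
  obtain ⟨δ₁, h1, h1'⟩ := Metric.uniformContinuous_iff.1 u1 ε hε
  obtain ⟨δ₂, h2, h2'⟩ := Metric.uniformContinuous_iff.1 u2 ε hε
  obtain ⟨δ₃, h3, h3'⟩ := hFc.isCompact.exists_cthickening_subset_open hT hFT
  have hδ : 0 < min δ₁ (min δ₂ δ₃) := lt_min h1 (lt_min h2 h3)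
  set δ := min δ₁ (min δ₂ δ₃) with hδ_def
  let φ : ContDiffBump (0 : E) := ⟨δ / 2, δ, by positivity, by linarith⟩
  have hconv : ∀ y, HasFDerivAt (convolution (φ.normed μ) F (ContinuousLinearMap.lsmul ℝ ℝ) μ)
      (convolution (φ.normed μ) (fderiv ℝ F) (ContinuousLinearMap.lsmul ℝ ℝ) μ y) y := by
    intro y
    have hli : LocallyIntegrable (φ.normed μ) μ := φ.continuous_normed.locallyIntegrable
    have h := hFc.hasFDerivAt_convolution_right (ContinuousLinearMap.lsmul ℝ ℝ) hli hF y
    -- Scalar multiplication stays scalar multiplication on functionals, so the derivative of the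
    -- mollification is the mollification of the derivative.
    have hL : ContinuousLinearMap.precompR E (ContinuousLinearMap.lsmul ℝ ℝ : ℝ →L[ℝ] ℝ →L[ℝ] ℝ) =
        ContinuousLinearMap.lsmul ℝ ℝ := by
      ext a D
      simp
    rwa [hL] at h
  refine ⟨convolution (φ.normed μ) F (ContinuousLinearMap.lsmul ℝ ℝ) μ, ?_, ?_, ?_, ?_⟩
  · exact φ.hasCompactSupport_normed.contDiff_convolution_left _ φ.contDiff_normed
      hF.continuous.locallyIntegrable
  · refine subset_trans (closure_minimal ?_ Metric.isClosed_cthickening) h3'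
    refine (support_convolution_subset _).trans ?_
    rw [φ.support_normed_eq]
    rintro _ ⟨a, ha, b, hb, rfl⟩
    refine Metric.mem_cthickening_of_dist_le _ b _ _ (subset_tsupport F hb) ?_
    have ha' : ‖a‖ < δ := by simpa using ha
    rw [dist_eq_norm]
    simpa using ha'.le.trans ((min_le_right _ _).trans (min_le_right _ _))
  · intro y
    have := φ.dist_normed_convolution_le (μ := μ) (x₀ := y) (ε := ε)
      hF.continuous.aestronglyMeasurable
      (fun x hx => (h1' (lt_of_lt_of_le hx (min_le_left _ _))).le)
    rwa [Real.dist_eq] at this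
  · intro y
    have := φ.dist_normed_convolution_le (μ := μ) (x₀ := y) (ε := ε) hF'.aestronglyMeasurable
      (fun x hx => (h2' (lt_of_lt_of_le hx ((min_le_right _ _).trans (min_le_left _ _)))).le)
    rwa [(hconv y).fderiv, ← dist_eq_norm]

end Mollification

theorem EuclideanSpace.norm_le_sum_abs {N : ℕ} (u : EuclideanSpace ℝ (Fin N)) :
    ‖u‖ ≤ ∑ k, |u k| := by
  rw [EuclideanSpace.norm_eq]
  refine Real.sqrt_le_iff.2 ⟨Finset.sum_nonneg fun _ _ => abs_nonneg _, ?_⟩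
  simp only [Real.norm_eq_abs]
  exact Finset.sum_sq_le_sq_sum_of_nonneg fun i _ => abs_nonneg _

/-! ### Smooth approximation of C¹ functions on the manifold. -/

section Density

variable {n N : ℕ} {M : Type*} [TopologicalSpace M]
  [ChartedSpace (EuclideanSpace ℝ (Fin n)) M]

/-- `f` is of class `C¹` and a `C¹`-limit of smooth functions supported in `L`. -/
def IsC1Approximable (X : Fin N → (x : M) → TangentSpace (𝓡 n) x) (L : Set M) (f : M → ℝ) : Prop :=
  ContMDiff (𝓡 n) 𝓘(ℝ, ℝ) 1 f ∧ ∀ ε : ℝ, 0 < ε → ∃ χ : M → ℝ, ContMDiff (𝓡 n) 𝓘(ℝ, ℝ) ∞ χ ∧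
    tsupport χ ⊆ L ∧ (∀ x, |χ x - f x| ≤ ε) ∧
    ∀ x, ‖horizontalGradient X χ x - horizontalGradient X f x‖ ≤ ε

theorem IsC1Approximable.zero (X : Fin N → (x : M) → TangentSpace (𝓡 n) x) (L : Set M) :
    IsC1Approximable X L 0 := by
  refine ⟨contMDiff_const, fun ε hε => ⟨0, contMDiff_const, ?_, ?_, ?_⟩⟩
  · simp [tsupport]
  · intro x; simpa using hε.le
  · intro x; simpa using hε.le

theorem IsC1Approximable.add {X : Fin N → (x : M) → TangentSpace (𝓡 n) x} {L : Set M}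
    (hL : IsClosed L) {f g : M → ℝ} (hf : IsC1Approximable X L f) (hg : IsC1Approximable X L g) :
    IsC1Approximable X L (f + g) := by
  refine ⟨hf.1.add hg.1, fun ε hε => ?_⟩
  obtain ⟨χ, h1, h2, h3, h4⟩ := hf.2 (ε / 2) (half_pos hε)
  obtain ⟨η, k1, k2, k3, k4⟩ := hg.2 (ε / 2) (half_pos hε)
  refine ⟨χ + η, h1.add k1, ?_, fun x => ?_, fun x => ?_⟩
  · refine closure_minimal ((Function.support_add _ _).trans ?_) hL
    exact union_subset ((subset_tsupport _).trans h2) ((subset_tsupport _).trans k2)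
  · have := abs_add_le (χ x - f x) (η x - g x)
    have e : (χ + η) x - (f + g) x = (χ x - f x) + (η x - g x) := by simp; ring
    rw [e]; linarith [h3 x, k3 x]
  · have d1 := horizontalGradient_add (X := X) (h1.mdifferentiableAt (by simp) (x := x))
      (k1.mdifferentiableAt (by simp) (x := x))
    have d2 := horizontalGradient_add (X := X) (hf.1.mdifferentiableAt (by simp) (x := x))
      (hg.1.mdifferentiableAt (by simp) (x := x))
    have e1 : χ + η = fun y => χ y + η y := rfl
    have e2 : f + g = fun y => f y + g y := rfl
    rw [e1, e2, d1, d2, add_sub_add_comm]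
    exact (norm_add_le _ _).trans (by linarith [h4 x, k4 x])

/-- Push `f` to the chart, mollify there inside a compact set, pull back and extend by zero. The
horizontal derivatives are Euclidean derivatives applied to the fields read in the chart, which are
bounded on the compact set. -/
theorem isC1Approximable_of_tsupport_subset_chart [T2Space M] [IsManifold (𝓡 n) ∞ M]
    {X : Fin N → (x : M) → TangentSpace (𝓡 n) x}
    (hX : ∀ k, ContMDiff (𝓡 n) (𝓡 n).tangent ∞
      (fun x => (⟨x, X k x⟩ : TangentBundle (𝓡 n) M)))
    {f : M → ℝ} (hf : ContMDiff (𝓡 n) 𝓘(ℝ, ℝ) 1 f) (hfc : HasCompactSupport f) (x₀ : M)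
    (hfs : tsupport f ⊆ (chartAt (EuclideanSpace ℝ (Fin n)) x₀).source) {L : Set M}
    (hfL : tsupport f ⊆ interior L) : IsC1Approximable X L f := by
  have hM1 : IsManifold (𝓡 n) 1 M := IsManifold.of_le (n := ∞) (by norm_cast)
  refine ⟨hf, fun ε hε => ?_⟩
  set e := chartAt (EuclideanSpace ℝ (Fin n)) x₀ with he
  set K := tsupport f with hK
  have hKc : IsCompact K := hfc
  have heK : IsCompact (e '' K) := hKc.image_of_continuousOn (e.continuousOn.mono hfs)
  have heKt : e '' K ⊆ e.target := by
    rintro _ ⟨x, hx, rfl⟩; exact e.map_source (hfs hx)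
  -- the push-forward of `f`
  set F : EuclideanSpace ℝ (Fin n) → ℝ := e.target.indicator (fun y => f (e.symm y)) with hFdef
  have hF0 : ∀ y ∉ e '' K, F y = 0 := by
    intro y hy
    by_cases hyt : y ∈ e.target
    · rw [hFdef, indicator_of_mem hyt]
      refine image_eq_zero_of_notMem_tsupport fun h => hy ⟨e.symm y, h, e.right_inv hyt⟩
    · rw [hFdef, indicator_of_notMem hyt]
  have hFs : tsupport F ⊆ e '' K :=
    closure_minimal (fun y hy => by_contra fun h => hy (hF0 y h)) heK.isClosed
  have hF1 : ContDiff ℝ 1 F := by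
    rw [contDiff_iff_contDiffAt]
    intro y
    by_cases hy : y ∈ e '' K
    · have hyt := heKt hy
      have h1 : ContMDiffOn (𝓡 n) 𝓘(ℝ, ℝ) 1 (fun y => f (e.symm y)) e.target :=
        hf.comp_contMDiffOn (contMDiffOn_chart_symm (x := x₀))
      have h2 := (contMDiffOn_iff_contDiffOn.1 h1).contDiffAt (e.open_target.mem_nhds hyt)
      refine h2.congr_of_eventuallyEq ?_
      filter_upwards [e.open_target.mem_nhds hyt] with z hz
      rw [hFdef, indicator_of_mem hz]
    · refine (contDiffAt_const (c := (0 : ℝ))).congr_of_eventuallyEq ?_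
      filter_upwards [heK.isClosed.isOpen_compl.mem_nhds hy] with z hz
      exact hF0 z hz
  have hFc : HasCompactSupport F := heK.of_isClosed_subset (isClosed_tsupport _) hFs
  -- a compact set in the chart
  set T : Set (EuclideanSpace ℝ (Fin n)) := e.target ∩ e.symm ⁻¹' (interior L) with hTdef
  have hT : IsOpen T := e.symm.continuousOn.isOpen_inter_preimage e.open_target isOpen_interior
  have hKT : e '' K ⊆ T := by
    rintro _ ⟨x, hx, rfl⟩
    refine ⟨e.map_source (hfs hx), ?_⟩
    rw [mem_preimage, e.left_inv (hfs hx)]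
    exact hfL hx
  obtain ⟨L', hL'c, hKL', hL'T⟩ := exists_compact_between heK hT hKT
  have hS : IsCompact (e.symm '' L') :=
    hL'c.image_of_continuousOn (e.symm.continuousOn.mono fun y hy => (hL'T hy).1)
  have hSs : e.symm '' L' ⊆ e.source := by
    rintro _ ⟨y, hy, rfl⟩; exact e.map_target (hL'T hy).1
  have hSL : e.symm '' L' ⊆ L := by
    rintro _ ⟨y, hy, rfl⟩; exact interior_subset (hL'T hy).2
  have hch : ContMDiffOn (𝓡 n) (𝓡 n) ∞ e e.source := contMDiffOn_chart (x := x₀)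
  let D : Fin N → M → EuclideanSpace ℝ (Fin n) := fun k x => mfderiv (𝓡 n) (𝓡 n) e x (X k x)
  have hbc : ContinuousOn (fun x => ∑ k, ‖D k x‖) e.source :=
    continuousOn_finsetSum _ fun k _ => (continuousOn_mfderiv_apply (hX k) e.open_source
      (contMDiffOn_chart (x := x₀))).norm
  obtain ⟨B, hB⟩ := (hS.image_of_continuousOn (hbc.mono hSs)).bddAbove
  have hB' : ∀ x ∈ e.symm '' L', ∑ k, ‖D k x‖ ≤ |B| := fun x hx => (hB ⟨x, hx, rfl⟩).trans (le_abs_self B)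
  -- The divisor `|B| + 1` pays for the chart fields in the gradient bound, and being at least 1 it
  -- keeps the error of the values below `ε`.
  have hε' : 0 < ε / (|B| + 1) := by positivity
  obtain ⟨F', hF's, hF't, hFd, hFd'⟩ := exists_contDiff_approx_of_contDiff_one hF1 hFc
    isOpen_interior (hFs.trans hKL') hε'
  have hεle : ε / (|B| + 1) ≤ ε := div_le_self hε.le (by linarith [abs_nonneg B])
  set χ : M → ℝ := e.source.indicator (fun x => F' (e x)) with hχdef
  have hχ0 : ∀ x ∉ e.symm '' L', χ x = 0 := by
    intro x hx
    by_cases hxs : x ∈ e.source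
    · rw [hχdef, indicator_of_mem hxs]
      refine image_eq_zero_of_notMem_tsupport fun h =>
        hx ⟨e x, interior_subset (hF't h), e.left_inv hxs⟩
    · rw [hχdef, indicator_of_notMem hxs]
  have hKS : K ⊆ e.symm '' L' := fun x hx =>
    ⟨e x, interior_subset (hKL' ⟨x, hx, rfl⟩), e.left_inv (hfs hx)⟩
  have hf0 : ∀ x ∉ e.symm '' L', f x = 0 := fun x hx =>
    image_eq_zero_of_notMem_tsupport fun h => hx (hKS h)
  have hfF : ∀ x ∈ e.source, f x = F (e x) := by
    intro x hx
    rw [hFdef, indicator_of_mem (e.map_source hx), e.left_inv hx]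
  have hχt : tsupport χ ⊆ e.symm '' L' :=
    closure_minimal (fun y hy => by_contra fun h => hy (hχ0 y h)) hS.isClosed
  refine ⟨χ, ?_, hχt.trans hSL, fun x => ?_, fun x => ?_⟩
  · intro x
    by_cases hx : x ∈ e.symm '' L'
    · have h1 : ContMDiffOn (𝓡 n) 𝓘(ℝ, ℝ) ∞ (fun x => F' (e x)) e.source :=
        hF's.contMDiff.comp_contMDiffOn hch
      refine (h1.contMDiffAt (e.open_source.mem_nhds (hSs hx))).congr_of_eventuallyEq ?_
      filter_upwards [e.open_source.mem_nhds (hSs hx)] with z hz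
      rw [hχdef, indicator_of_mem hz]
    · refine (contMDiffAt_const (c := (0 : ℝ))).congr_of_eventuallyEq ?_
      filter_upwards [hS.isClosed.isOpen_compl.mem_nhds hx] with z hz
      exact hχ0 z hz
  · by_cases hx : x ∈ e.source
    · rw [hfF x hx, hχdef, indicator_of_mem hx]
      exact (hFd _).trans hεle
    · have hx' : x ∉ e.symm '' L' := fun h => hx (hSs h)
      rw [hχ0 x hx', hf0 x hx']; simpa using hε.le
  · by_cases hx : x ∈ e.symm '' L'
    · have hxs := hSs hx
      have hed : MDifferentiableAt (𝓡 n) (𝓡 n) e x :=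
        (hch.contMDiffAt (e.open_source.mem_nhds hxs)).mdifferentiableAt (by simp)
      have g1 : ∀ k, horizontalGradient X χ x k =
          fderiv ℝ F' (e x) (D k x) := by
        intro k
        refine Eq.trans ?_ (horizontalGradient_comp_hasFDerivAt hed
          (hF's.differentiable (by simp) (e x)).hasFDerivAt k)
        refine congrArg (fun u : EuclideanSpace ℝ (Fin N) => u k) (horizontalGradient_congr ?_)
        filter_upwards [e.open_source.mem_nhds hxs] with z hz
        rw [hχdef, indicator_of_mem hz]
      have g2 : ∀ k, horizontalGradient X f x k =
          fderiv ℝ F (e x) (D k x) := by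
        intro k
        refine Eq.trans ?_ (horizontalGradient_comp_hasFDerivAt hed
          (hF1.differentiable (by simp) (e x)).hasFDerivAt k)
        refine congrArg (fun u : EuclideanSpace ℝ (Fin N) => u k) (horizontalGradient_congr ?_)
        filter_upwards [e.open_source.mem_nhds hxs] with z hz
        exact hfF z hz
      calc ‖horizontalGradient X χ x - horizontalGradient X f x‖
          ≤ ∑ k, |(horizontalGradient X χ x - horizontalGradient X f x) k| :=
            EuclideanSpace.norm_le_sum_abs _
        _ ≤ ∑ k, ε / (|B| + 1) * ‖D k x‖ := by
            refine Finset.sum_le_sum fun k _ => ?_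
            rw [PiLp.sub_apply, g1, g2, ← _root_.sub_apply]
            exact ((fderiv ℝ F' (e x) - fderiv ℝ F (e x)).le_opNorm _).trans
              (mul_le_mul_of_nonneg_right (hFd' _) (norm_nonneg _))
        _ ≤ ε / (|B| + 1) * |B| := by
            rw [← Finset.mul_sum]
            exact mul_le_mul_of_nonneg_left (hB' x hx) hε'.le
        _ ≤ ε / (|B| + 1) * (|B| + 1) := by gcongr; linarith
        _ = ε := by field_simp
    · have hx1 : x ∉ tsupport χ := fun h => hx (hχt h)
      have hx2 : x ∉ tsupport f := fun h => hx (hKS h)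
      rw [horizontalGradient_eq_zero_of_notMem_tsupport hx1,
        horizontalGradient_eq_zero_of_notMem_tsupport hx2]
      simpa using hε.le

/-- A partition of unity subordinate to the charts has only finitely many members meeting the
compact support, so `f` is a finite sum of pieces each living in one chart. -/
theorem isC1Approximable_of_contMDiff_one [T2Space M] [SigmaCompactSpace M] [IsManifold (𝓡 n) ∞ M]
    {X : Fin N → (x : M) → TangentSpace (𝓡 n) x}
    (hX : ∀ k, ContMDiff (𝓡 n) (𝓡 n).tangent ∞
      (fun x => (⟨x, X k x⟩ : TangentBundle (𝓡 n) M)))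
    {f : M → ℝ} (hf : ContMDiff (𝓡 n) 𝓘(ℝ, ℝ) 1 f) (hfc : HasCompactSupport f) {L : Set M}
    (hL : IsClosed L) (hfL : tsupport f ⊆ interior L) : IsC1Approximable X L f := by
  obtain ⟨ρ, hρ⟩ := SmoothPartitionOfUnity.exists_isSubordinate (𝓡 n) (isClosed_tsupport f)
    (fun x : M => (chartAt (EuclideanSpace ℝ (Fin n)) x).source)
    (fun x => (chartAt (EuclideanSpace ℝ (Fin n)) x).open_source)
    (fun x _ => mem_iUnion.2 ⟨x, mem_chart_source _ x⟩)
  have hfin := ρ.locallyFinite.finite_nonempty_inter_compact hfc.isCompact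
  have hsum : f = ∑ i ∈ hfin.toFinset, fun x => ρ i x * f x := by
    ext x
    rw [Finset.sum_apply]
    by_cases hx : x ∈ tsupport f
    · have h1 := ρ.sum_eq_one hx
      rw [finsum_eq_sum_of_support_subset (s := hfin.toFinset)] at h1
      · rw [← Finset.sum_mul, h1, one_mul]
      · intro i hi
        simp only [Finite.coe_toFinset, mem_ofPred_eq]
        exact ⟨x, hi, hx⟩
    · simp [image_eq_zero_of_notMem_tsupport hx]
  rw [hsum]
  refine Finset.sum_induction _ (IsC1Approximable X L) (fun a b ha hb => ha.add hL hb)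
    (IsC1Approximable.zero X L) fun i _ => ?_
  have hsub : tsupport (fun x => ρ i x * f x) ⊆ tsupport f :=
    closure_mono (Function.support_mul_subset_right _ _)
  refine isC1Approximable_of_tsupport_subset_chart hX ?_ ?_ i ?_ (hsub.trans hfL)
  · exact ((ρ i).contMDiff.of_le (by norm_cast)).mul hf
  · exact hfc.of_isClosed_subset (isClosed_tsupport _) hsub
  · exact (closure_mono (Function.support_mul_subset_left _ _)).trans (hρ i)

end Density

/-! ### The modular of a variable exponent. -/

section Modular

variable {M F : Type*} [MeasurableSpace M] [NormedAddCommGroup F] {μ : Measure M}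
  {Ω : Set M} {p : M → ℝ} {P : ℝ}

theorem aemeasurable_modular_integrand {f : M → F} (hf : AEStronglyMeasurable f (μ.restrict Ω))
    (hp : AEMeasurable p (μ.restrict Ω)) :
    AEMeasurable (fun x => ENNReal.ofReal (‖f x‖ ^ p x)) (μ.restrict Ω) :=
  (hf.norm.aemeasurable.pow hp).ennreal_ofReal

theorem modular_le_of_norm_le {F' : Type*} [NormedAddCommGroup F'] {f : M → F} {g : M → F'}
    {C : ℝ} (hC : 1 ≤ C)
    (hp1 : ∀ᵐ x ∂(μ.restrict Ω), 1 ≤ p x) (hpP : ∀ᵐ x ∂(μ.restrict Ω), p x ≤ P)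
    (h : ∀ᵐ x ∂(μ.restrict Ω), ‖f x‖ ≤ C * ‖g x‖) :
    modular μ Ω p f ≤ ENNReal.ofReal (C ^ P) * modular μ Ω p g := by
  rw [modular, modular, ← lintegral_const_mul' _ _ ENNReal.ofReal_ne_top]
  refine lintegral_mono_ae ?_
  filter_upwards [hp1, hpP, h] with x h1 h2 h3
  rw [← ENNReal.ofReal_mul (by positivity)]
  refine ENNReal.ofReal_le_ofReal ?_
  calc ‖f x‖ ^ p x ≤ (C * ‖g x‖) ^ p x :=
        Real.rpow_le_rpow (norm_nonneg _) h3 (by linarith)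
    _ = C ^ p x * ‖g x‖ ^ p x := Real.mul_rpow (by linarith) (norm_nonneg _)
    _ ≤ C ^ P * ‖g x‖ ^ p x := by
        gcongr

/-- A substitute for the triangle inequality: `‖f + g‖` is at most twice the larger norm, and the
bounded exponent turns the 2 into `2 ^ P`. -/
theorem modular_add_le {f g : M → F} (hf : AEStronglyMeasurable f (μ.restrict Ω))
    (hp : AEMeasurable p (μ.restrict Ω))
    (hp1 : ∀ᵐ x ∂(μ.restrict Ω), 1 ≤ p x) (hpP : ∀ᵐ x ∂(μ.restrict Ω), p x ≤ P) :
    modular μ Ω p (fun x => f x + g x) ≤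
      ENNReal.ofReal (2 ^ P) * (modular μ Ω p f + modular μ Ω p g) := by
  rw [modular, modular, modular, ← lintegral_add_left' (aemeasurable_modular_integrand hf hp),
    ← lintegral_const_mul' _ _ ENNReal.ofReal_ne_top]
  refine lintegral_mono_ae ?_
  filter_upwards [hp1, hpP] with x h1 h2
  rw [← ENNReal.ofReal_add (by positivity) (by positivity), ← ENNReal.ofReal_mul (by positivity)]
  refine ENNReal.ofReal_le_ofReal ?_
  have hmax : ‖f x + g x‖ ≤ 2 * max ‖f x‖ ‖g x‖ := by
    refine (norm_add_le _ _).trans ?_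
    linarith [le_max_left ‖f x‖ ‖g x‖, le_max_right ‖f x‖ ‖g x‖]
  have hm : max ‖f x‖ ‖g x‖ ^ p x ≤ ‖f x‖ ^ p x + ‖g x‖ ^ p x := by
    rcases max_choice ‖f x‖ ‖g x‖ with h | h <;> rw [h]
    · exact le_add_of_nonneg_right (by positivity)
    · exact le_add_of_nonneg_left (by positivity)
  have h0 : 0 ≤ max ‖f x‖ ‖g x‖ := le_max_of_le_left (norm_nonneg _)
  calc ‖f x + g x‖ ^ p x ≤ (2 * max ‖f x‖ ‖g x‖) ^ p x :=
        Real.rpow_le_rpow (norm_nonneg _) hmax (by linarith)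
    _ = 2 ^ p x * max ‖f x‖ ‖g x‖ ^ p x := Real.mul_rpow (by norm_num) h0
    _ ≤ 2 ^ P * (‖f x‖ ^ p x + ‖g x‖ ^ p x) := by
        gcongr
        norm_num

theorem tendsto_modular_add {u v : ℕ → M → F}
    (hum : ∀ j, AEStronglyMeasurable (u j) (μ.restrict Ω)) (hp : AEMeasurable p (μ.restrict Ω))
    (hp1 : ∀ᵐ x ∂(μ.restrict Ω), 1 ≤ p x) (hpP : ∀ᵐ x ∂(μ.restrict Ω), p x ≤ P)
    (hu : Tendsto (fun j => modular μ Ω p (u j)) atTop (𝓝 0))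
    (hv : Tendsto (fun j => modular μ Ω p (v j)) atTop (𝓝 0)) :
    Tendsto (fun j => modular μ Ω p (fun x => u j x + v j x)) atTop (𝓝 0) := by
  have h := ENNReal.Tendsto.const_mul (a := ENNReal.ofReal (2 ^ P)) (hu.add hv)
    (Or.inr ENNReal.ofReal_ne_top)
  rw [add_zero, mul_zero] at h
  exact tendsto_of_tendsto_of_tendsto_of_le_of_le tendsto_const_nhds h (fun _ => zero_le)
    fun j => modular_add_le (hum j) hp hp1 hpP

theorem tendsto_modular_of_dominated {u : ℕ → M → F} {D : M → ℝ}
    (hum : ∀ j, AEStronglyMeasurable (u j) (μ.restrict Ω)) (hp : AEMeasurable p (μ.restrict Ω))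
    (hp1 : ∀ᵐ x ∂(μ.restrict Ω), 1 ≤ p x)
    (hD : modular μ Ω p D < ⊤) (huD : ∀ j, ∀ᵐ x ∂(μ.restrict Ω), ‖u j x‖ ≤ D x)
    (hu : ∀ᵐ x ∂(μ.restrict Ω), Tendsto (fun j => u j x) atTop (𝓝 0)) :
    Tendsto (fun j => modular μ Ω p (u j)) atTop (𝓝 0) := by
  have h := tendsto_lintegral_of_dominated_convergence' (μ := μ.restrict Ω)
    (F := fun j x => ENNReal.ofReal (‖u j x‖ ^ p x)) (f := fun _ => 0)
    (fun x => ENNReal.ofReal (‖D x‖ ^ p x))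
    (fun j => aemeasurable_modular_integrand (hum j) hp) ?_ hD.ne ?_
  · simpa [modular] using h
  · intro j
    filter_upwards [hp1, huD j] with x h1 h2
    exact ENNReal.ofReal_le_ofReal (Real.rpow_le_rpow (norm_nonneg _)
      (h2.trans (le_abs_self _)) (by linarith))
  · filter_upwards [hp1, hu] with x h1 h2
    have h3 : Tendsto (fun j => ‖u j x‖ ^ p x) atTop (𝓝 (‖(0 : F)‖ ^ p x)) :=
      h2.norm.rpow_const (Or.inr (by linarith))
    rw [norm_zero, Real.zero_rpow (by linarith)] at h3
    simpa using ENNReal.tendsto_ofReal h3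

/-- Modular convergence is L¹ convergence of `‖u j‖ ^ p`, hence convergence in measure; a
subsequence converges a.e., and the power is removed by taking the `p x`-th root. -/
theorem exists_subseq_tendsto_of_modular {u : ℕ → M → F}
    (hum : ∀ j, AEStronglyMeasurable (u j) (μ.restrict Ω)) (hp : AEMeasurable p (μ.restrict Ω))
    (hp1 : ∀ᵐ x ∂(μ.restrict Ω), 1 ≤ p x)
    (hu : Tendsto (fun j => modular μ Ω p (u j)) atTop (𝓝 0)) :
    ∃ ns : ℕ → ℕ, StrictMono ns ∧
      ∀ᵐ x ∂(μ.restrict Ω), Tendsto (fun j => u (ns j) x) atTop (𝓝 0) := by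
  have h1 : Tendsto (fun j => eLpNorm ((fun x => ‖u j x‖ ^ p x) - (fun _ => (0 : ℝ))) 1
      (μ.restrict Ω)) atTop (𝓝 0) := by
    refine hu.congr fun j => ?_
    rw [eLpNorm_one_eq_lintegral_enorm, modular]
    refine lintegral_congr fun x => ?_
    simp only [Pi.sub_apply, sub_zero]
    rw [Real.enorm_eq_ofReal (by positivity)]
  have h2 := tendstoInMeasure_of_tendsto_eLpNorm one_ne_zero
    (fun j => (((hum j).norm.aemeasurable.pow hp)).aestronglyMeasurable)
    aestronglyMeasurable_const h1
  obtain ⟨ns, hns, hae⟩ := h2.exists_seq_tendsto_ae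
  refine ⟨ns, hns, ?_⟩
  filter_upwards [hae, hp1] with x hx h1
  rw [tendsto_zero_iff_norm_tendsto_zero]
  have h3 := hx.rpow_const (p := (p x)⁻¹) (Or.inr (inv_nonneg.2 (by linarith)))
  rw [Real.zero_rpow (inv_ne_zero (by linarith))] at h3
  refine h3.congr fun j => ?_
  exact Real.rpow_rpow_inv (norm_nonneg _) (by linarith)

theorem modular_le_of_bounded {f : M → F} {K : Set M} (hK : MeasurableSet K) {c : ℝ}
    (hp1 : ∀ᵐ x ∂(μ.restrict Ω), 1 ≤ p x) (hpP : ∀ᵐ x ∂(μ.restrict Ω), p x ≤ P)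
    (hfK : ∀ x ∉ K, f x = 0) (hfc : ∀ᵐ x ∂(μ.restrict Ω), ‖f x‖ ≤ c) :
    modular μ Ω p f ≤ ENNReal.ofReal (max c 1 ^ P) * μ K := by
  calc modular μ Ω p f
      ≤ ∫⁻ x in Ω, K.indicator (fun _ => ENNReal.ofReal (max c 1 ^ P)) x ∂μ := by
        refine lintegral_mono_ae ?_
        filter_upwards [hp1, hpP, hfc] with x h1 h2 h3
        by_cases hx : x ∈ K
        · rw [indicator_of_mem hx]
          refine ENNReal.ofReal_le_ofReal ?_
          calc ‖f x‖ ^ p x ≤ max c 1 ^ p x :=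
                Real.rpow_le_rpow (norm_nonneg _) (h3.trans (le_max_left _ _)) (by linarith)
            _ ≤ max c 1 ^ P := Real.rpow_le_rpow_of_exponent_le (le_max_right _ _) h2
        · rw [hfK x hx, norm_zero, Real.zero_rpow (by linarith)]
          simp
    _ = ENNReal.ofReal (max c 1 ^ P) * (μ.restrict Ω) K := by
        rw [lintegral_indicator_const hK]
    _ ≤ _ := by gcongr; exact Measure.restrict_le_self

/-- For `c ≤ 1 ≤ p` one has `c ^ p ≤ c`, so uniform smallness on a set of finite measure gives a
small modular whatever the exponent. -/
theorem modular_le_of_small {f : M → F} {K : Set M} (hK : MeasurableSet K) {c : ℝ} (hc0 : 0 < c)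
    (hc : c ≤ 1) (hp1 : ∀ᵐ x ∂(μ.restrict Ω), 1 ≤ p x)
    (hfK : ∀ x ∉ K, f x = 0) (hfc : ∀ x, ‖f x‖ ≤ c) :
    modular μ Ω p f ≤ ENNReal.ofReal c * μ K := by
  calc modular μ Ω p f
      ≤ ∫⁻ x in Ω, K.indicator (fun _ => ENNReal.ofReal c) x ∂μ := by
        refine lintegral_mono_ae ?_
        filter_upwards [hp1] with x h1
        by_cases hx : x ∈ K
        · rw [indicator_of_mem hx]
          refine ENNReal.ofReal_le_ofReal ?_
          calc ‖f x‖ ^ p x ≤ c ^ p x :=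
                Real.rpow_le_rpow (norm_nonneg _) (hfc x) (by linarith)
            _ ≤ c ^ (1 : ℝ) := Real.rpow_le_rpow_of_exponent_ge hc0 hc h1
            _ = c := Real.rpow_one c
        · rw [hfK x hx, norm_zero, Real.zero_rpow (by linarith)]
          simp
    _ = ENNReal.ofReal c * (μ.restrict Ω) K := by
        rw [lintegral_indicator_const hK]
    _ ≤ _ := by gcongr; exact Measure.restrict_le_self

/-- Above `δ` write `t = t ^ (1 - p) * t ^ p` with nonpositive first exponent. With `δ` free, this
replaces Hölder's inequality in comparing L¹ norms on sets of finite measure with the modular. -/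
theorem le_add_rpow_mul_rpow {t δ p P : ℝ} (ht : 0 ≤ t) (hδ : 0 < δ) (hδ1 : δ ≤ 1) (hp : 1 ≤ p)
    (hpP : p ≤ P) : t ≤ δ + δ ^ (1 - P) * t ^ p := by
  rcases le_or_gt t δ with h | h
  · have : 0 ≤ δ ^ (1 - P) * t ^ p := by positivity
    linarith
  · have ht' : 0 < t := hδ.trans h
    have h1 : t = t ^ (1 - p) * t ^ p := by
      rw [← Real.rpow_add ht']; simp
    have h2 : t ^ (1 - p) ≤ δ ^ (1 - p) := Real.rpow_le_rpow_of_nonpos hδ h.le (by linarith)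
    have h3 : δ ^ (1 - p) ≤ δ ^ (1 - P) :=
      Real.rpow_le_rpow_of_exponent_ge hδ hδ1 (by linarith)
    have h4 : t ^ (1 - p) * t ^ p ≤ δ ^ (1 - P) * t ^ p :=
      mul_le_mul_of_nonneg_right (h2.trans h3) (by positivity)
    linarith

theorem lintegral_enorm_mul_le {f ξ : M → ℝ} {K : Set M} (hK : MeasurableSet K) {c δ : ℝ}
    (hc : 0 ≤ c) (hδ : 0 < δ) (hδ1 : δ ≤ 1)
    (hp1 : ∀ᵐ x ∂(μ.restrict Ω), 1 ≤ p x) (hpP : ∀ᵐ x ∂(μ.restrict Ω), p x ≤ P)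
    (hξK : ∀ x ∉ K, ξ x = 0) (hξc : ∀ x, |ξ x| ≤ c) :
    ∫⁻ x in Ω, ‖f x * ξ x‖ₑ ∂μ ≤
      ENNReal.ofReal (c * δ) * μ K + ENNReal.ofReal (c * δ ^ (1 - P)) * modular μ Ω p f := by
  calc ∫⁻ x in Ω, ‖f x * ξ x‖ₑ ∂μ
      ≤ ∫⁻ x in Ω, (K.indicator (fun _ => ENNReal.ofReal (c * δ)) x +
          ENNReal.ofReal (c * δ ^ (1 - P)) * ENNReal.ofReal (‖f x‖ ^ p x)) ∂μ := by
        refine lintegral_mono_ae ?_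
        filter_upwards [hp1, hpP] with x h1 h2
        by_cases hx : x ∈ K
        · rw [indicator_of_mem hx, ← ENNReal.ofReal_mul (by positivity),
            ← ENNReal.ofReal_add (by positivity) (by positivity), Real.enorm_eq_ofReal_abs]
          refine ENNReal.ofReal_le_ofReal ?_
          rw [abs_mul]
          have h3 := le_add_rpow_mul_rpow (norm_nonneg (f x)) hδ hδ1 h1 h2
          calc |f x| * |ξ x| ≤ ‖f x‖ * c := by gcongr; exacts [le_rfl, hξc x]
            _ ≤ (δ + δ ^ (1 - P) * ‖f x‖ ^ p x) * c := by gcongr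
            _ = _ := by ring
        · rw [hξK x hx]; simp
    _ = ENNReal.ofReal (c * δ) * (μ.restrict Ω) K +
          ENNReal.ofReal (c * δ ^ (1 - P)) * modular μ Ω p f := by
        rw [lintegral_add_left (measurable_const.indicator hK), lintegral_indicator_const hK,
          lintegral_const_mul' _ _ ENNReal.ofReal_ne_top, modular]
    _ ≤ _ := by gcongr; exact Measure.restrict_le_self

theorem integrable_mul_of_modular {f ξ : M → ℝ} {K : Set M} (hK : MeasurableSet K)
    (hμK : μ K < ⊤) {c : ℝ} (hfm : AEStronglyMeasurable f (μ.restrict Ω))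
    (hξm : AEStronglyMeasurable ξ (μ.restrict Ω))
    (hp1 : ∀ᵐ x ∂(μ.restrict Ω), 1 ≤ p x) (hpP : ∀ᵐ x ∂(μ.restrict Ω), p x ≤ P)
    (hf : modular μ Ω p f < ⊤)
    (hξK : ∀ x ∉ K, ξ x = 0) (hξc : ∀ x, |ξ x| ≤ c) :
    Integrable (fun x => f x * ξ x) (μ.restrict Ω) := by
  refine ⟨hfm.mul hξm, ?_⟩
  rw [hasFiniteIntegral_iff_enorm]
  refine (lintegral_enorm_mul_le hK (abs_nonneg c) one_pos le_rfl hp1 hpP hξK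
    (fun x => (hξc x).trans (le_abs_self c))).trans_lt ?_
  exact ENNReal.add_lt_top.2 ⟨ENNReal.mul_lt_top ENNReal.ofReal_lt_top hμK,
    ENNReal.mul_lt_top ENNReal.ofReal_lt_top hf⟩

theorem tendsto_integral_mul_of_modular {u : ℕ → M → ℝ} {f ξ : M → ℝ} {K : Set M}
    (hK : MeasurableSet K) (hμK : μ K < ⊤) {c : ℝ}
    (hum : ∀ j, AEStronglyMeasurable (u j) (μ.restrict Ω))
    (hfm : AEStronglyMeasurable f (μ.restrict Ω))
    (hξm : AEStronglyMeasurable ξ (μ.restrict Ω))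
    (hp1 : ∀ᵐ x ∂(μ.restrict Ω), 1 ≤ p x) (hpP : ∀ᵐ x ∂(μ.restrict Ω), p x ≤ P)
    (hum' : ∀ j, modular μ Ω p (u j) < ⊤)
    (hu : Tendsto (fun j => modular μ Ω p (fun x => u j x - f x)) atTop (𝓝 0))
    (hξK : ∀ x ∉ K, ξ x = 0) (hξc : ∀ x, |ξ x| ≤ c) :
    Tendsto (fun j => ∫ x in Ω, u j x * ξ x ∂μ) atTop (𝓝 (∫ x in Ω, f x * ξ x ∂μ)) := by
  refine tendsto_integral_of_L1 _ (hfm.mul hξm) (Eventually.of_forall fun j =>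
    integrable_mul_of_modular hK hμK (hum j) hξm hp1 hpP (hum' j) hξK hξc) ?_
  have hξc' : ∀ x, |ξ x| ≤ |c| := fun x => (hξc x).trans (le_abs_self c)
  rw [ENNReal.tendsto_nhds_zero]
  intro ε hε
  have t1 : Tendsto (fun δ : ℝ => ENNReal.ofReal (|c| * δ) * μ K) (𝓝[>] 0) (𝓝 0) := by
    have h1 : Tendsto (fun δ : ℝ => |c| * δ) (𝓝[>] 0) (𝓝 (|c| * 0)) :=
      (tendsto_id.const_mul _).mono_left nhdsWithin_le_nhds
    have h2 := ENNReal.Tendsto.mul_const (b := μ K) (ENNReal.tendsto_ofReal h1) (Or.inr hμK.ne)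
    simpa using h2
  have hε2 : (0 : ENNReal) < ε / 2 := ENNReal.half_pos hε.ne'
  -- First `δ` is fixed to make the measure term small; then the modular term, despite its large
  -- constant, vanishes as `j` grows.
  obtain ⟨δ, hδ1, hδ2⟩ := ((t1.eventually (gt_mem_nhds hε2)).and
    (Ioc_mem_nhdsGT (one_pos : (0 : ℝ) < 1))).exists
  have t2 := ENNReal.Tendsto.const_mul (a := ENNReal.ofReal (|c| * δ ^ (1 - P))) hu
    (Or.inr ENNReal.ofReal_ne_top)
  rw [mul_zero] at t2
  filter_upwards [t2.eventually (gt_mem_nhds hε2)] with j hj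
  calc ∫⁻ x in Ω, ‖u j x * ξ x - f x * ξ x‖ₑ ∂μ
      = ∫⁻ x in Ω, ‖(u j x - f x) * ξ x‖ₑ ∂μ := by simp only [sub_mul]
    _ ≤ _ := lintegral_enorm_mul_le hK (abs_nonneg c) hδ2.1 hδ2.2 hp1 hpP hξK hξc'
    _ ≤ ε / 2 + ε / 2 := add_le_add hδ1.le hj.le
    _ = ε := ENNReal.add_halves ε

theorem MemVarLp.locallyIntegrableOn [TopologicalSpace M] [OpensMeasurableSpace M]
    [IsLocallyFiniteMeasure μ] {f : M → F} (hf : MemVarLp μ Ω p f)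
    (hp1 : ∀ᵐ x ∂(μ.restrict Ω), 1 ≤ p x) (hpP : ∀ᵐ x ∂(μ.restrict Ω), p x ≤ P) :
    LocallyIntegrableOn f Ω μ := by
  intro x _
  obtain ⟨U, hxU, hUo, hU⟩ := μ.exists_isOpen_measure_lt_top x
  refine ⟨Ω ∩ U, inter_mem_nhdsWithin Ω (hUo.mem_nhds hxU), ?_⟩
  have hle : μ.restrict (Ω ∩ U) ≤ μ.restrict Ω := Measure.restrict_mono inter_subset_left le_rfl
  refine ⟨hf.1.mono_measure hle, ?_⟩
  rw [hasFiniteIntegral_iff_enorm]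
  calc ∫⁻ x in Ω ∩ U, ‖f x‖ₑ ∂μ
      ≤ ∫⁻ x in Ω ∩ U, (1 + ENNReal.ofReal (‖f x‖ ^ p x)) ∂μ := by
        refine lintegral_mono_ae ?_
        filter_upwards [ae_mono hle hp1, ae_mono hle hpP] with x h1 h2
        rw [← ofReal_norm, ← ENNReal.ofReal_one, ← ENNReal.ofReal_add (by positivity)
          (by positivity)]
        refine ENNReal.ofReal_le_ofReal ?_
        simpa using le_add_rpow_mul_rpow (norm_nonneg (f x)) one_pos le_rfl h1 h2
    _ = μ (Ω ∩ U) + ∫⁻ x in Ω ∩ U, ENNReal.ofReal (‖f x‖ ^ p x) ∂μ := by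
        rw [lintegral_add_left measurable_const]; simp
    _ ≤ μ U + modular μ Ω p f := by
        gcongr
        · exact inter_subset_right
        · exact lintegral_mono' hle le_rfl
    _ < ⊤ := ENNReal.add_lt_top.2 ⟨hU, hf.2⟩

theorem memVarLp_of_tendsto {u : ℕ → M → F} {f : M → F}
    (hum : ∀ j, AEStronglyMeasurable (u j) (μ.restrict Ω))
    (hfm : AEStronglyMeasurable f (μ.restrict Ω)) (hp : AEMeasurable p (μ.restrict Ω))
    (hp1 : ∀ᵐ x ∂(μ.restrict Ω), 1 ≤ p x) (hpP : ∀ᵐ x ∂(μ.restrict Ω), p x ≤ P)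
    (hu : ∀ j, modular μ Ω p (u j) < ⊤)
    (hlim : Tendsto (fun j => modular μ Ω p (fun x => u j x - f x)) atTop (𝓝 0)) :
    MemVarLp μ Ω p f := by
  refine ⟨hfm, ?_⟩
  obtain ⟨j, hj⟩ := (hlim.eventually (gt_mem_nhds ENNReal.zero_lt_top)).exists
  have h1 := modular_add_le (f := u j) (g := fun x => f x - u j x) (hum j) hp hp1 hpP
  have h2 : modular μ Ω p (fun x => f x - u j x) = modular μ Ω p (fun x => u j x - f x) := by
    simp only [modular, norm_sub_rev]
  rw [h2] at h1
  simp only [add_sub_cancel] at h1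
  exact h1.trans_lt (ENNReal.mul_lt_top ENNReal.ofReal_lt_top (ENNReal.add_lt_top.2 ⟨hu j, hj⟩))

end Modular

/-! ### Membership in W₀ by approximation. -/

section Closure

variable {n N : ℕ} {M : Type*} [TopologicalSpace M]
  [ChartedSpace (EuclideanSpace ℝ (Fin n)) M] [MeasurableSpace M] [BorelSpace M]
  {X : Fin N → (x : M) → TangentSpace (𝓡 n) x} {μ : Measure M} {Ω : Set M} {p : M → ℝ} {P : ℝ}

theorem modular_lt_top_of_hasCompactSupport {F : Type*} [NormedAddCommGroup F] [T2Space M]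
    [IsLocallyFiniteMeasure μ] {f : M → F} (hf : Continuous f) (hfc : HasCompactSupport f)
    (hp1 : ∀ᵐ x ∂(μ.restrict Ω), 1 ≤ p x) (hpP : ∀ᵐ x ∂(μ.restrict Ω), p x ≤ P) :
    modular μ Ω p f < ⊤ := by
  obtain ⟨c, hc⟩ := hf.bounded_above_of_compact_support hfc
  refine (modular_le_of_bounded (K := tsupport f) (isClosed_tsupport f).measurableSet hp1 hpP
    (fun x hx => image_eq_zero_of_notMem_tsupport hx) (Eventually.of_forall hc)).trans_lt ?_
  exact ENNReal.mul_lt_top ENNReal.ofReal_lt_top hfc.isCompact.measure_lt_top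

/-- A modular limit of test functions and their gradients automatically has the limit field as weak
gradient, because both sides of the weak identity are continuous under modular convergence. -/
theorem memW10_of_tendsto [T2Space M] [SecondCountableTopology M] [IsManifold (𝓡 n) ∞ M]
    [IsLocallyFiniteMeasure μ]
    (hX : ∀ k, ContMDiff (𝓡 n) (𝓡 n).tangent ∞
      (fun x => (⟨x, X k x⟩ : TangentBundle (𝓡 n) M)))
    (hp : AEMeasurable p (μ.restrict Ω))
    (hp1 : ∀ᵐ x ∂(μ.restrict Ω), 1 ≤ p x) (hpP : ∀ᵐ x ∂(μ.restrict Ω), p x ≤ P)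
    {u : M → ℝ} {G : M → EuclideanSpace ℝ (Fin N)}
    (hum : AEStronglyMeasurable u (μ.restrict Ω)) (hGm : AEStronglyMeasurable G (μ.restrict Ω))
    {χ : ℕ → M → ℝ} (hχ : ∀ j, IsTestFunction n Ω (χ j))
    (hu : Tendsto (fun j => modular μ Ω p (fun x => χ j x - u x)) atTop (𝓝 0))
    (hG : Tendsto (fun j => modular μ Ω p (fun x => horizontalGradient X (χ j) x - G x))
      atTop (𝓝 0)) : MemW10 X μ Ω p u G := by
  have hχm : ∀ j, AEStronglyMeasurable (χ j) (μ.restrict Ω) := fun j =>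
    (hχ j).1.continuous.aestronglyMeasurable
  have hgm : ∀ j, AEStronglyMeasurable (horizontalGradient X (χ j)) (μ.restrict Ω) := fun j =>
    ((hχ j).continuous_horizontalGradient hX).aestronglyMeasurable
  have hχf : ∀ j, modular μ Ω p (χ j) < ⊤ := fun j =>
    modular_lt_top_of_hasCompactSupport (hχ j).1.continuous (hχ j).2.1 hp1 hpP
  have hgf : ∀ j, modular μ Ω p (horizontalGradient X (χ j)) < ⊤ := fun j =>
    modular_lt_top_of_hasCompactSupport ((hχ j).continuous_horizontalGradient hX)
      (hχ j).hasCompactSupport_horizontalGradient hp1 hpP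
  have hu' := memVarLp_of_tendsto hχm hum hp hp1 hpP hχf hu
  have hG' := memVarLp_of_tendsto hgm hGm hp hp1 hpP hgf hG
  refine ⟨⟨⟨hu'.locallyIntegrableOn hp1 hpP, hG'.locallyIntegrableOn hp1 hpP, ?_⟩, hu', hG'⟩,
    χ, hχ, hu, hG⟩
  intro k φ ξ hφ hξ hadj
  obtain ⟨c, hc⟩ := hξ.1.continuous.bounded_above_of_compact_support hξ.2.1
  obtain ⟨c', hc'⟩ := hφ.1.continuous.bounded_above_of_compact_support hφ.2.1
  have t1 := tendsto_integral_mul_of_modular (ξ := ξ) (K := tsupport ξ) (c := c)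
    (isClosed_tsupport ξ).measurableSet
    hξ.2.1.isCompact.measure_lt_top hχm hum hξ.1.continuous.aestronglyMeasurable hp1 hpP hχf
    hu (fun x hx => image_eq_zero_of_notMem_tsupport hx) hc
  have hcomp : ∀ w : M → EuclideanSpace ℝ (Fin N),
      modular μ Ω p (fun x => w x k) ≤ modular μ Ω p w := fun w => by
    have := modular_le_of_norm_le (μ := μ) (Ω := Ω) (f := fun x => w x k) (g := w) le_rfl hp1 hpP
      (Eventually.of_forall fun x => by simpa using PiLp.norm_apply_le (w x) k)
    simpa using this
  have hk : Continuous fun w : EuclideanSpace ℝ (Fin N) => w k := by fun_prop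
  have t2 := tendsto_integral_mul_of_modular (u := fun j x => horizontalGradient X (χ j) x k)
    (f := fun x => G x k) (ξ := φ) (K := tsupport φ) (c := c')
    (isClosed_tsupport φ).measurableSet
    hφ.2.1.isCompact.measure_lt_top (fun j => hk.comp_aestronglyMeasurable (hgm j))
    (hk.comp_aestronglyMeasurable hGm)
    hφ.1.continuous.aestronglyMeasurable hp1 hpP (fun j => (hcomp _).trans_lt (hgf j))
    (tendsto_of_tendsto_of_tendsto_of_le_of_le tendsto_const_nhds hG (fun _ => zero_le)
      fun j => hcomp fun x => horizontalGradient X (χ j) x - G x)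
    (fun x hx => image_eq_zero_of_notMem_tsupport hx) hc'
  refine tendsto_nhds_unique t1 (t2.congr fun j => ?_)
  -- For a test function the weak identity is the defining property of the formal adjoint, so no
  -- integration by parts is needed.
  have h := hadj (χ j) (hχ j)
  simp only [mul_comm] at h ⊢
  exact h.symm

/-- Each `ψ j` is replaced by a smooth function within `1 / (j + 1)` in C¹. All supports lie in one
compact `L` of finite measure, so these errors vanish in the modular. -/
theorem memW10_of_tendsto_contMDiff_one [T2Space M] [SecondCountableTopology M]
    [IsManifold (𝓡 n) ∞ M] [IsLocallyFiniteMeasure μ]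
    (hX : ∀ k, ContMDiff (𝓡 n) (𝓡 n).tangent ∞
      (fun x => (⟨x, X k x⟩ : TangentBundle (𝓡 n) M)))
    (hΩ : IsOpen Ω) (hp : AEMeasurable p (μ.restrict Ω))
    (hp1 : ∀ᵐ x ∂(μ.restrict Ω), 1 ≤ p x) (hpP : ∀ᵐ x ∂(μ.restrict Ω), p x ≤ P)
    {u : M → ℝ} {G : M → EuclideanSpace ℝ (Fin N)}
    (hum : AEStronglyMeasurable u (μ.restrict Ω)) (hGm : AEStronglyMeasurable G (μ.restrict Ω))
    {K : Set M} (hK : IsCompact K) (hKΩ : K ⊆ Ω)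
    {ψ : ℕ → M → ℝ} (hψ : ∀ j, ContMDiff (𝓡 n) 𝓘(ℝ, ℝ) 1 (ψ j)) (hψK : ∀ j, tsupport (ψ j) ⊆ K)
    (hu : Tendsto (fun j => modular μ Ω p (fun x => ψ j x - u x)) atTop (𝓝 0))
    (hG : Tendsto (fun j => modular μ Ω p (fun x => horizontalGradient X (ψ j) x - G x))
      atTop (𝓝 0)) : MemW10 X μ Ω p u G := by
  have hlc : LocallyCompactSpace M := ChartedSpace.locallyCompactSpace (EuclideanSpace ℝ (Fin n)) M
  obtain ⟨L, hLc, hKL, hLΩ⟩ := exists_compact_between hK hΩ hKΩ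
  have happ : ∀ j, IsC1Approximable X L (ψ j) := fun j =>
    isC1Approximable_of_contMDiff_one hX (hψ j)
      (hK.of_isClosed_subset (isClosed_tsupport _) (hψK j)) hLc.isClosed ((hψK j).trans hKL)
  have hpos : ∀ j : ℕ, (0 : ℝ) < 1 / ((j : ℝ) + 1) := fun j => by positivity
  choose χ h1 h2 h3 h4 using fun j : ℕ => (happ j).2 _ (hpos j)
  have hχ : ∀ j, IsTestFunction n Ω (χ j) := fun j =>
    ⟨h1 j, hLc.of_isClosed_subset (isClosed_tsupport _) (h2 j), (h2 j).trans hLΩ⟩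
  have hle : ∀ j : ℕ, 1 / ((j : ℝ) + 1) ≤ 1 := fun j => by
    rw [div_le_one (by positivity)]; linarith [(Nat.cast_nonneg j : (0 : ℝ) ≤ j)]
  have hψL : ∀ j, ∀ x ∉ L, x ∉ tsupport (ψ j) := fun j x hx h =>
    hx (interior_subset (hKL (hψK j h)))
  have hlim : Tendsto (fun j : ℕ => ENNReal.ofReal (1 / ((j : ℝ) + 1)) * μ L) atTop (𝓝 0) := by
    have := ENNReal.Tendsto.mul_const (b := μ L)
      (ENNReal.tendsto_ofReal (tendsto_one_div_add_atTop_nhds_zero_nat (𝕜 := ℝ)))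
      (Or.inr hLc.measure_lt_top.ne)
    simpa using this
  have m1 : Tendsto (fun j => modular μ Ω p (fun x => χ j x - ψ j x)) atTop (𝓝 0) := by
    refine tendsto_of_tendsto_of_tendsto_of_le_of_le tendsto_const_nhds hlim (fun _ => zero_le)
      fun j => modular_le_of_small hLc.isClosed.measurableSet (hpos j) (hle j) hp1 ?_ (h3 j)
    intro x hx
    rw [image_eq_zero_of_notMem_tsupport (hψL j x hx),
      image_eq_zero_of_notMem_tsupport fun h => hx (h2 j h), sub_zero]
  have m2 : Tendsto (fun j => modular μ Ω p
      (fun x => horizontalGradient X (χ j) x - horizontalGradient X (ψ j) x)) atTop (𝓝 0) := by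
    refine tendsto_of_tendsto_of_tendsto_of_le_of_le tendsto_const_nhds hlim (fun _ => zero_le)
      fun j => modular_le_of_small hLc.isClosed.measurableSet (hpos j) (hle j) hp1 ?_ (h4 j)
    intro x hx
    rw [horizontalGradient_eq_zero_of_notMem_tsupport (hψL j x hx),
      horizontalGradient_eq_zero_of_notMem_tsupport fun h => hx (h2 j h), sub_zero]
  have c1 : ∀ j, Continuous (horizontalGradient X (ψ j)) := fun j =>
    continuousOn_univ.1 (continuousOn_horizontalGradient hX isOpen_univ (hψ j).contMDiffOn)
  refine memW10_of_tendsto hX hp hp1 hpP hum hGm hχ ?_ ?_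
  · refine (tendsto_modular_add (fun j => ?_) hp hp1 hpP m1 hu).congr fun j => ?_
    · exact ((h1 j).continuous.sub (hψ j).continuous).aestronglyMeasurable
    · simp only [sub_add_sub_cancel]
  · refine (tendsto_modular_add (fun j => ?_) hp hp1 hpP m2 hG).congr fun j => ?_
    · exact (((hχ j).continuous_horizontalGradient hX).sub (c1 j)).aestronglyMeasurable
    · simp only [sub_add_sub_cancel]

end Closure

/-! ### Powers with variable exponent as C¹ functions of two variables. -/

section RealFunctions

/-- `s ^ t` for `s > 0`, extended by zero to `s ≤ 0`. -/
noncomputable def posRpow (z : ℝ × ℝ) : ℝ := if z.1 ≤ 0 then 0 else z.1 ^ z.2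

/-- The partial derivative of `posRpow` in the base. -/
noncomputable def posRpowDerivBase (z : ℝ × ℝ) : ℝ := if z.1 ≤ 0 then 0 else z.2 * z.1 ^ (z.2 - 1)

/-- The partial derivative of `posRpow` in the exponent. -/
noncomputable def posRpowDerivExp (z : ℝ × ℝ) : ℝ := if z.1 ≤ 0 then 0 else z.1 ^ z.2 * Real.log z.1

theorem posRpow_nonneg (z : ℝ × ℝ) : 0 ≤ posRpow z := by
  unfold posRpow; split_ifs with h
  · exact le_rfl
  · exact Real.rpow_nonneg (not_le.1 h).le _

/-- Exponent 0 must be excluded: `0 ^ 0 = 1`, whereas `posRpow` vanishes at base zero. -/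
theorem posRpow_eq {s t : ℝ} (hs : 0 ≤ s) (ht : t ≠ 0) : posRpow (s, t) = s ^ t := by
  unfold posRpow
  rcases hs.eq_or_lt with rfl | h
  · simp [Real.zero_rpow ht]
  · simp [not_le.2 h]

theorem posRpowDerivBase_eq {s t : ℝ} (hs : 0 ≤ s) (ht : t - 1 ≠ 0) :
    posRpowDerivBase (s, t) = t * s ^ (t - 1) := by
  unfold posRpowDerivBase
  rcases hs.eq_or_lt with rfl | h
  · simp [Real.zero_rpow ht]
  · simp [not_le.2 h]

/-- Near `(0, t₀)` the exponents stay above some `t₁ > 1`, so one extra power `t₁ - 1 > 0` of the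
base is available; the logarithm is absorbed by `|log s| * s ≤ 1`. This gives a vanishing derivative
at base zero and continuity of the partial derivatives there. -/
theorem eventually_posRpow_bounds {t₀ : ℝ} (ht : 1 < t₀) :
    ∃ k : ℝ × ℝ → ℝ, Tendsto k (𝓝 (0, t₀)) (𝓝 0) ∧ ∀ᶠ z in 𝓝 ((0 : ℝ), t₀),
      |posRpow z| ≤ |z.1| * k z ∧ |posRpowDerivBase z| ≤ k z ∧ |posRpowDerivExp z| ≤ k z := by
  obtain ⟨t₁, h1, h1'⟩ := exists_between ht
  have hk : Tendsto (fun z : ℝ × ℝ => (t₀ + 1) * |z.1| ^ (t₁ - 1)) (𝓝 (0, t₀)) (𝓝 0) := by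
    have h2 : ContinuousAt (fun z : ℝ × ℝ => (t₀ + 1) * |z.1| ^ (t₁ - 1)) (0, t₀) :=
      continuousAt_const.mul
        ((continuous_fst.abs.continuousAt).rpow_const (Or.inr (by linarith)))
    have h3 := h2.tendsto
    simpa [Real.zero_rpow (by linarith : t₁ - 1 ≠ 0)] using h3
  refine ⟨_, hk, ?_⟩
  have e1 : ∀ᶠ z in 𝓝 ((0 : ℝ), t₀), z.1 < 1 :=
    continuous_fst.continuousAt.eventually (gt_mem_nhds (by norm_num))
  have e2 : ∀ᶠ z in 𝓝 ((0 : ℝ), t₀), t₁ < z.2 :=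
    continuous_snd.continuousAt.eventually (lt_mem_nhds h1')
  have e3 : ∀ᶠ z in 𝓝 ((0 : ℝ), t₀), z.2 < t₀ + 1 :=
    continuous_snd.continuousAt.eventually (gt_mem_nhds (by linarith))
  filter_upwards [e1, e2, e3] with z hz1 hz2 hz3
  have hk0 : 0 ≤ (t₀ + 1) * |z.1| ^ (t₁ - 1) := by positivity
  rcases le_or_gt z.1 0 with hz | hz
  · simp only [posRpow, posRpowDerivBase, posRpowDerivExp, if_pos hz, abs_zero]
    exact ⟨by positivity, hk0, hk0⟩
  · simp only [posRpow, posRpowDerivBase, posRpowDerivExp, if_neg (not_le.2 hz)]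
    rw [abs_of_pos hz, abs_of_nonneg (Real.rpow_nonneg hz.le _), abs_mul,
      abs_of_nonneg (Real.rpow_nonneg hz.le (z.2 - 1)), abs_mul,
      abs_of_nonneg (Real.rpow_nonneg hz.le _), abs_of_pos (by linarith : 0 < z.2)]
    have m1 : z.1 ^ (z.2 - 1) ≤ z.1 ^ (t₁ - 1) :=
      Real.rpow_le_rpow_of_exponent_ge hz hz1.le (by linarith)
    have m2 : z.1 ^ z.2 = z.1 * z.1 ^ (z.2 - 1) := by
      rw [← Real.rpow_one_add' hz.le (by linarith)]; ring_nf
    have m3 : 0 ≤ z.1 ^ (t₁ - 1) := Real.rpow_nonneg hz.le _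
    have m4 : z.1 ^ (t₁ - 1) ≤ (t₀ + 1) * z.1 ^ (t₁ - 1) :=
      le_mul_of_one_le_left m3 (by linarith)
    refine ⟨?_, ?_, ?_⟩
    · rw [m2]; gcongr; exact m1.trans m4
    · exact mul_le_mul hz3.le m1 (Real.rpow_nonneg hz.le _) (by linarith)
    · have m5 : |Real.log z.1| * z.1 ≤ 1 := by
        have := (Real.abs_log_mul_self_lt z.1 hz hz1.le).le
        rwa [abs_mul, abs_of_pos hz] at this
      calc z.1 ^ z.2 * |Real.log z.1| = z.1 ^ (z.2 - 1) * (|Real.log z.1| * z.1) := by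
            rw [m2]; ring
        _ ≤ z.1 ^ (z.2 - 1) * 1 := by gcongr
        _ ≤ _ := by rw [mul_one]; exact m1.trans m4

theorem hasFDerivAt_posRpow {z : ℝ × ℝ} (hz : 1 < z.2) :
    HasFDerivAt posRpow (posRpowDerivBase z • ContinuousLinearMap.fst ℝ ℝ ℝ +
      posRpowDerivExp z • ContinuousLinearMap.snd ℝ ℝ ℝ) z := by
  rcases lt_trichotomy z.1 0 with h | h | h
  · have e : posRpow =ᶠ[𝓝 z] fun _ => 0 := by
      filter_upwards [continuous_fst.continuousAt.eventually (gt_mem_nhds h)] with y hy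
      simp [posRpow, le_of_lt hy]
    have := (hasFDerivAt_const (𝕜 := ℝ) (0 : ℝ) z).congr_of_eventuallyEq e
    simpa [posRpowDerivBase, posRpowDerivExp, h.le] using this
  · obtain ⟨s, t⟩ := z
    obtain rfl : s = 0 := h
    have e : (posRpowDerivBase (0, t) • ContinuousLinearMap.fst ℝ ℝ ℝ +
      posRpowDerivExp (0, t) • ContinuousLinearMap.snd ℝ ℝ ℝ) = 0 := by
      simp [posRpowDerivBase, posRpowDerivExp]
    rw [e, hasFDerivAt_iff_isLittleO, Asymptotics.isLittleO_iff]
    intro c hc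
    obtain ⟨k, hk, hb⟩ := eventually_posRpow_bounds hz
    filter_upwards [hb, hk.eventually (gt_mem_nhds hc)] with y hy hky
    have h0 : posRpow (0, t) = 0 := by simp [posRpow]
    simp only [h0, sub_zero, _root_.zero_apply, Real.norm_eq_abs]
    have h1 : |y.1| ≤ ‖y - (0, t)‖ := by
      have := norm_fst_le (y - (0, t)); simpa using this
    calc |posRpow y| ≤ |y.1| * k y := hy.1
      _ ≤ |y.1| * c := by gcongr
      _ ≤ ‖y - (0, t)‖ * c := by gcongr
      _ = _ := mul_comm _ _
  · have e : posRpow =ᶠ[𝓝 z] fun y => y.1 ^ y.2 := by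
      filter_upwards [continuous_fst.continuousAt.eventually (lt_mem_nhds h)] with y hy
      simp [posRpow, not_le.2 hy]
    have := (Real.hasStrictFDerivAt_rpow_of_pos z h).hasFDerivAt.congr_of_eventuallyEq e
    simpa [posRpowDerivBase, posRpowDerivExp, not_le.2 h] using this

theorem continuousAt_posRpowDeriv {z : ℝ × ℝ} (hz : 1 < z.2) :
    ContinuousAt posRpowDerivBase z ∧ ContinuousAt posRpowDerivExp z := by
  rcases lt_trichotomy z.1 0 with h | h | h
  · have e := continuous_fst.continuousAt.eventually (gt_mem_nhds h)
    constructor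
    · refine (continuousAt_const (y := (0 : ℝ))).congr ?_
      filter_upwards [e] with y hy
      simp [posRpowDerivBase, le_of_lt hy]
    · refine (continuousAt_const (y := (0 : ℝ))).congr ?_
      filter_upwards [e] with y hy
      simp [posRpowDerivExp, le_of_lt hy]
  · obtain ⟨s, t⟩ := z
    obtain rfl : s = 0 := h
    obtain ⟨k, hk, hb⟩ := eventually_posRpow_bounds hz
    constructor
    · have : posRpowDerivBase (0, t) = 0 := by simp [posRpowDerivBase]
      rw [ContinuousAt, this]
      exact squeeze_zero_norm' (hb.mono fun y hy => hy.2.1) hk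
    · have : posRpowDerivExp (0, t) = 0 := by simp [posRpowDerivExp]
      rw [ContinuousAt, this]
      exact squeeze_zero_norm' (hb.mono fun y hy => hy.2.2) hk
  · have e := continuous_fst.continuousAt.eventually (lt_mem_nhds h)
    constructor
    · have c : ContinuousAt (fun y : ℝ × ℝ => y.2 * y.1 ^ (y.2 - 1)) z :=
        continuousAt_snd.mul (continuousAt_fst.rpow (continuousAt_snd.sub continuousAt_const)
          (Or.inl h.ne'))
      refine c.congr ?_
      filter_upwards [e] with y hy
      simp [posRpowDerivBase, not_le.2 hy]
    · have c : ContinuousAt (fun y : ℝ × ℝ => y.1 ^ y.2 * Real.log y.1) z :=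
        (continuousAt_fst.rpow continuousAt_snd (Or.inl h.ne')).mul
          (continuousAt_fst.log h.ne')
      refine c.congr ?_
      filter_upwards [e] with y hy
      simp [posRpowDerivExp, not_le.2 hy]

/-- This makes `φ ^ p` a C¹ function even where `φ` touches zero; it is the place where `p > 1` is
needed for the cut-off. -/
theorem contDiffAt_posRpow {z : ℝ × ℝ} (hz : 1 < z.2) : ContDiffAt ℝ 1 posRpow z := by
  refine contDiffAt_one_iff.2 ⟨fun z => posRpowDerivBase z • ContinuousLinearMap.fst ℝ ℝ ℝ +
    posRpowDerivExp z • ContinuousLinearMap.snd ℝ ℝ ℝ, {y | 1 < y.2}, ?_, ?_, ?_⟩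
  · exact (isOpen_lt continuous_const continuous_snd).mem_nhds hz
  · intro y hy
    have := continuousAt_posRpowDeriv hy
    exact ((this.1.smul continuousAt_const).add
      (this.2.smul continuousAt_const)).continuousWithinAt
  · exact fun y hy => hasFDerivAt_posRpow hy

theorem hasDerivAt_max_zero_sq (s : ℝ) : HasDerivAt (fun s : ℝ => max s 0 ^ 2) (2 * max s 0) s := by
  rcases lt_trichotomy s 0 with h | rfl | h
  · have e : (fun s : ℝ => max s 0 ^ 2) =ᶠ[𝓝 s] fun _ => 0 := by
      filter_upwards [gt_mem_nhds h] with y hy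
      simp [max_eq_right hy.le]
    simpa [max_eq_right h.le] using (hasDerivAt_const s (0 : ℝ)).congr_of_eventuallyEq e
  · have hO : (fun s : ℝ => max s 0 ^ 2) =O[𝓝 0] fun s => ‖s - 0‖ ^ 2 := by
      refine Asymptotics.isBigO_of_le _ fun s => ?_
      rw [sub_zero, norm_pow, norm_pow, norm_norm]
      gcongr
      rw [Real.norm_eq_abs, Real.norm_eq_abs, abs_of_nonneg (le_max_right _ _)]
      exact max_le (le_abs_self _) (abs_nonneg _)
    have := (hO.hasFDerivAt (by norm_num)).hasDerivAt
    simpa using this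
  · have e : (fun s : ℝ => max s 0 ^ 2) =ᶠ[𝓝 s] fun s => s ^ 2 := by
      filter_upwards [lt_mem_nhds h] with y hy
      simp [max_eq_left (le_of_lt hy)]
    simpa [max_eq_left h.le] using (hasDerivAt_pow 2 s).congr_of_eventuallyEq e

/-- A `C¹` function with values in `[ε / 2, ∞)` that equals `s + ε` for `s ≥ 0`. -/
noncomputable def posShift (ε s : ℝ) : ℝ := ε / 2 + (max (s + ε) 0 ^ 2 - max s 0 ^ 2) / (2 * ε)

/-- The derivative of `posShift`. -/
noncomputable def posShiftDeriv (ε s : ℝ) : ℝ := (max (s + ε) 0 - max s 0) / ε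

theorem hasDerivAt_posShift {ε : ℝ} (hε : 0 < ε) (s : ℝ) :
    HasDerivAt (posShift ε) (posShiftDeriv ε s) s := by
  have h1 := (hasDerivAt_max_zero_sq (s + ε)).comp_add_const s ε
  have h2 := ((h1.sub (hasDerivAt_max_zero_sq s)).div_const (2 * ε)).const_add (ε / 2)
  refine h2.congr_deriv ?_
  rw [posShiftDeriv]
  field_simp

theorem continuous_posShiftDeriv (ε : ℝ) : Continuous (posShiftDeriv ε) := by
  unfold posShiftDeriv; fun_prop

theorem posShift_of_nonneg {ε s : ℝ} (hε : 0 < ε) (hs : 0 ≤ s) : posShift ε s = s + ε := by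
  rw [posShift, max_eq_left hs, max_eq_left (by linarith)]
  field_simp; ring

theorem posShiftDeriv_of_nonneg {ε s : ℝ} (hε : 0 < ε) (hs : 0 ≤ s) : posShiftDeriv ε s = 1 := by
  rw [posShiftDeriv, max_eq_left hs, max_eq_left (by linarith)]
  field_simp; ring

/-- The smooth approximants of `v` may be negative; this lower bound keeps negative powers of the
shifted values bounded along them. -/
theorem half_le_posShift {ε : ℝ} (hε : 0 < ε) (s : ℝ) : ε / 2 ≤ posShift ε s := by
  have h : max s 0 ^ 2 ≤ max (s + ε) 0 ^ 2 := by
    gcongr; linarith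
  have : 0 ≤ (max (s + ε) 0 ^ 2 - max s 0 ^ 2) / (2 * ε) :=
    div_nonneg (by linarith) (by linarith)
  rw [posShift]; linarith

theorem abs_posShiftDeriv_le {ε : ℝ} (hε : 0 < ε) (s : ℝ) : |posShiftDeriv ε s| ≤ 1 := by
  have h1 : max s 0 ≤ max (s + ε) 0 := by gcongr; linarith
  have h2 : max (s + ε) 0 ≤ max s 0 + ε :=
    max_le (by linarith [le_max_left s 0]) (by linarith [le_max_right s 0])
  rw [posShiftDeriv, abs_of_nonneg (div_nonneg (by linarith) hε.le), div_le_one hε]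
  linarith

/-- `(s, t) ↦ posShift ε s ^ t`. -/
noncomputable def posShiftRpow (ε : ℝ) (z : ℝ × ℝ) : ℝ := posShift ε z.1 ^ z.2

theorem posShift_pos {ε : ℝ} (hε : 0 < ε) (s : ℝ) : 0 < posShift ε s :=
  (half_pos hε).trans_le (half_le_posShift hε s)

theorem hasFDerivAt_posShiftRpow {ε : ℝ} (hε : 0 < ε) (z : ℝ × ℝ) :
    HasFDerivAt (posShiftRpow ε)
      ((z.2 * posShift ε z.1 ^ (z.2 - 1) * posShiftDeriv ε z.1) • ContinuousLinearMap.fst ℝ ℝ ℝ +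
        (posShift ε z.1 ^ z.2 * Real.log (posShift ε z.1)) • ContinuousLinearMap.snd ℝ ℝ ℝ) z := by
  have h1 : HasFDerivAt (fun z : ℝ × ℝ => posShift ε z.1)
      (posShiftDeriv ε z.1 • ContinuousLinearMap.fst ℝ ℝ ℝ) z :=
    (hasDerivAt_posShift hε z.1).comp_hasFDerivAt z hasFDerivAt_fst
  have h2 := h1.rpow hasFDerivAt_snd (posShift_pos hε z.1)
  refine h2.congr_fderiv ?_
  rw [smul_smul]

theorem contDiff_posShiftRpow {ε : ℝ} (hε : 0 < ε) : ContDiff ℝ 1 (posShiftRpow ε) := by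
  have hd : Differentiable ℝ (posShift ε) := fun s => (hasDerivAt_posShift hε s).differentiableAt
  have hd' : deriv (posShift ε) = posShiftDeriv ε := funext fun s => (hasDerivAt_posShift hε s).deriv
  have h : ContDiff ℝ 1 (posShift ε) := by
    rw [contDiff_one_iff_deriv, hd']
    exact ⟨hd, continuous_posShiftDeriv ε⟩
  exact (h.comp contDiff_fst).rpow contDiff_snd fun z => (posShift_pos hε z.1).ne'

theorem fderiv_posShiftRpow_base {ε : ℝ} (hε : 0 < ε) (z : ℝ × ℝ) :
    fderiv ℝ (posShiftRpow ε) z (1, 0) =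
      z.2 * posShift ε z.1 ^ (z.2 - 1) * posShiftDeriv ε z.1 := by
  rw [(hasFDerivAt_posShiftRpow hε z).fderiv]; simp

theorem fderiv_posShiftRpow_exp {ε : ℝ} (hε : 0 < ε) (z : ℝ × ℝ) :
    fderiv ℝ (posShiftRpow ε) z (0, 1) =
      posShift ε z.1 ^ z.2 * Real.log (posShift ε z.1) := by
  rw [(hasFDerivAt_posShiftRpow hε z).fderiv]; simp

/-- For `h ≥ 1` the negative exponent bounds the powers by 1 and beats the logarithm through `log h
≤ h ^ (-β) / (-β)`; for `c ≤ h ≤ 1` the worst case is base `c` with the least exponent. `B` adds up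
the bounds of all cases. -/
theorem exists_bound_rpow_of_neg {c α β : ℝ} (hc : 0 < c) (hc1 : c ≤ 1) (hβ : β < 0) :
    ∃ B : ℝ, 0 ≤ B ∧ ∀ h t : ℝ, c ≤ h → α ≤ t → t ≤ β →
      h ^ t ≤ B ∧ h ^ (t - 1) ≤ B ∧ |h ^ t * Real.log h| ≤ B := by
  have k1 : 0 ≤ c ^ α := by positivity
  have k2 : 0 ≤ c ^ (α - 1) := by positivity
  have k3 : 0 ≤ c ^ α * |Real.log c| := by positivity
  have k4 : 0 < 1 / (-β) := one_div_pos.2 (neg_pos.2 hβ)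
  refine ⟨1 + c ^ α + c ^ (α - 1) + c ^ α * |Real.log c| + 1 / (-β), by positivity, ?_⟩
  intro h t hch hαt htβ
  have hh : 0 < h := hc.trans_le hch
  have key : ∀ a b : ℝ, a ≤ b → b ≤ 0 → h ^ b ≤ 1 + c ^ a := by
    intro a b hab hb
    have k5 : 0 ≤ c ^ a := by positivity
    rcases le_total 1 h with h1 | h1
    · have := Real.rpow_le_one_of_one_le_of_nonpos h1 hb
      linarith
    · have m1 : h ^ b ≤ h ^ a := Real.rpow_le_rpow_of_exponent_ge hh h1 hab
      have m2 : h ^ a ≤ c ^ a := Real.rpow_le_rpow_of_nonpos hc hch (by linarith)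
      linarith
  refine ⟨?_, ?_, ?_⟩
  · have := key α t hαt (by linarith)
    linarith
  · have := key (α - 1) (t - 1) (by linarith) (by linarith)
    linarith
  · rw [abs_mul, abs_of_pos (Real.rpow_pos_of_pos hh t)]
    rcases le_total 1 h with h1 | h1
    · rw [abs_of_nonneg (Real.log_nonneg h1)]
      have m1 : Real.log h ≤ h ^ (-β) / (-β) := Real.log_le_rpow_div hh.le (by linarith)
      have m2 : h ^ t ≤ h ^ β := Real.rpow_le_rpow_of_exponent_le h1 htβ
      have m3 : h ^ t * Real.log h ≤ h ^ β * (h ^ (-β) / (-β)) :=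
        mul_le_mul m2 m1 (Real.log_nonneg h1) (by positivity)
      have m4 : h ^ β * (h ^ (-β) / (-β)) = 1 / (-β) := by
        rw [← mul_div_assoc, ← Real.rpow_add hh]; simp
      linarith
    · have m1 : h ^ t ≤ h ^ α := Real.rpow_le_rpow_of_exponent_ge hh h1 hαt
      have m2 : h ^ α ≤ c ^ α := Real.rpow_le_rpow_of_nonpos hc hch (by linarith)
      have m3 : |Real.log h| ≤ |Real.log c| := by
        rw [abs_of_nonpos (Real.log_nonpos hh.le h1), abs_of_nonpos (Real.log_nonpos hc.le hc1)]
        exact neg_le_neg (Real.log_le_log hc hch)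
      have m4 : h ^ t * |Real.log h| ≤ c ^ α * |Real.log c| :=
        mul_le_mul (m1.trans m2) m3 (abs_nonneg _) k1
      linarith

end RealFunctions

/-! ### Superposition in W₀. -/

section Superposition

variable {n N : ℕ} {M : Type*} [TopologicalSpace M]
  [ChartedSpace (EuclideanSpace ℝ (Fin n)) M] [MeasurableSpace M] [BorelSpace M]
  {X : Fin N → (x : M) → TangentSpace (𝓡 n) x} {μ : Measure M} {Ω : Set M} {p : M → ℝ} {P : ℝ}

theorem ContinuousOn.aestronglyMeasurable_restrict_isOpen [SecondCountableTopology M]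
    {F : Type*} [NormedAddCommGroup F] {f : M → F}
    (hΩ : IsOpen Ω) (hf : ContinuousOn f Ω) : AEStronglyMeasurable f (μ.restrict Ω) :=
  hf.aestronglyMeasurable hΩ.measurableSet

/-- With test functions `f j` approximating `w`, the functions `Φ * Θ (f j, a)` are C¹, supported in
`K`, and obey the classical chain rule. Boundedness of `Θ` and its partial derivatives over `K`,
uniformly in the first variable, gives domination. -/
theorem memW10_mul_comp [T2Space M] [SecondCountableTopology M] [IsManifold (𝓡 n) ∞ M]
    [IsLocallyFiniteMeasure μ]
    (hX : ∀ k, ContMDiff (𝓡 n) (𝓡 n).tangent ∞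
      (fun x => (⟨x, X k x⟩ : TangentBundle (𝓡 n) M)))
    (hΩ : IsOpen Ω) (hp : AEMeasurable p (μ.restrict Ω))
    (hp1 : ∀ᵐ x ∂(μ.restrict Ω), 1 ≤ p x) (hpP : ∀ᵐ x ∂(μ.restrict Ω), p x ≤ P)
    {K : Set M} (hK : IsCompact K) (hKΩ : K ⊆ Ω) {Φ a : M → ℝ}
    (hΦ : ContMDiffOn (𝓡 n) 𝓘(ℝ, ℝ) 1 Φ Ω) (hΦK : tsupport Φ ⊆ K)
    (ha : ContMDiffOn (𝓡 n) 𝓘(ℝ, ℝ) 1 a Ω) {Θ : ℝ × ℝ → ℝ} (hΘ : ContDiff ℝ 1 Θ) {B : ℝ}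
    (hB : ∀ s, ∀ x ∈ K, |Θ (s, a x)| ≤ B ∧ |fderiv ℝ Θ (s, a x) (1, 0)| ≤ B ∧
      |fderiv ℝ Θ (s, a x) (0, 1)| ≤ B)
    {w : M → ℝ} {Hw : M → EuclideanSpace ℝ (Fin N)} (hw : MemW10 X μ Ω p w Hw) :
    MemW10 X μ Ω p (fun x => Φ x * Θ (w x, a x))
      (fun x => Θ (w x, a x) • horizontalGradient X Φ x +
        Φ x • (fderiv ℝ Θ (w x, a x) (1, 0) • Hw x +
          fderiv ℝ Θ (w x, a x) (0, 1) • horizontalGradient X a x)) := by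
  obtain ⟨⟨-, ⟨hwm, -⟩, ⟨hHm, hHf⟩⟩, f', hf', hfw', hfH'⟩ := hw
  have hgc : ∀ j, Continuous (horizontalGradient X (f' j)) := fun j =>
    (hf' j).continuous_horizontalGradient hX
  -- The derivatives of `Θ` are merely continuous, so convergence of the compositions rests on a.e.
  -- convergence, obtained along a subsequence.
  obtain ⟨ns, hns, hae⟩ := exists_subseq_tendsto_of_modular (u := fun j x => f' j x - w x)
    (fun j => (hf' j).1.continuous.aestronglyMeasurable.sub hwm) hp hp1 hfw'
  set f : ℕ → M → ℝ := fun j => f' (ns j) with hfdef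
  have hfH := hfH'.comp hns.tendsto_atTop
  have hf1 : ∀ j, ContMDiff (𝓡 n) 𝓘(ℝ, ℝ) 1 (f j) := fun j =>
    (hf' (ns j)).1.of_le (by norm_cast)
  have hfm : ∀ j, AEStronglyMeasurable (f j) (μ.restrict Ω) := fun j =>
    (hf1 j).continuous.aestronglyMeasurable
  have hflim : ∀ᵐ x ∂(μ.restrict Ω), Tendsto (fun j => f j x) atTop (𝓝 (w x)) := by
    filter_upwards [hae] with x hx
    simpa using hx.add_const (w x)
  -- continuity and measurability
  set Θs : ℝ × ℝ → ℝ := fun z => fderiv ℝ Θ z (1, 0) with hΘs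
  set Θt : ℝ × ℝ → ℝ := fun z => fderiv ℝ Θ z (0, 1) with hΘt
  have cΘ : Continuous Θ := hΘ.continuous
  have cΘs : Continuous Θs := (hΘ.continuous_fderiv one_ne_zero).clm_apply continuous_const
  have cΘt : Continuous Θt := (hΘ.continuous_fderiv one_ne_zero).clm_apply continuous_const
  have cgΦ := continuousOn_horizontalGradient hX hΩ hΦ
  have cga := continuousOn_horizontalGradient hX hΩ ha
  have mΦ : AEStronglyMeasurable Φ (μ.restrict Ω) :=
    hΦ.continuousOn.aestronglyMeasurable_restrict_isOpen hΩ
  have ma : AEStronglyMeasurable a (μ.restrict Ω) :=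
    ha.continuousOn.aestronglyMeasurable_restrict_isOpen hΩ
  have mgΦ : AEStronglyMeasurable (horizontalGradient X Φ) (μ.restrict Ω) :=
    cgΦ.aestronglyMeasurable_restrict_isOpen hΩ
  have mga : AEStronglyMeasurable (horizontalGradient X a) (μ.restrict Ω) :=
    cga.aestronglyMeasurable_restrict_isOpen hΩ
  have mcomp : ∀ (Ξ : ℝ × ℝ → ℝ), Continuous Ξ → ∀ u : M → ℝ,
      AEStronglyMeasurable u (μ.restrict Ω) →
      AEStronglyMeasurable (fun x => Ξ (u x, a x)) (μ.restrict Ω) := fun Ξ hΞ u hu =>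
    hΞ.comp_aestronglyMeasurable (hu.prodMk ma)
  have lcomp : ∀ (Ξ : ℝ × ℝ → ℝ), Continuous Ξ → ∀ x, Tendsto (fun j => f j x) atTop (𝓝 (w x)) →
      Tendsto (fun j => Ξ (f j x, a x) - Ξ (w x, a x)) atTop (𝓝 0) := fun Ξ hΞ x hx => by
    have h1 : Tendsto (fun j => (f j x, a x)) atTop (𝓝 (w x, a x)) :=
      hx.prodMk_nhds tendsto_const_nhds
    have h2 := ((hΞ.tendsto _).comp h1).sub_const (Ξ (w x, a x))
    rwa [sub_self] at h2
  -- bounds on `K`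
  obtain ⟨c₁, hc₁⟩ := hK.exists_bound_of_continuousOn (hΦ.continuousOn.mono hKΩ)
  obtain ⟨c₂, hc₂⟩ := hK.exists_bound_of_continuousOn (cgΦ.mono hKΩ)
  obtain ⟨c₃, hc₃⟩ := hK.exists_bound_of_continuousOn (cga.mono hKΩ)
  have hΦ0 : ∀ x ∉ K, Φ x = 0 := fun x hx =>
    image_eq_zero_of_notMem_tsupport fun h => hx (hΦK h)
  have hgΦ0 : ∀ x ∉ K, horizontalGradient X Φ x = 0 := fun x hx =>
    horizontalGradient_eq_zero_of_notMem_tsupport fun h => hx (hΦK h)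
  have hdiff : ∀ (Ξ : ℝ × ℝ → ℝ) x, (∀ s, |Ξ (s, a x)| ≤ B) → ∀ s s',
      |Ξ (s, a x) - Ξ (s', a x)| ≤ 2 * B := fun Ξ x h s s' => by
    have := abs_sub (Ξ (s, a x)) (Ξ (s', a x))
    linarith [h s, h s']
  have hconst : ∀ c : ℝ, modular μ Ω p (K.indicator (fun _ => c)) < ⊤ := fun c => by
    refine (modular_le_of_bounded hK.isClosed.measurableSet (c := |c|) hp1 hpP
      (fun x hx => indicator_of_notMem hx _) (Eventually.of_forall fun x => ?_)).trans_lt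
      (ENNReal.mul_lt_top ENNReal.ofReal_lt_top hK.measure_lt_top)
    exact norm_indicator_le_norm_self (fun _ => c) x
  -- the approximations
  refine memW10_of_tendsto_contMDiff_one hX hΩ hp hp1 hpP
    (mΦ.mul (mcomp Θ cΘ w hwm))
    (((mcomp Θ cΘ w hwm).smul mgΦ).add (mΦ.smul (((mcomp Θs cΘs w hwm).smul hHm).add
      ((mcomp Θt cΘt w hwm).smul mga)))) hK hKΩ
    (ψ := fun j x => Φ x * Θ (f j x, a x)) ?_ ?_ ?_ ?_
  · intro j x
    by_cases hx : x ∈ tsupport Φ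
    · have hxΩ : Ω ∈ 𝓝 x := hΩ.mem_nhds (hKΩ (hΦK hx))
      have h1 : ContMDiffOn (𝓡 n) 𝓘(ℝ, ℝ) 1 (fun x => Θ (f j x, a x)) Ω :=
        hΘ.contMDiff.comp_contMDiffOn ((hf1 j).contMDiffOn.prodMk_space ha)
      exact (hΦ.mul h1).contMDiffAt hxΩ
    · refine (contMDiffAt_const (c := (0 : ℝ))).congr_of_eventuallyEq ?_
      filter_upwards [notMem_tsupport_iff_eventuallyEq.1 hx] with y hy
      simp [hy]
  · intro j
    exact (closure_mono (Function.support_mul_subset_left _ _)).trans hΦK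
  · refine tendsto_modular_of_dominated (D := K.indicator fun _ => c₁ * (2 * B))
      (fun j => (mΦ.mul (mcomp Θ cΘ _ (hfm j))).sub (mΦ.mul (mcomp Θ cΘ w hwm))) hp hp1
      (hconst _) (fun j => Eventually.of_forall fun x => ?_) ?_
    · by_cases hx : x ∈ K
      · rw [indicator_of_mem hx, ← mul_sub, norm_mul]
        exact mul_le_mul (hc₁ x hx) (hdiff Θ x (fun s => (hB s x hx).1) _ _) (abs_nonneg _)
          ((norm_nonneg _).trans (hc₁ x hx))
      · simp [hΦ0 x hx, hx]
    · filter_upwards [hflim] with x hx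
      have := (lcomp Θ cΘ x hx).const_mul (Φ x)
      simpa [mul_sub] using this
  -- The gradient error splits into three parts. Here the vector factors are bounded on `K` and the
  -- coefficients tend to zero a.e.
  · have hA : Tendsto (fun j => modular μ Ω p (fun x =>
        (Θ (f j x, a x) - Θ (w x, a x)) • horizontalGradient X Φ x +
        (Φ x * (Θt (f j x, a x) - Θt (w x, a x))) • horizontalGradient X a x)) atTop (𝓝 0) := by
      refine tendsto_modular_of_dominated
        (D := K.indicator fun _ => 2 * B * c₂ + c₁ * (2 * B) * c₃) (fun j => ?_) hp hp1
        (hconst _) (fun j => Eventually.of_forall fun x => ?_) ?_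
      · exact (((mcomp Θ cΘ _ (hfm j)).sub (mcomp Θ cΘ w hwm)).smul mgΦ).add
          ((mΦ.mul ((mcomp Θt cΘt _ (hfm j)).sub (mcomp Θt cΘt w hwm))).smul mga)
      · by_cases hx : x ∈ K
        · rw [indicator_of_mem hx]
          have hB0 : 0 ≤ B := (abs_nonneg _).trans (hB 0 x hx).1
          have h10 : 0 ≤ c₁ := (norm_nonneg _).trans (hc₁ x hx)
          have d1 := hdiff Θ x (fun s => (hB s x hx).1) (f j x) (w x)
          have d2 := hdiff Θt x (fun s => (hB s x hx).2.2) (f j x) (w x)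
          refine (norm_add_le _ _).trans (add_le_add ?_ ?_)
          · rw [norm_smul]
            exact mul_le_mul d1 (hc₂ x hx) (norm_nonneg _) (by positivity)
          · rw [norm_smul, norm_mul]
            exact mul_le_mul (mul_le_mul (hc₁ x hx) d2 (abs_nonneg _) h10) (hc₃ x hx)
              (norm_nonneg _) (by positivity)
        · simp [hΦ0 x hx, hgΦ0 x hx, hx]
      · filter_upwards [hflim] with x hx
        have t1 := (lcomp Θ cΘ x hx).smul_const (horizontalGradient X Φ x)
        have t2 := ((lcomp Θt cΘt x hx).const_mul (Φ x)).smul_const (horizontalGradient X a x)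
        have t3 := t1.add t2
        simpa using t3
    -- A bounded coefficient times the gradient error of the approximants.
    have hBt : Tendsto (fun j => modular μ Ω p (fun x =>
        (Φ x * Θs (f j x, a x)) • (horizontalGradient X (f j) x - Hw x))) atTop (𝓝 0) := by
      have h1 := ENNReal.Tendsto.const_mul (a := ENNReal.ofReal ((max 1 (c₁ * B)) ^ P)) hfH
        (Or.inr ENNReal.ofReal_ne_top)
      rw [mul_zero] at h1
      refine tendsto_of_tendsto_of_tendsto_of_le_of_le tendsto_const_nhds h1 (fun _ => zero_le)
        fun j => modular_le_of_norm_le (le_max_left _ _) hp1 hpP (Eventually.of_forall fun x => ?_)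
      rw [norm_smul]
      refine mul_le_mul_of_nonneg_right ?_ (norm_nonneg _)
      by_cases hx : x ∈ K
      · refine le_trans ?_ (le_max_right _ _)
        rw [norm_mul]
        exact mul_le_mul (hc₁ x hx) (hB _ x hx).2.1 (abs_nonneg _)
          ((norm_nonneg _).trans (hc₁ x hx))
      · simp [hΦ0 x hx]
    -- A bounded coefficient tending to zero a.e., times the fixed field `Hw`, so a multiple of
    -- `‖Hw‖` dominates.
    have hC : Tendsto (fun j => modular μ Ω p (fun x =>
        (Φ x * (Θs (f j x, a x) - Θs (w x, a x))) • Hw x)) atTop (𝓝 0) := by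
      refine tendsto_modular_of_dominated
        (D := fun x => max 1 (c₁ * (2 * B)) * ‖Hw x‖) (fun j => ?_) hp hp1
        ?_ (fun j => Eventually.of_forall fun x => ?_) ?_
      · exact (mΦ.mul ((mcomp Θs cΘs _ (hfm j)).sub (mcomp Θs cΘs w hwm))).smul hHm
      · refine (modular_le_of_norm_le (g := Hw) (le_max_left 1 (c₁ * (2 * B))) hp1 hpP
          (Eventually.of_forall fun x => ?_)).trans_lt
          (ENNReal.mul_lt_top ENNReal.ofReal_lt_top hHf)
        rw [Real.norm_of_nonneg (by positivity)]
      · rw [norm_smul]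
        refine mul_le_mul_of_nonneg_right ?_ (norm_nonneg _)
        by_cases hx : x ∈ K
        · refine le_trans ?_ (le_max_right _ _)
          rw [norm_mul]
          exact mul_le_mul (hc₁ x hx) (hdiff Θs x (fun s => (hB s x hx).2.1) _ _) (abs_nonneg _)
            ((norm_nonneg _).trans (hc₁ x hx))
        · simp [hΦ0 x hx]
      · filter_upwards [hflim] with x hx
        have t1 := ((lcomp Θs cΘs x hx).const_mul (Φ x)).smul_const (Hw x)
        simpa using t1
    have hsum := tendsto_modular_add (fun j => ?_) hp hp1 hpP
      (tendsto_modular_add (fun j => ?_) hp hp1 hpP hA hBt) hC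
    · refine hsum.congr fun j => lintegral_congr_ae ?_
      filter_upwards [ae_restrict_mem hΩ.measurableSet] with x hx
      have hxΩ : Ω ∈ 𝓝 x := hΩ.mem_nhds hx
      have dΦ : MDifferentiableAt (𝓡 n) 𝓘(ℝ, ℝ) Φ x :=
        (hΦ.contMDiffAt hxΩ).mdifferentiableAt one_ne_zero
      have da : MDifferentiableAt (𝓡 n) 𝓘(ℝ, ℝ) a x :=
        (ha.contMDiffAt hxΩ).mdifferentiableAt one_ne_zero
      have df : MDifferentiableAt (𝓡 n) 𝓘(ℝ, ℝ) (f j) x := (hf1 j).mdifferentiableAt one_ne_zero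
      have hΘd : HasFDerivAt Θ (fderiv ℝ Θ (f j x, a x)) (f j x, a x) :=
        (hΘ.differentiable one_ne_zero _).hasFDerivAt
      have dc : MDifferentiableAt (𝓡 n) 𝓘(ℝ, ℝ) (fun y => Θ (f j y, a y)) x :=
        (hΘd.differentiableAt.mdifferentiableAt).comp x (df.prodMk_space da)
      have e1 := horizontalGradient_mul (X := X) dΦ dc
      have e2 := horizontalGradient_comp₂ (X := X) df da hΘd
      rw [e2] at e1
      rw [e1]
      congr 3
      simp only [hΘs, hΘt]
      module
    · exact ((((mcomp Θ cΘ _ (hfm j)).sub (mcomp Θ cΘ w hwm)).smul mgΦ).add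
        ((mΦ.mul ((mcomp Θt cΘt _ (hfm j)).sub (mcomp Θt cΘt w hwm))).smul mga)).add
        ((mΦ.mul (mcomp Θs cΘs _ (hfm j))).smul ((hgc (ns j)).aestronglyMeasurable.sub hHm))
    · exact (((mcomp Θ cΘ _ (hfm j)).sub (mcomp Θ cΘ w hwm)).smul mgΦ).add
        ((mΦ.mul ((mcomp Θt cΘt _ (hfm j)).sub (mcomp Θt cΘt w hwm))).smul mga)

end Superposition

/-! ### The pointwise inequality. -/

section PointwiseInequality

theorem mul_rpow_sub_one_mul_le {x y p : ℝ} (hx : 0 ≤ x) (hy : 0 ≤ y) (hp : 1 < p) :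
    p * (x ^ (p - 1) * y) ≤ (p - 1) * x ^ p + y ^ p := by
  have hp0 : 0 < p - 1 := by linarith
  have hconj : (p / (p - 1)).HolderConjugate p := (Real.HolderConjugate.conjExponent hp).symm
  have h := Real.young_inequality_of_nonneg (Real.rpow_nonneg hx (p - 1)) hy hconj
  rw [← Real.rpow_mul hx, mul_div_cancel₀ _ hp0.ne'] at h
  calc p * (x ^ (p - 1) * y) ≤ p * (x ^ p / (p / (p - 1)) + y ^ p / p) := by gcongr
    _ = _ := by field_simp

/-- Young's inequality is applied to `τ ^ (1 / p) * x` and `τ ^ (1 / p - 1) * y`; this scaling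
leaves `x ^ (p - 1) * y` unchanged. -/
theorem mul_rpow_sub_one_mul_le_weighted {x y p τ : ℝ} (hx : 0 ≤ x) (hy : 0 ≤ y) (hp : 1 < p)
    (hτ : 0 < τ) :
    p * (x ^ (p - 1) * y) ≤ (p - 1) * τ * x ^ p + τ ^ (1 - p) * y ^ p := by
  have hp0 : p ≠ 0 := by linarith
  have h := mul_rpow_sub_one_mul_le (x := τ ^ (1 / p) * x) (y := τ ^ (1 / p - 1) * y)
    (by positivity) (by positivity) hp
  rw [Real.mul_rpow (by positivity) hx, Real.mul_rpow (by positivity) hx,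
    Real.mul_rpow (by positivity) hy, ← Real.rpow_mul hτ.le, ← Real.rpow_mul hτ.le,
    ← Real.rpow_mul hτ.le, one_div_mul_cancel hp0, Real.rpow_one] at h
  have e1 : (1 / p - 1) * p = 1 - p := by field_simp
  have e2 : τ ^ (1 / p * (p - 1)) * x ^ (p - 1) * (τ ^ (1 / p - 1) * y) = x ^ (p - 1) * y := by
    have : τ ^ (1 / p * (p - 1)) * τ ^ (1 / p - 1) = 1 := by
      rw [← Real.rpow_add hτ]
      have : 1 / p * (p - 1) + (1 / p - 1) = 0 := by field_simp; ring
      rw [this, Real.rpow_zero]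
    calc _ = (τ ^ (1 / p * (p - 1)) * τ ^ (1 / p - 1)) * (x ^ (p - 1) * y) := by ring
      _ = _ := by rw [this, one_mul]
  rw [e1, e2] at h
  linarith

variable {E : Type*} [NormedAddCommGroup E] [InnerProductSpace ℝ E]

theorem abs_rpow_mul_inner_le (G Y : E) (p : ℝ) :
    |‖G‖ ^ (p - 2) * inner ℝ G Y| ≤ ‖G‖ ^ (p - 1) * ‖Y‖ := by
  rcases eq_or_ne G 0 with rfl | hG
  · simp only [inner_zero_left, mul_zero, abs_zero]; positivity
  · have hG' : 0 < ‖G‖ := norm_pos_iff.2 hG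
    rw [abs_mul, abs_of_nonneg (by positivity)]
    calc ‖G‖ ^ (p - 2) * |inner ℝ G Y| ≤ ‖G‖ ^ (p - 2) * (‖G‖ * ‖Y‖) := by
          gcongr; exact abs_real_inner_le_norm G Y
      _ = ‖G‖ ^ (p - 2) * ‖G‖ ^ (1 : ℝ) * ‖Y‖ := by rw [Real.rpow_one]; ring
      _ = ‖G‖ ^ (p - 1) * ‖Y‖ := by rw [← Real.rpow_add hG']; ring_nf

theorem rpow_mul_norm_sq (G : E) {p : ℝ} (hp : 1 < p) :
    ‖G‖ ^ (p - 2) * inner ℝ G G = ‖G‖ ^ p := by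
  rw [real_inner_self_eq_norm_sq]
  rcases eq_or_ne G 0 with rfl | hG
  · simp [Real.zero_rpow (by linarith : p ≠ 0)]
  · rw [← Real.rpow_natCast, ← Real.rpow_add (norm_pos_iff.2 hG)]; norm_num

/-- `A` and `B` are chosen so that `A ^ p` and `B ^ p` are the two densities and `A ^ (p - 1) * B`
bounds the cross term. The weight `τ = d / P` gives `(P - 1) * τ - d = -τ`, so a multiple `-τ` of `A
^ p` survives, and `τ ^ (1 - p) = τ * (P / d) ^ p` gives the constant. -/
theorem caccioppoli_pointwise (G Y : E) {h φ p q d P C : ℝ} (hh : 0 < h) (hφ : 0 ≤ φ) (hp : 1 < p)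
    (hpP : p ≤ P) (hd : 0 < d) (hdp : d ≤ p - q - 1) (hC : (P / d) ^ p ≤ C) :
    p * φ ^ (p - 1) * h ^ (q - p + 1) * (‖G‖ ^ (p - 2) * inner ℝ G Y) +
        (q - p + 1) * (h ^ (q - p) * φ ^ p * ‖G‖ ^ p) ≤
      d / P * (C * (h ^ q * ‖Y‖ ^ p) - h ^ (q - p) * φ ^ p * ‖G‖ ^ p) := by
  have hP : 0 < P := by linarith
  have hp0 : p ≠ 0 := by linarith
  set A := h ^ ((q - p) / p) * φ * ‖G‖ with hA
  set B := h ^ (q / p) * ‖Y‖ with hB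
  have hA0 : 0 ≤ A := by positivity
  have hB0 : 0 ≤ B := by positivity
  have hAp : A ^ p = h ^ (q - p) * φ ^ p * ‖G‖ ^ p := by
    rw [hA, Real.mul_rpow (by positivity) (norm_nonneg _), Real.mul_rpow (by positivity) hφ,
      ← Real.rpow_mul hh.le, div_mul_cancel₀ _ hp0]
  have hBp : B ^ p = h ^ q * ‖Y‖ ^ p := by
    rw [hB, Real.mul_rpow (by positivity) (norm_nonneg _), ← Real.rpow_mul hh.le,
      div_mul_cancel₀ _ hp0]
  have hAB : A ^ (p - 1) * B = φ ^ (p - 1) * h ^ (q - p + 1) * (‖G‖ ^ (p - 1) * ‖Y‖) := by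
    rw [hA, hB, Real.mul_rpow (by positivity) (norm_nonneg _), Real.mul_rpow (by positivity) hφ,
      ← Real.rpow_mul hh.le]
    have e : (q - p + 1) = (q - p) / p * (p - 1) + q / p := by field_simp; ring
    rw [e, Real.rpow_add hh]; ring
  have hτ : 0 < d / P := div_pos hd hP
  have young := mul_rpow_sub_one_mul_le_weighted hA0 hB0 hp hτ
  have first : p * φ ^ (p - 1) * h ^ (q - p + 1) * (‖G‖ ^ (p - 2) * inner ℝ G Y) ≤
      p * (A ^ (p - 1) * B) := by
    rw [hAB]
    have := (le_abs_self _).trans (abs_rpow_mul_inner_le G Y p)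
    calc _ ≤ p * φ ^ (p - 1) * h ^ (q - p + 1) * (‖G‖ ^ (p - 1) * ‖Y‖) := by gcongr
      _ = _ := by ring
  have hL : 0 ≤ A ^ p := by positivity
  have hR : 0 ≤ B ^ p := by positivity
  rw [← hAp, ← hBp]
  have k1 : (q - p + 1) * A ^ p ≤ -d * A ^ p := by gcongr; linarith
  have k2 : (p - 1) * (d / P) * A ^ p ≤ (P - 1) * (d / P) * A ^ p := by gcongr
  have k3 : (P - 1) * (d / P) * A ^ p - d * A ^ p = -(d / P * A ^ p) := by field_simp; ring
  have k4 : (d / P) ^ (1 - p) * B ^ p ≤ d / P * (C * B ^ p) := by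
    have : (d / P) ^ (1 - p) = d / P * (P / d) ^ p := by
      rw [Real.rpow_sub hτ, Real.rpow_one, div_eq_mul_inv, ← Real.inv_rpow hτ.le, inv_div]
    rw [this, mul_assoc]
    gcongr
  linarith

theorem rpow_le_rpow_add_rpow {a b p P : ℝ} (ha : 0 ≤ a) (hb : 0 ≤ b) (hp : 1 ≤ p) (hpP : p ≤ P) :
    (a + b) ^ p ≤ 2 ^ P * (a ^ p + b ^ p) := by
  have h0 : 0 ≤ max a b := le_max_of_le_left ha
  have hm : max a b ^ p ≤ a ^ p + b ^ p := by
    rcases max_choice a b with h | h <;> rw [h]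
    · exact le_add_of_nonneg_right (by positivity)
    · exact le_add_of_nonneg_left (by positivity)
  calc (a + b) ^ p ≤ (2 * max a b) ^ p := by
        gcongr; linarith [le_max_left a b, le_max_right a b]
    _ = 2 ^ p * max a b ^ p := Real.mul_rpow (by norm_num) h0
    _ ≤ 2 ^ P * (a ^ p + b ^ p) := by gcongr; norm_num

theorem rpow_sub_one_le_one_add_rpow {t p : ℝ} (ht : 0 ≤ t) (hp : 1 < p) :
    t ^ (p - 1) ≤ 1 + t ^ p := by
  rcases le_total t 1 with h | h
  · have := Real.rpow_le_one ht h (by linarith : 0 ≤ p - 1)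
    linarith [Real.rpow_nonneg ht p]
  · have := Real.rpow_le_rpow_of_exponent_le h (by linarith : p - 1 ≤ p)
    linarith

end PointwiseInequality

/-! ### The integrated estimate and the limit ε → 0. -/

section AbstractEstimate

variable {α E : Type*} [MeasurableSpace α] [NormedAddCommGroup E]

/-- The measurability, integrability and size conditions on exponents `p`, `q`, a weight `g`, a
positive function `v` with gradient `G` and a bounded cut-off `φ` with gradient `Y`. -/
structure CaccioppoliData (ν : Measure α) (p q g v φ : α → ℝ) (G Y : α → E)
    (P d Q cg cφ cY : ℝ) : Prop where
  meas_p : AEMeasurable p ν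
  meas_q : AEMeasurable q ν
  meas_g : AEMeasurable g ν
  meas_v : AEMeasurable v ν
  meas_φ : AEMeasurable φ ν
  meas_G : AEStronglyMeasurable G ν
  meas_Y : AEStronglyMeasurable Y ν
  d_pos : 0 < d
  one_lt_P : 1 < P
  Q_nonneg : 0 ≤ Q
  one_le_cφ : 1 ≤ cφ
  one_le_cY : 1 ≤ cY
  ae : ∀ᵐ x ∂ν, 0 < v x ∧ (0 ≤ φ x ∧ φ x ≤ cφ) ∧ (0 ≤ g x ∧ g x ≤ cg) ∧ ‖Y x‖ ≤ cY ∧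
    1 < p x ∧ p x ≤ P ∧ d ≤ p x - q x - 1 ∧ -Q ≤ q x
  integrable_G : Integrable (fun x => ‖G x‖ ^ p x) ν
  integrable_v : Integrable (fun x => v x ^ p x) ν

theorem integrable_const_add {ν : Measure α} [IsFiniteMeasure ν] (c : ℝ) {f : α → ℝ}
    (hf : Integrable f ν) : Integrable (fun x => c + f x) ν :=
  (integrable_const c).add hf

namespace CaccioppoliData

variable {ν : Measure α} {p q g v φ : α → ℝ} {G Y : α → E}
  {P d Q cg cφ cY : ℝ}

theorem exists_bound (D : CaccioppoliData ν p q g v φ G Y P d Q cg cφ cY) {ε : ℝ} (hε : 0 < ε) :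
    ∃ B : ℝ, 0 ≤ B ∧ ∀ᵐ x ∂ν, (v x + ε) ^ (q x - p x + 1) ≤ B ∧ (v x + ε) ^ (q x - p x) ≤ B := by
  -- The exponent `q - p + 1` lies between `-Q - P + 1` and `-d`; the bound for the exponent lowered
  -- by one covers `q - p`.
  obtain ⟨B, hB, h⟩ := exists_bound_rpow_of_neg (c := min ε 1) (α := -Q - P + 1) (β := -d)
    (lt_min hε one_pos) (min_le_right _ _) (neg_lt_zero.2 D.d_pos)
  refine ⟨B, hB, ?_⟩
  filter_upwards [D.ae] with x ⟨h1, _, _, _, _, h6, h7, h8⟩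
  have := h (v x + ε) (q x - p x + 1) ((min_le_left _ _).trans (by linarith)) (by linarith)
    (by linarith)
  refine ⟨this.1, ?_⟩
  have h9 := this.2.1
  rwa [add_sub_cancel_right] at h9

theorem integrable_lhs (D : CaccioppoliData ν p q g v φ G Y P d Q cg cφ cY) {ε : ℝ} (hε : 0 < ε) :
    Integrable (fun x => (v x + ε) ^ (q x - p x) * φ x ^ p x * ‖G x‖ ^ p x) ν := by
  obtain ⟨B, hB, h⟩ := D.exists_bound hε
  refine (D.integrable_G.const_mul (B * cφ ^ P)).mono' ?_ ?_
  · exact ((((D.meas_v.add_const ε).pow (D.meas_q.sub D.meas_p)).mul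
      (D.meas_φ.pow D.meas_p)).mul (D.meas_G.norm.aemeasurable.pow D.meas_p)).aestronglyMeasurable
  · filter_upwards [D.ae, h] with x ⟨h1, ⟨h2, h2'⟩, _, _, h5, h6, _, _⟩ ⟨_, hb⟩
    have h0 : 0 ≤ v x + ε := by linarith
    rw [Real.norm_of_nonneg (by positivity)]
    gcongr
    calc φ x ^ p x ≤ cφ ^ p x := by gcongr
      _ ≤ cφ ^ P := Real.rpow_le_rpow_of_exponent_le D.one_le_cφ h6

/-- The cross term grows like `‖G‖ ^ (p - 1) ≤ 1 + ‖G‖ ^ p`, and constants are integrable for a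
finite measure. -/
theorem integrable_flux [InnerProductSpace ℝ E] [IsFiniteMeasure ν]
    (D : CaccioppoliData ν p q g v φ G Y P d Q cg cφ cY) {ε : ℝ}
    (hε : 0 < ε) :
    Integrable (fun x => p x * φ x ^ (p x - 1) * (v x + ε) ^ (q x - p x + 1) *
      (‖G x‖ ^ (p x - 2) * inner ℝ (G x) (Y x)) +
        (q x - p x + 1) * ((v x + ε) ^ (q x - p x) * φ x ^ p x * ‖G x‖ ^ p x)) ν := by
  obtain ⟨B, hB, h⟩ := D.exists_bound hε
  have mh := D.meas_v.add_const ε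
  have ma := (D.meas_q.sub D.meas_p).add_const 1
  have mL := D.integrable_lhs hε
  refine Integrable.add ?_ ?_
  · refine ((integrable_const_add 1 D.integrable_G).const_mul (P * cφ ^ P * B * cY)).mono' ?_ ?_
    · exact (((D.meas_p.mul (D.meas_φ.pow (D.meas_p.sub_const 1))).mul (mh.pow ma)).mul
        ((D.meas_G.norm.aemeasurable.pow (D.meas_p.sub_const 2)).mul
          (D.meas_G.inner D.meas_Y).aemeasurable)).aestronglyMeasurable
    · filter_upwards [D.ae, h] with x ⟨h1, ⟨h2, h2'⟩, _, h4, h5, h6, _, _⟩ ⟨hb, _⟩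
      have h0 : 0 ≤ v x + ε := by linarith
      have hP0 : 0 ≤ P := by linarith
      have hc0 : 0 ≤ cφ := by linarith [D.one_le_cφ]
      rw [norm_mul, Real.norm_eq_abs (‖G x‖ ^ (p x - 2) * _), Real.norm_of_nonneg (by positivity)]
      have k1 : φ x ^ (p x - 1) ≤ cφ ^ P :=
        calc φ x ^ (p x - 1) ≤ cφ ^ (p x - 1) := by gcongr
          _ ≤ cφ ^ P := Real.rpow_le_rpow_of_exponent_le D.one_le_cφ (by linarith)
      have k2 : |‖G x‖ ^ (p x - 2) * inner ℝ (G x) (Y x)| ≤ (1 + ‖G x‖ ^ p x) * cY :=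
        (abs_rpow_mul_inner_le (G x) (Y x) (p x)).trans (by
          gcongr; exact rpow_sub_one_le_one_add_rpow (norm_nonneg _) h5)
      calc _ ≤ P * cφ ^ P * B * ((1 + ‖G x‖ ^ p x) * cY) := by gcongr
        _ = _ := by ring
  · refine (mL.const_mul (Q + P)).mono' ?_ ?_
    · exact (ma.aestronglyMeasurable).mul mL.1
    · filter_upwards [D.ae] with x ⟨h1, ⟨h2, h2'⟩, _, h4, h5, h6, h7, h8⟩
      have h0 : 0 ≤ v x + ε := by linarith
      rw [norm_mul, Real.norm_of_nonneg (by positivity : 0 ≤ (v x + ε) ^ (q x - p x) *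
        φ x ^ p x * ‖G x‖ ^ p x)]
      gcongr
      rw [Real.norm_eq_abs, abs_le]
      constructor <;> linarith [D.d_pos, D.Q_nonneg, D.one_lt_P]

theorem integrable_v_add [IsFiniteMeasure ν]
    (D : CaccioppoliData ν p q g v φ G Y P d Q cg cφ cY) {ε : ℝ}
    (hε : 0 < ε) : Integrable (fun x => (v x + ε) ^ p x) ν := by
  refine ((integrable_const_add ((max ε 1) ^ P) D.integrable_v).const_mul (2 ^ P)).mono'
    ((D.meas_v.add_const ε).pow D.meas_p).aestronglyMeasurable ?_
  filter_upwards [D.ae] with x ⟨h1, _, _, _, h5, h6, _, _⟩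
  have h0 : 0 ≤ v x + ε := by linarith
  rw [Real.norm_of_nonneg (by positivity)]
  refine (rpow_le_rpow_add_rpow h1.le hε.le h5.le h6).trans ?_
  rw [add_comm]
  gcongr
  calc ε ^ p x ≤ max ε 1 ^ p x := by gcongr; exact le_max_left _ _
    _ ≤ max ε 1 ^ P := Real.rpow_le_rpow_of_exponent_le (le_max_right _ _) h6

theorem norm_rpow_le (D : CaccioppoliData ν p q g v φ G Y P d Q cg cφ cY) :
    ∀ᵐ x ∂ν, ‖Y x‖ ^ p x ≤ cY ^ P := by
  filter_upwards [D.ae] with x ⟨_, _, _, h4, h5, h6, _, _⟩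
  calc ‖Y x‖ ^ p x ≤ cY ^ p x := by gcongr
    _ ≤ cY ^ P := Real.rpow_le_rpow_of_exponent_le D.one_le_cY h6

theorem integrable_rhs [IsFiniteMeasure ν]
    (D : CaccioppoliData ν p q g v φ G Y P d Q cg cφ cY) {ε : ℝ} (hε : 0 < ε) :
    Integrable (fun x => (v x + ε) ^ q x * ‖Y x‖ ^ p x) ν := by
  set c := min ε 1 with hc
  have hc0 : 0 < c := lt_min hε one_pos
  refine ((integrable_const_add (c ^ (-Q)) (D.integrable_v_add hε)).mul_const (cY ^ P)).mono'
    (((D.meas_v.add_const ε).pow D.meas_q).mul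
      (D.meas_Y.norm.aemeasurable.pow D.meas_p)).aestronglyMeasurable ?_
  filter_upwards [D.ae, D.norm_rpow_le] with x ⟨h1, _, _, _, h5, h6, h7, h8⟩ hY
  have h0 : 0 < v x + ε := by linarith
  rw [Real.norm_of_nonneg (by positivity)]
  gcongr
  -- For values above 1 the power `q` is dominated by `p`; below 1 the bounds `q ≥ -Q` and `v + ε ≥
  -- c` control negative powers.
  rcases le_total 1 (v x + ε) with h | h
  · have : (v x + ε) ^ q x ≤ (v x + ε) ^ p x :=
      Real.rpow_le_rpow_of_exponent_le h (by linarith [D.d_pos])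
    have h9 : 0 ≤ c ^ (-Q) := by positivity
    linarith
  · have m1 : (v x + ε) ^ q x ≤ (v x + ε) ^ (-Q) := Real.rpow_le_rpow_of_exponent_ge h0 h h8
    have m2 : (v x + ε) ^ (-Q) ≤ c ^ (-Q) :=
      Real.rpow_le_rpow_of_nonpos hc0 ((min_le_left _ _).trans (by linarith))
        (by linarith [D.Q_nonneg])
    have h9 : 0 ≤ (v x + ε) ^ p x := by positivity
    linarith

theorem integrable_zeroth [IsFiniteMeasure ν]
    (D : CaccioppoliData ν p q g v φ G Y P d Q cg cφ cY) {ε : ℝ}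
    (hε : 0 < ε) :
    Integrable (fun x => g x * v x ^ (p x - 1) * (v x + ε) ^ (q x - p x + 1) * φ x ^ p x) ν := by
  obtain ⟨B, hB, h⟩ := D.exists_bound hε
  refine (((integrable_const_add 1 D.integrable_v).const_mul cg).mul_const (B * cφ ^ P)).mono' ?_ ?_
  · exact (((D.meas_g.mul (D.meas_v.pow (D.meas_p.sub_const 1))).mul
      ((D.meas_v.add_const ε).pow ((D.meas_q.sub D.meas_p).add_const 1))).mul
      (D.meas_φ.pow D.meas_p)).aestronglyMeasurable
  · filter_upwards [D.ae, h] with x ⟨h1, ⟨h2, h2'⟩, ⟨h3, h3'⟩, _, h5, h6, _, _⟩ ⟨hb, _⟩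
    have h0 : 0 ≤ v x + ε := by linarith
    have hcg : 0 ≤ cg := h3.trans h3'
    rw [Real.norm_of_nonneg (by positivity), mul_assoc]
    gcongr
    · exact rpow_sub_one_le_one_add_rpow h1.le h5
    · calc φ x ^ p x ≤ cφ ^ p x := by gcongr
        _ ≤ cφ ^ P := Real.rpow_le_rpow_of_exponent_le D.one_le_cφ h6

/-- For `ε > 0` every integral is finite, so the pointwise inequality can be integrated, combined
with the weak inequality and multiplied by `P / d`; the sign of `lam` decides the side of the last
term. -/
theorem estimate_of_pos [InnerProductSpace ℝ E] [IsFiniteMeasure ν]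
    (D : CaccioppoliData ν p q g v φ G Y P d Q cg cφ cY) {C lam ε : ℝ}
    (hε : 0 < ε) (hC : ∀ᵐ x ∂ν, (P / d) ^ p x ≤ C) (hC0 : 0 ≤ C)
    (hweak : 0 ≤ (∫ x, (p x * φ x ^ (p x - 1) * (v x + ε) ^ (q x - p x + 1) *
      (‖G x‖ ^ (p x - 2) * inner ℝ (G x) (Y x)) +
        (q x - p x + 1) * ((v x + ε) ^ (q x - p x) * φ x ^ p x * ‖G x‖ ^ p x)) ∂ν) -
      lam * ∫ x, g x * v x ^ (p x - 1) * (v x + ε) ^ (q x - p x + 1) * φ x ^ p x ∂ν) :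
    (∫⁻ x, ENNReal.ofReal ((v x + ε) ^ (q x - p x) * φ x ^ p x * ‖G x‖ ^ p x) ∂ν) +
        ENNReal.ofReal (lam * P / d) * ∫⁻ x, ENNReal.ofReal
          (g x * v x ^ (p x - 1) * (v x + ε) ^ (q x - p x + 1) * φ x ^ p x) ∂ν ≤
      ENNReal.ofReal C * (∫⁻ x, ENNReal.ofReal ((v x + ε) ^ q x * ‖Y x‖ ^ p x) ∂ν) +
        ENNReal.ofReal (-(lam * P / d)) * ∫⁻ x, ENNReal.ofReal
          (g x * v x ^ (p x - 1) * (v x + ε) ^ (q x - p x + 1) * φ x ^ p x) ∂ν := by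
  have iL := D.integrable_lhs hε
  have iR := D.integrable_rhs hε
  have iS := D.integrable_zeroth hε
  have nL : 0 ≤ᵐ[ν] fun x => (v x + ε) ^ (q x - p x) * φ x ^ p x * ‖G x‖ ^ p x := by
    filter_upwards [D.ae] with x ⟨h1, ⟨h2, _⟩, _⟩
    have h0 : 0 ≤ v x + ε := by linarith
    change 0 ≤ _
    positivity
  have nR : 0 ≤ᵐ[ν] fun x => (v x + ε) ^ q x * ‖Y x‖ ^ p x := by
    filter_upwards [D.ae] with x ⟨h1, _⟩
    have h0 : 0 ≤ v x + ε := by linarith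
    change 0 ≤ _
    positivity
  have nS : 0 ≤ᵐ[ν] fun x =>
      g x * v x ^ (p x - 1) * (v x + ε) ^ (q x - p x + 1) * φ x ^ p x := by
    filter_upwards [D.ae] with x ⟨h1, ⟨h2, _⟩, ⟨h3, _⟩, _⟩
    have h0 : 0 ≤ v x + ε := by linarith
    change 0 ≤ _
    positivity
  rw [← ofReal_integral_eq_lintegral_ofReal iL nL, ← ofReal_integral_eq_lintegral_ofReal iR nR,
    ← ofReal_integral_eq_lintegral_ofReal iS nS]
  have hle := integral_mono_ae (D.integrable_flux hε)
    (((iR.const_mul C).sub iL).const_mul (d / P)) (by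
      filter_upwards [D.ae, hC] with x ⟨h1, ⟨h2, _⟩, _, _, h5, h6, h7, _⟩ hCx
      exact caccioppoli_pointwise (G x) (Y x) (by linarith) h2 h5 h6 D.d_pos h7 hCx)
  have he : ∫ x, d / P * ((fun x => C * ((v x + ε) ^ q x * ‖Y x‖ ^ p x)) -
      fun x => (v x + ε) ^ (q x - p x) * φ x ^ p x * ‖G x‖ ^ p x) x ∂ν =
      d / P * (C * (∫ x, (v x + ε) ^ q x * ‖Y x‖ ^ p x ∂ν) -
        ∫ x, (v x + ε) ^ (q x - p x) * φ x ^ p x * ‖G x‖ ^ p x ∂ν) := by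
    rw [integral_const_mul]
    congr 1
    rw [← integral_const_mul]
    exact integral_sub (iR.const_mul C) iL
  have hS0 := integral_nonneg_of_ae nS
  have hR0 := integral_nonneg_of_ae nR
  have hL0 := integral_nonneg_of_ae nL
  rw [he] at hle
  set IL := ∫ x, (v x + ε) ^ (q x - p x) * φ x ^ p x * ‖G x‖ ^ p x ∂ν
  set IR := ∫ x, (v x + ε) ^ q x * ‖Y x‖ ^ p x ∂ν
  set IS := ∫ x, g x * v x ^ (p x - 1) * (v x + ε) ^ (q x - p x + 1) * φ x ^ p x ∂ν
  have hP : 0 < P := by linarith [D.one_lt_P]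
  have key : IL + lam * P / d * IS ≤ C * IR := by
    have h1 : 0 ≤ d / P * (C * IR - IL) - lam * IS := hweak.trans (by linarith)
    have h2 : 0 ≤ P / d * (d / P * (C * IR - IL) - lam * IS) :=
      mul_nonneg (div_pos hP D.d_pos).le h1
    have h3 : P / d * (d / P * (C * IR - IL) - lam * IS) = C * IR - IL - lam * P / d * IS := by
      have := D.d_pos.ne'
      field_simp
    linarith
  rcases le_total 0 (lam * P / d) with h | h
  · rw [ENNReal.ofReal_of_nonpos (neg_nonpos.2 h), zero_mul, add_zero, ← ENNReal.ofReal_mul h,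
      ← ENNReal.ofReal_mul hC0, ← ENNReal.ofReal_add hL0 (mul_nonneg h hS0)]
    exact ENNReal.ofReal_le_ofReal key
  · rw [ENNReal.ofReal_of_nonpos h, zero_mul, add_zero, ← ENNReal.ofReal_mul (neg_nonneg.2 h),
      ← ENNReal.ofReal_mul hC0, ← ENNReal.ofReal_add (mul_nonneg hC0 hR0)
        (mul_nonneg (neg_nonneg.2 h) hS0)]
    exact ENNReal.ofReal_le_ofReal (by linarith)

/-- The left side is lower semicontinuous by Fatou, including the zeroth-order term when its
coefficient is positive. If the term with `‖Y‖` is infinite there is nothing to prove; otherwise it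
converges by domination. -/
theorem estimate [InnerProductSpace ℝ E] [IsFiniteMeasure ν]
    (D : CaccioppoliData ν p q g v φ G Y P d Q cg cφ cY) {C lam : ℝ}
    (hC : ∀ᵐ x ∂ν, (P / d) ^ p x ≤ C) (hC0 : 0 < C)
    (hweak : ∀ ε : ℝ, 0 < ε →
      0 ≤ (∫ x, (p x * φ x ^ (p x - 1) * (v x + ε) ^ (q x - p x + 1) *
      (‖G x‖ ^ (p x - 2) * inner ℝ (G x) (Y x)) +
        (q x - p x + 1) * ((v x + ε) ^ (q x - p x) * φ x ^ p x * ‖G x‖ ^ p x)) ∂ν) -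
      lam * ∫ x, g x * v x ^ (p x - 1) * (v x + ε) ^ (q x - p x + 1) * φ x ^ p x ∂ν) :
    (∫⁻ x, ENNReal.ofReal (v x ^ (q x - p x) * φ x ^ p x * ‖G x‖ ^ p x) ∂ν) +
        ENNReal.ofReal (lam * P / d) * ∫⁻ x, ENNReal.ofReal (g x * v x ^ q x * φ x ^ p x) ∂ν ≤
      ENNReal.ofReal C * (∫⁻ x, ENNReal.ofReal (v x ^ q x * ‖Y x‖ ^ p x) ∂ν) +
        ENNReal.ofReal (-(lam * P / d)) *
          ∫⁻ x, ENNReal.ofReal (g x * v x ^ q x * φ x ^ p x) ∂ν := by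
  set A := lam * P / d with hA
  by_cases hR : ∫⁻ x, ENNReal.ofReal (v x ^ q x * ‖Y x‖ ^ p x) ∂ν = ⊤
  -- Strict positivity of `C` matters, since `0 * ⊤ = 0`.
  · rw [hR, ENNReal.mul_top (by simpa using hC0), top_add]
    exact le_top
  let e : ℕ → ℝ := fun j => 1 / ((j : ℝ) + 1)
  have he0 : ∀ j, 0 < e j := fun j => by positivity
  have he1 : ∀ j, e j ≤ 1 := fun j => by
    rw [div_le_one (by positivity)]; linarith [(Nat.cast_nonneg j : (0 : ℝ) ≤ j)]
  have hetop : Tendsto e atTop (𝓝 0) := tendsto_one_div_add_atTop_nhds_zero_nat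
  have hve : ∀ x, Tendsto (fun j => v x + e j) atTop (𝓝 (v x)) := fun x => by
    simpa using hetop.const_add (v x)
  set SL : ℕ → α → ℝ := fun j x => (v x + e j) ^ (q x - p x) * φ x ^ p x * ‖G x‖ ^ p x with hSL
  set SR : ℕ → α → ℝ := fun j x => (v x + e j) ^ q x * ‖Y x‖ ^ p x with hSR
  set SS : ℕ → α → ℝ := fun j x =>
    g x * v x ^ (p x - 1) * (v x + e j) ^ (q x - p x + 1) * φ x ^ p x with hSS
  have mL : ∀ j, AEMeasurable (fun x => ENNReal.ofReal (SL j x)) ν := fun j =>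
    (D.integrable_lhs (he0 j)).1.aemeasurable.ennreal_ofReal
  have mS : ∀ j, AEMeasurable (fun x => ENNReal.ofReal (SS j x)) ν := fun j =>
    (D.integrable_zeroth (he0 j)).1.aemeasurable.ennreal_ofReal
  have mR : ∀ j, AEMeasurable (fun x => ENNReal.ofReal (SR j x)) ν := fun j =>
    (D.integrable_rhs (he0 j)).1.aemeasurable.ennreal_ofReal
  have hvq : ∀ᵐ x ∂ν, v x ^ (p x - 1) * v x ^ (q x - p x + 1) = v x ^ q x := by
    filter_upwards [D.ae] with x ⟨h1, _⟩
    rw [← Real.rpow_add h1]; ring_nf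
  have hlow : (∫⁻ x, ENNReal.ofReal (v x ^ (q x - p x) * φ x ^ p x * ‖G x‖ ^ p x) ∂ν) +
        ENNReal.ofReal A * ∫⁻ x, ENNReal.ofReal (g x * v x ^ q x * φ x ^ p x) ∂ν ≤
      liminf (fun j => (∫⁻ x, ENNReal.ofReal (SL j x) ∂ν) +
        ENNReal.ofReal A * ∫⁻ x, ENNReal.ofReal (SS j x) ∂ν) atTop := by
    have m0 : AEMeasurable (fun x => ENNReal.ofReal
        (v x ^ (q x - p x) * φ x ^ p x * ‖G x‖ ^ p x)) ν :=
      (((D.meas_v.pow (D.meas_q.sub D.meas_p)).mul (D.meas_φ.pow D.meas_p)).mul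
        (D.meas_G.norm.aemeasurable.pow D.meas_p)).ennreal_ofReal
    calc _ = ∫⁻ x, (ENNReal.ofReal (v x ^ (q x - p x) * φ x ^ p x * ‖G x‖ ^ p x) +
          ENNReal.ofReal A * ENNReal.ofReal (g x * v x ^ q x * φ x ^ p x)) ∂ν := by
          rw [lintegral_add_left' m0, lintegral_const_mul' _ _ ENNReal.ofReal_ne_top]
      _ = ∫⁻ x, liminf (fun j => ENNReal.ofReal (SL j x) +
          ENNReal.ofReal A * ENNReal.ofReal (SS j x)) atTop ∂ν := by
          refine lintegral_congr_ae ?_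
          filter_upwards [D.ae, hvq] with x ⟨h1, _⟩ hq
          refine (Tendsto.liminf_eq ?_).symm
          have t1 : Tendsto (fun j => SL j x) atTop
              (𝓝 (v x ^ (q x - p x) * φ x ^ p x * ‖G x‖ ^ p x)) :=
            (((hve x).rpow_const (Or.inl h1.ne')).mul_const _).mul_const _
          have t2 : Tendsto (fun j => SS j x) atTop (𝓝 (g x * v x ^ q x * φ x ^ p x)) := by
            have := (((hve x).rpow_const (p := q x - p x + 1) (Or.inl h1.ne')).const_mul
              (g x * v x ^ (p x - 1))).mul_const (φ x ^ p x)
            rwa [mul_assoc (g x), hq] at this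
          exact (ENNReal.tendsto_ofReal t1).add (ENNReal.Tendsto.const_mul
            (ENNReal.tendsto_ofReal t2) (Or.inr ENNReal.ofReal_ne_top))
      _ ≤ liminf (fun j => ∫⁻ x, (ENNReal.ofReal (SL j x) +
          ENNReal.ofReal A * ENNReal.ofReal (SS j x)) ∂ν) atTop :=
          lintegral_liminf_le' fun j => (mL j).add ((mS j).const_mul _)
      _ = _ := by
          congr 1
          ext j
          rw [lintegral_add_left' (mL j), lintegral_const_mul' _ _ ENNReal.ofReal_ne_top]
  have hRlim : Tendsto (fun j => ∫⁻ x, ENNReal.ofReal (SR j x) ∂ν) atTop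
      (𝓝 (∫⁻ x, ENNReal.ofReal (v x ^ q x * ‖Y x‖ ^ p x) ∂ν)) := by
    refine tendsto_lintegral_of_dominated_convergence'
      (fun x => ENNReal.ofReal (v x ^ q x * ‖Y x‖ ^ p x) +
        ENNReal.ofReal ((v x + 1) ^ p x * cY ^ P)) mR (fun j => ?_) ?_ ?_
    · filter_upwards [D.ae, D.norm_rpow_le] with x ⟨h1, _, _, _, h5, h6, h7, _⟩ hY
      have h0 : 0 < v x + e j := by linarith [he0 j]
      rw [← ENNReal.ofReal_add (by positivity)
        (mul_nonneg (by positivity) ((by positivity : 0 ≤ ‖Y x‖ ^ p x).trans hY))]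
      refine ENNReal.ofReal_le_ofReal ?_
      have hcY : 0 ≤ cY ^ P := (by positivity : 0 ≤ ‖Y x‖ ^ p x).trans hY
      -- For `q ≤ 0` the shift only decreases the power, so the limit dominates; for `q ≥ 0` the
      -- shift is at most 1 and `q < p`.
      rcases le_total (q x) 0 with hq | hq
      · have m1 : (v x + e j) ^ q x ≤ v x ^ q x :=
          Real.rpow_le_rpow_of_nonpos h1 (by linarith [he0 j]) hq
        have m2 : SR j x ≤ v x ^ q x * ‖Y x‖ ^ p x := by
          change (v x + e j) ^ q x * ‖Y x‖ ^ p x ≤ _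
          gcongr
        have m3 : 0 ≤ (v x + 1) ^ p x * cY ^ P := by positivity
        linarith
      · have m1 : (v x + e j) ^ q x ≤ (v x + 1) ^ q x := by
          gcongr; exact he1 j
        have m1' : (v x + 1) ^ q x ≤ (v x + 1) ^ p x :=
          Real.rpow_le_rpow_of_exponent_le (by linarith) (by linarith [D.d_pos])
        have m2 : SR j x ≤ (v x + 1) ^ p x * cY ^ P := by
          change (v x + e j) ^ q x * ‖Y x‖ ^ p x ≤ _
          exact mul_le_mul (m1.trans m1') hY (by positivity) (by positivity)
        have m3 : 0 ≤ v x ^ q x * ‖Y x‖ ^ p x := by positivity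
        linarith
    · rw [lintegral_add_right' _ (((D.integrable_v_add one_pos).1.aemeasurable.mul_const
        _).ennreal_ofReal)]
      refine (ENNReal.add_lt_top.2 ⟨lt_top_iff_ne_top.2 hR, ?_⟩).ne
      exact ((D.integrable_v_add one_pos).mul_const (cY ^ P)).lintegral_lt_top
    · filter_upwards [D.ae] with x ⟨h1, _⟩
      exact ENNReal.tendsto_ofReal (((hve x).rpow_const (Or.inl h1.ne')).mul_const _)
  -- Since `q - p + 1 < 0`, the shift decreases the zeroth-order density; no finiteness is needed.
  have hSle : ∀ j, ∫⁻ x, ENNReal.ofReal (SS j x) ∂ν ≤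
      ∫⁻ x, ENNReal.ofReal (g x * v x ^ q x * φ x ^ p x) ∂ν := fun j => by
    refine lintegral_mono_ae ?_
    filter_upwards [D.ae, hvq] with x ⟨h1, ⟨h2, _⟩, ⟨h3, _⟩, _, h5, h6, h7, _⟩ hq
    refine ENNReal.ofReal_le_ofReal ?_
    have m1 : (v x + e j) ^ (q x - p x + 1) ≤ v x ^ (q x - p x + 1) :=
      Real.rpow_le_rpow_of_nonpos h1 (by linarith [he0 j]) (by linarith [D.d_pos])
    calc SS j x ≤ g x * v x ^ (p x - 1) * v x ^ (q x - p x + 1) * φ x ^ p x := by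
          change g x * v x ^ (p x - 1) * (v x + e j) ^ (q x - p x + 1) * φ x ^ p x ≤ _
          gcongr
      _ = _ := by rw [mul_assoc (g x), hq]
  have hup := ((ENNReal.Tendsto.const_mul hRlim
    (Or.inr (ENNReal.ofReal_ne_top (r := C)))).add_const
    (ENNReal.ofReal (-A) * ∫⁻ x, ENNReal.ofReal (g x * v x ^ q x * φ x ^ p x) ∂ν)).liminf_eq
  refine hlow.trans (le_trans (liminf_le_liminf (Eventually.of_forall fun j => ?_)) hup.le)
  refine (D.estimate_of_pos (he0 j) hC hC0.le (hweak (e j) (he0 j))).trans ?_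
  exact add_le_add le_rfl (mul_le_mul' le_rfl (hSle j))

end CaccioppoliData

end AbstractEstimate

/-! ### From extended to real values. -/

section AbstractEstimateReal

variable {α E : Type*} [MeasurableSpace α] [NormedAddCommGroup E]

namespace CaccioppoliData

variable {ν : Measure α} {p q g v φ : α → ℝ} {G Y : α → E} {P d Q cg cφ cY : ℝ}

theorem estimate_real (D : CaccioppoliData ν p q g v φ G Y P d Q cg cφ cY) {C A : ℝ} (hC0 : 0 ≤ C)
    (h : (∫⁻ x, ENNReal.ofReal (v x ^ (q x - p x) * φ x ^ p x * ‖G x‖ ^ p x) ∂ν) +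
        ENNReal.ofReal A * ∫⁻ x, ENNReal.ofReal (g x * v x ^ q x * φ x ^ p x) ∂ν ≤
      ENNReal.ofReal C * (∫⁻ x, ENNReal.ofReal (v x ^ q x * ‖Y x‖ ^ p x) ∂ν) +
        ENNReal.ofReal (-A) * ∫⁻ x, ENNReal.ofReal (g x * v x ^ q x * φ x ^ p x) ∂ν)
    (iR : Integrable (fun x => v x ^ q x * ‖Y x‖ ^ p x) ν)
    (iS : Integrable (fun x => g x * v x ^ q x * φ x ^ p x) ν) :
    Integrable (fun x => v x ^ (q x - p x) * φ x ^ p x * ‖G x‖ ^ p x) ν ∧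
      ∫ x, v x ^ (q x - p x) * φ x ^ p x * ‖G x‖ ^ p x ∂ν ≤
        C * (∫ x, v x ^ q x * ‖Y x‖ ^ p x ∂ν) - A * ∫ x, g x * v x ^ q x * φ x ^ p x ∂ν := by
  have nL : 0 ≤ᵐ[ν] fun x => v x ^ (q x - p x) * φ x ^ p x * ‖G x‖ ^ p x := by
    filter_upwards [D.ae] with x ⟨h1, ⟨h2, _⟩, _⟩
    change 0 ≤ _
    positivity
  have nR : 0 ≤ᵐ[ν] fun x => v x ^ q x * ‖Y x‖ ^ p x := by
    filter_upwards [D.ae] with x ⟨h1, _⟩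
    change 0 ≤ _
    positivity
  have nS : 0 ≤ᵐ[ν] fun x => g x * v x ^ q x * φ x ^ p x := by
    filter_upwards [D.ae] with x ⟨h1, ⟨h2, _⟩, ⟨h3, _⟩, _⟩
    change 0 ≤ _
    positivity
  have hS0 := integral_nonneg_of_ae nS
  have hR0 := integral_nonneg_of_ae nR
  rw [← ofReal_integral_eq_lintegral_ofReal iR nR,
    ← ofReal_integral_eq_lintegral_ofReal iS nS] at h
  have mL : AEStronglyMeasurable (fun x => v x ^ (q x - p x) * φ x ^ p x * ‖G x‖ ^ p x) ν :=
    (((D.meas_v.pow (D.meas_q.sub D.meas_p)).mul (D.meas_φ.pow D.meas_p)).mul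
      (D.meas_G.norm.aemeasurable.pow D.meas_p)).aestronglyMeasurable
  have iL : Integrable (fun x => v x ^ (q x - p x) * φ x ^ p x * ‖G x‖ ^ p x) ν := by
    refine ⟨mL, (hasFiniteIntegral_iff_ofReal nL).2 ?_⟩
    -- Dropping the nonnegative second summand, the finite right side forces the left density to be
    -- integrable.
    refine (le_self_add.trans h).trans_lt ?_
    exact ENNReal.add_lt_top.2 ⟨ENNReal.mul_lt_top ENNReal.ofReal_lt_top ENNReal.ofReal_lt_top,
      ENNReal.mul_lt_top ENNReal.ofReal_lt_top ENNReal.ofReal_lt_top⟩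
  refine ⟨iL, ?_⟩
  rw [← ofReal_integral_eq_lintegral_ofReal iL nL] at h
  have hL0 := integral_nonneg_of_ae nL
  set IL := ∫ x, v x ^ (q x - p x) * φ x ^ p x * ‖G x‖ ^ p x ∂ν
  set IR := ∫ x, v x ^ q x * ‖Y x‖ ^ p x ∂ν
  set IS := ∫ x, g x * v x ^ q x * φ x ^ p x ∂ν
  rcases le_total 0 A with hA | hA
  · rw [ENNReal.ofReal_of_nonpos (neg_nonpos.2 hA), zero_mul, add_zero, ← ENNReal.ofReal_mul hA,
      ← ENNReal.ofReal_mul hC0, ← ENNReal.ofReal_add hL0 (mul_nonneg hA hS0),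
      ENNReal.ofReal_le_ofReal_iff (mul_nonneg hC0 hR0)] at h
    linarith
  · rw [ENNReal.ofReal_of_nonpos hA, zero_mul, add_zero, ← ENNReal.ofReal_mul (neg_nonneg.2 hA),
      ← ENNReal.ofReal_mul hC0, ← ENNReal.ofReal_add (mul_nonneg hC0 hR0)
        (mul_nonneg (neg_nonneg.2 hA) hS0), ENNReal.ofReal_le_ofReal_iff (add_nonneg
        (mul_nonneg hC0 hR0) (mul_nonneg (neg_nonneg.2 hA) hS0))] at h
    linarith

end CaccioppoliData

theorem setLIntegral_eq_of_forall_diff_eq_zero {μ : Measure α} {s t : Set α}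
    (hs : MeasurableSet s) (hst : s ⊆ t) {f : α → ENNReal} (hf : ∀ x ∈ t \ s, f x = 0)
    (ht : MeasurableSet t) : ∫⁻ x in t, f x ∂μ = ∫⁻ x in s, f x ∂μ := by
  rw [← lintegral_inter_add_sdiff f t hs, inter_eq_self_of_subset_right hst,
    setLIntegral_congr_fun (g := fun _ => 0) (ht.diff hs) hf]
  simp

end AbstractEstimateReal

/-! ### Testing the sup-solution inequality. -/

section SupSolution

variable {n N : ℕ} {M : Type*} [TopologicalSpace M]
  [ChartedSpace (EuclideanSpace ℝ (Fin n)) M]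
  {X : Fin N → (x : M) → TangentSpace (𝓡 n) x} {Ω : Set M} {p q g v φ : M → ℝ}
  {G : M → EuclideanSpace ℝ (Fin N)} {P lam : ℝ}

theorem IsTestFunction.contMDiffOn_posRpow (hΩ : IsOpen Ω)
    (hp : ContMDiffOn (𝓡 n) 𝓘(ℝ, ℝ) 1 p Ω) (hp1 : ∀ x ∈ Ω, 1 < p x) (hφ : IsTestFunction n Ω φ) :
    ContMDiffOn (𝓡 n) 𝓘(ℝ, ℝ) 1 (fun x => posRpow (φ x, p x)) Ω := by
  intro x hx
  have h1 : ContMDiffAt (𝓡 n) 𝓘(ℝ, ℝ × ℝ) 1 (fun y => (φ y, p y)) x :=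
    (hφ.1.contMDiffAt.of_le (by norm_cast)).prodMk_space (hp.contMDiffAt (hΩ.mem_nhds hx))
  exact ((contDiffAt_posRpow (z := (φ x, p x)) (hp1 x hx)).contMDiffAt.comp x h1).contMDiffWithinAt

theorem tsupport_posRpow_subset (φ p : M → ℝ) :
    tsupport (fun x => posRpow (φ x, p x)) ⊆ tsupport φ := by
  refine closure_mono fun x hx h => hx ?_
  simp [posRpow, h]

/-- Compactness puts the exponents in a closed interval of negative numbers. The factor `1 + |a z|`,
with `a z` the least exponent, absorbs the coefficient `a x` of the base derivative. -/
theorem exists_bound_posShiftRpow {K : Set M} (hK : IsCompact K) {a : M → ℝ}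
    (ha : ContinuousOn a K) (ha0 : ∀ x ∈ K, a x < 0) {ε : ℝ} (hε : 0 < ε) :
    ∃ B : ℝ, ∀ s, ∀ x ∈ K, |posShiftRpow ε (s, a x)| ≤ B ∧
      |fderiv ℝ (posShiftRpow ε) (s, a x) (1, 0)| ≤ B ∧
      |fderiv ℝ (posShiftRpow ε) (s, a x) (0, 1)| ≤ B := by
  rcases K.eq_empty_or_nonempty with rfl | hne
  · exact ⟨0, fun _ _ h => h.elim⟩
  obtain ⟨y, hy, hmax⟩ := hK.exists_isMaxOn hne ha
  obtain ⟨z, hz, hmin⟩ := hK.exists_isMinOn hne ha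
  have hc : 0 < min (ε / 2) 1 := lt_min (half_pos hε) one_pos
  obtain ⟨B, hB, h⟩ := exists_bound_rpow_of_neg (α := a z) hc (min_le_right _ _) (ha0 y hy)
  refine ⟨(1 + |a z|) * B, fun s x hx => ?_⟩
  have hB' : B ≤ (1 + |a z|) * B := le_mul_of_one_le_left hB (by linarith [abs_nonneg (a z)])
  obtain ⟨b1, b2, b3⟩ := h (posShift ε s) (a x) ((min_le_left _ _).trans (half_le_posShift hε s))
    (hmin hx) (hmax hx)
  have hpos := posShift_pos hε s
  refine ⟨?_, ?_, ?_⟩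
  · rw [posShiftRpow, abs_of_pos (Real.rpow_pos_of_pos hpos _)]
    exact b1.trans hB'
  · rw [fderiv_posShiftRpow_base hε, abs_mul, abs_mul, abs_of_pos (Real.rpow_pos_of_pos hpos _)]
    have hax : |a x| ≤ 1 + |a z| := by
      have h1 : a z ≤ a x := hmin hx
      rw [abs_of_neg (ha0 x hx), abs_of_neg (ha0 z hz)]
      linarith
    calc |a x| * posShift ε s ^ (a x - 1) * |posShiftDeriv ε s|
        ≤ (1 + |a z|) * B * 1 := by
          gcongr
          exact abs_posShiftDeriv_le hε s
      _ = _ := mul_one _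
  · rw [fderiv_posShiftRpow_exp hε]
    exact b3.trans hB'

variable [MeasurableSpace M] [BorelSpace M] {μ : Measure M}

/-- The test function is `φ ^ p * (v + ε) ^ (q - p + 1)`, written through `posRpow` and
`posShiftRpow` so that it is also meaningful for the approximants. -/
theorem IsLocalSupSolution.flux_inequality [T2Space M] [SecondCountableTopology M]
    [IsManifold (𝓡 n) ∞ M] [IsLocallyFiniteMeasure μ]
    (hX : ∀ k, ContMDiff (𝓡 n) (𝓡 n).tangent ∞
      (fun x => (⟨x, X k x⟩ : TangentBundle (𝓡 n) M)))
    (hΩ : IsOpen Ω) (hp : ContMDiffOn (𝓡 n) 𝓘(ℝ, ℝ) 1 p Ω) (hp1 : ∀ x ∈ Ω, 1 < p x)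
    (hpP : ∀ᵐ x ∂(μ.restrict Ω), p x ≤ P)
    (hv : IsLocalSupSolution X μ Ω p g lam v G) (hvpos : ∀ᵐ x ∂(μ.restrict Ω), 0 < v x)
    (hvp : ∀ᵐ x ∂(μ.restrict Ω), inner ℝ (G x) (horizontalGradient X p x) = 0)
    (hq : ContMDiffOn (𝓡 n) 𝓘(ℝ, ℝ) 1 q Ω) (hqp : ∀ x ∈ Ω, q x < p x - 1)
    (hvq : ∀ᵐ x ∂(μ.restrict Ω), inner ℝ (G x) (horizontalGradient X q x) = 0)
    (hφ : IsTestFunction n Ω φ) (hφ0 : ∀ x, 0 ≤ φ x) {ε : ℝ} (hε : 0 < ε) :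
    0 ≤ (∫ x in tsupport φ, (p x * φ x ^ (p x - 1) * (v x + ε) ^ (q x - p x + 1) *
      (‖G x‖ ^ (p x - 2) * inner ℝ (G x) (horizontalGradient X φ x)) +
        (q x - p x + 1) * ((v x + ε) ^ (q x - p x) * φ x ^ p x * ‖G x‖ ^ p x)) ∂μ) -
      lam * ∫ x in tsupport φ,
        g x * v x ^ (p x - 1) * (v x + ε) ^ (q x - p x + 1) * φ x ^ p x ∂μ := by
  set K := tsupport φ with hKdef
  have hK : IsCompact K := hφ.2.1
  have hKΩ : K ⊆ Ω := hφ.2.2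
  have hKm : MeasurableSet K := hK.isClosed.measurableSet
  have hpm : AEMeasurable p (μ.restrict Ω) := hp.continuousOn.aemeasurable hΩ.measurableSet
  have hp1' : ∀ᵐ x ∂(μ.restrict Ω), 1 ≤ p x :=
    (ae_restrict_mem hΩ.measurableSet).mono fun x hx => (hp1 x hx).le
  obtain ⟨w, Hw, hw, hwv⟩ := hv.1 K hK hKΩ
  have ha : ContMDiffOn (𝓡 n) 𝓘(ℝ, ℝ) 1 (fun x => q x - p x + 1) Ω :=
    (hq.sub hp).add contMDiffOn_const
  obtain ⟨B, hB⟩ := exists_bound_posShiftRpow hK (ha.continuousOn.mono hKΩ)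
    (fun x hx => by linarith [hqp x (hKΩ hx)]) hε
  have hΦ := hφ.contMDiffOn_posRpow hΩ hp hp1
  have hΦ0 : ∀ x ∉ K, posRpow (φ x, p x) = 0 := fun x hx => by
    simp [posRpow, image_eq_zero_of_notMem_tsupport hx]
  have hgΦ0 : ∀ x ∉ K, horizontalGradient X (fun x => posRpow (φ x, p x)) x = 0 := fun x hx =>
    horizontalGradient_eq_zero_of_notMem_tsupport fun h => hx (tsupport_posRpow_subset φ p h)
  have hmem := memW10_mul_comp hX hΩ hpm hp1' hpP hK hKΩ hΦ (tsupport_posRpow_subset φ p) ha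
    (contDiff_posShiftRpow hε) hB hw
  have hweak := hv.2 _ _ hmem
    (Eventually.of_forall fun x => mul_nonneg (posRpow_nonneg _)
      (Real.rpow_nonneg (posShift_pos hε _).le _))
    ⟨K, hK, hKΩ, fun x hx => by rw [hΦ0 x hx, zero_mul]⟩
  have hle : μ.restrict K ≤ μ.restrict Ω := Measure.restrict_mono hKΩ le_rfl
  -- Both integrands vanish off `K`; on `K` the global representative `w` agrees a.e. with `v`.
  rw [weakForm, setIntegral_eq_of_subset_of_forall_sdiff_eq_zero hΩ.measurableSet hKΩ,
    setIntegral_eq_of_subset_of_forall_sdiff_eq_zero hΩ.measurableSet hKΩ] at hweak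
  rotate_left
  · intro x hx
    rw [hΦ0 x hx.2]; ring
  · intro x hx
    rw [hΦ0 x hx.2, hgΦ0 x hx.2]; simp
  refine hweak.trans_eq ?_
  congr 1
  · refine integral_congr_ae ?_
    filter_upwards [ae_restrict_mem hKm, hwv, ae_mono hle hvpos, ae_mono hle hvp,
      ae_mono hle hvq] with x hxK ⟨hw1, hw2⟩ hv0 hvpx hvqx
    have hxΩ := hKΩ hxK
    have hnh := hΩ.mem_nhds hxΩ
    have hpx := hp1 x hxΩ
    have dφ : MDifferentiableAt (𝓡 n) 𝓘(ℝ, ℝ) φ x := hφ.1.mdifferentiableAt (by simp)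
    have dp : MDifferentiableAt (𝓡 n) 𝓘(ℝ, ℝ) p x :=
      (hp.contMDiffAt hnh).mdifferentiableAt one_ne_zero
    have dq : MDifferentiableAt (𝓡 n) 𝓘(ℝ, ℝ) q x :=
      (hq.contMDiffAt hnh).mdifferentiableAt one_ne_zero
    have g1 := horizontalGradient_comp₂ (X := X) dφ dp
      (hasFDerivAt_posRpow (z := (φ x, p x)) hpx)
    have g2 := horizontalGradient_comp₂ (X := X) (Ψ := fun z : ℝ × ℝ => z.1 - z.2 + 1) dq dp
      ((hasFDerivAt_fst.sub hasFDerivAt_snd).add_const 1)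
    -- The logarithmic term from the exponent is a multiple of ∇p, hence orthogonal to `G`.
    have i1 : inner ℝ (G x) (horizontalGradient X (fun y => posRpow (φ y, p y)) x) =
        p x * φ x ^ (p x - 1) * inner ℝ (G x) (horizontalGradient X φ x) := by
      rw [g1, inner_add_right, inner_smul_right, inner_smul_right, hvpx,
        ← posRpowDerivBase_eq (hφ0 x) (by linarith : p x - 1 ≠ 0)]
      simp
    have i2 : inner ℝ (G x) (horizontalGradient X (fun y => q y - p y + 1) x) = 0 := by
      rw [g2, inner_add_right, inner_smul_right, inner_smul_right, hvpx, hvqx]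
      simp
    have hsh : posShift ε (v x) = v x + ε := posShift_of_nonneg hε hv0.le
    rw [hw1, hw2, inner_add_right, inner_smul_right, inner_smul_right, inner_add_right,
      inner_smul_right, inner_smul_right, i1, i2, fderiv_posShiftRpow_base hε, posShiftRpow,
      posRpow_eq (hφ0 x) (by linarith), posShiftDeriv_of_nonneg hε hv0.le]
    simp only [hsh, add_sub_cancel_right]
    rw [← rpow_mul_norm_sq (G x) hpx]
    ring
  · congr 1
    refine integral_congr_ae ?_
    filter_upwards [ae_restrict_mem hKm, hwv, ae_mono hle hvpos] with x hxK ⟨hw1, _⟩ hv0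
    have hpx := hp1 x (hKΩ hxK)
    have hsh : posShift ε (v x) = v x + ε := posShift_of_nonneg hε hv0.le
    have e1 : |v x| ^ (p x - 2) * v x = v x ^ (p x - 1) := by
      rw [abs_of_pos hv0, ← Real.rpow_add_one hv0.ne']; ring_nf
    rw [hw1, posShiftRpow, posRpow_eq (hφ0 x) (by linarith), hsh, mul_assoc (g x), e1]
    ring

/-- On the compact support of `φ` the continuous data are bounded, and `v`, `G` inherit
measurability and integrability from a W₀ element. -/
theorem IsLocalSupSolution.exists_caccioppoliData [T2Space M] [SecondCountableTopology M]
    [IsManifold (𝓡 n) ∞ M] [IsLocallyFiniteMeasure μ]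
    (hX : ∀ k, ContMDiff (𝓡 n) (𝓡 n).tangent ∞
      (fun x => (⟨x, X k x⟩ : TangentBundle (𝓡 n) M)))
    (hΩ : IsOpen Ω) (hp : ContMDiffOn (𝓡 n) 𝓘(ℝ, ℝ) 1 p Ω) (hp1 : ∀ x ∈ Ω, 1 < p x)
    (hpP : ∀ᵐ x ∂(μ.restrict Ω), p x ≤ P) (hP : 1 < P)
    (hgm : AEMeasurable g (μ.restrict Ω)) (hg0 : ∀ x ∈ Ω, 0 ≤ g x) (hgbdd : BddAbove (g '' Ω))
    (hv : IsLocalSupSolution X μ Ω p g lam v G) (hvpos : ∀ᵐ x ∂(μ.restrict Ω), 0 < v x)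
    (hq : ContMDiffOn (𝓡 n) 𝓘(ℝ, ℝ) 1 q Ω) {d : ℝ} (hd : 0 < d)
    (hqd : ∀ᵐ x ∂(μ.restrict Ω), d ≤ p x - q x - 1)
    (hφ : IsTestFunction n Ω φ) (hφ0 : ∀ x, 0 ≤ φ x) :
    ∃ Q cg cφ cY : ℝ, CaccioppoliData (μ.restrict (tsupport φ)) p q g v φ G
      (horizontalGradient X φ) P d Q cg cφ cY := by
  set K := tsupport φ with hKdef
  have hK : IsCompact K := hφ.2.1
  have hKΩ : K ⊆ Ω := hφ.2.2
  have hKm : MeasurableSet K := hK.isClosed.measurableSet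
  have hle : μ.restrict K ≤ μ.restrict Ω := Measure.restrict_mono hKΩ le_rfl
  have hp1' : ∀ᵐ x ∂(μ.restrict Ω), 1 ≤ p x :=
    (ae_restrict_mem hΩ.measurableSet).mono fun x hx => (hp1 x hx).le
  obtain ⟨w, Hw, ⟨⟨-, ⟨hwm, hwf⟩, ⟨hHm, hHf⟩⟩, -⟩, hwv⟩ := hv.1 K hK hKΩ
  have hpm : AEMeasurable p (μ.restrict Ω) := hp.continuousOn.aemeasurable hΩ.measurableSet
  have hqm : AEMeasurable q (μ.restrict Ω) := hq.continuousOn.aemeasurable hΩ.measurableSet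
  have hYc := hφ.continuous_horizontalGradient hX
  obtain ⟨c₁, hc₁⟩ := hφ.1.continuous.bounded_above_of_compact_support hφ.2.1
  obtain ⟨c₂, hc₂⟩ := hYc.bounded_above_of_compact_support
    (hφ.hasCompactSupport_horizontalGradient (X := X))
  obtain ⟨c₃, hc₃⟩ := hK.exists_bound_of_continuousOn (hq.continuousOn.mono hKΩ)
  obtain ⟨c₄, hc₄⟩ := hgbdd
  have hint : ∀ {F : Type _} [NormedAddCommGroup F] {f f' : M → F},
      AEStronglyMeasurable f (μ.restrict Ω) → modular μ Ω p f < ⊤ →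
      (∀ᵐ x ∂(μ.restrict K), f x = f' x) →
      Integrable (fun x => ‖f' x‖ ^ p x) (μ.restrict K) := by
    intro F _ f f' hfm hff hae
    have h1 : Integrable (fun x => ‖f x‖ ^ p x) (μ.restrict Ω) :=
      ⟨(hfm.norm.aemeasurable.pow hpm).aestronglyMeasurable,
        (hasFiniteIntegral_iff_ofReal (Eventually.of_forall fun x => by
          change 0 ≤ _; positivity)).2 hff⟩
    refine (h1.mono_measure hle).congr ?_
    filter_upwards [hae] with x hx
    rw [hx]
  refine ⟨|c₃|, c₄, max 1 c₁, max 1 c₂, ?_⟩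
  constructor
  · exact hpm.mono_measure hle
  · exact hqm.mono_measure hle
  · exact hgm.mono_measure hle
  · exact (hwm.aemeasurable.mono_measure hle).congr (hwv.mono fun x hx => hx.1)
  · exact hφ.1.continuous.aemeasurable
  · exact (hHm.mono_measure hle).congr (hwv.mono fun x hx => hx.2)
  · exact hYc.aestronglyMeasurable
  · exact hd
  · exact hP
  · exact abs_nonneg _
  · exact le_max_left _ _
  · exact le_max_left _ _
  · filter_upwards [ae_restrict_mem hKm, ae_mono hle hvpos, ae_mono hle hpP, ae_mono hle hqd]
      with x hx h1 h2 h3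
    refine ⟨h1, ⟨hφ0 x, ((le_abs_self _).trans (hc₁ x)).trans (le_max_right _ _)⟩,
      ⟨hg0 x (hKΩ hx), hc₄ ⟨x, hKΩ hx, rfl⟩⟩, (hc₂ x).trans (le_max_right _ _), hp1 x (hKΩ hx),
      h2, h3, ?_⟩
    exact (neg_le_neg ((hc₃ x hx).trans (le_abs_self _))).trans (neg_abs_le (q x))
  · exact hint hHm hHf (hwv.mono fun x hx => hx.2)
  · refine (hint hwm hwf (hwv.mono fun x hx => hx.1)).congr ?_
    filter_upwards [ae_mono hle hvpos] with x hx
    rw [Real.norm_of_nonneg hx.le]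

/-- Off the support all densities contain a factor `0 ^ p x`, which is 0 because `p x > 1`. -/
theorem caccioppoliEstimate_of_tsupport [T2Space M] (hΩ : IsOpen Ω) (hp1 : ∀ x ∈ Ω, 1 < p x)
    (hφ : IsTestFunction n Ω φ) {d Q cg cφ cY C A : ℝ} (hC0 : 0 ≤ C)
    (D : CaccioppoliData (μ.restrict (tsupport φ)) p q g v φ G
      (horizontalGradient X φ) P d Q cg cφ cY)
    (h : (∫⁻ x in tsupport φ, ENNReal.ofReal (v x ^ (q x - p x) * φ x ^ p x * ‖G x‖ ^ p x) ∂μ) +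
        ENNReal.ofReal A *
          ∫⁻ x in tsupport φ, ENNReal.ofReal (g x * v x ^ q x * φ x ^ p x) ∂μ ≤
      ENNReal.ofReal C * (∫⁻ x in tsupport φ,
          ENNReal.ofReal (v x ^ q x * ‖horizontalGradient X φ x‖ ^ p x) ∂μ) +
        ENNReal.ofReal (-A) *
          ∫⁻ x in tsupport φ, ENNReal.ofReal (g x * v x ^ q x * φ x ^ p x) ∂μ) :
    CaccioppoliEstimate X μ Ω p q g v G φ C A := by
  have hKΩ : tsupport φ ⊆ Ω := hφ.2.2
  have hKm : MeasurableSet (tsupport φ) := (isClosed_tsupport φ).measurableSet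
  have z1 : ∀ x ∈ Ω \ tsupport φ, φ x ^ p x = 0 := fun x hx => by
    rw [image_eq_zero_of_notMem_tsupport hx.2, Real.zero_rpow (by linarith [hp1 x hx.1])]
  have z2 : ∀ x ∈ Ω \ tsupport φ, ‖horizontalGradient X φ x‖ ^ p x = 0 := fun x hx => by
    rw [horizontalGradient_eq_zero_of_notMem_tsupport hx.2, norm_zero,
      Real.zero_rpow (by linarith [hp1 x hx.1])]
  have zL : ∀ x ∈ Ω \ tsupport φ, v x ^ (q x - p x) * φ x ^ p x * ‖G x‖ ^ p x = 0 :=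
    fun x hx => by rw [z1 x hx]; ring
  have zR : ∀ x ∈ Ω \ tsupport φ, v x ^ q x * ‖horizontalGradient X φ x‖ ^ p x = 0 :=
    fun x hx => by rw [z2 x hx]; ring
  have zS : ∀ x ∈ Ω \ tsupport φ, g x * v x ^ q x * φ x ^ p x = 0 :=
    fun x hx => by rw [z1 x hx]; ring
  refine ⟨?_, fun iR iS => ?_⟩
  · rw [setLIntegral_eq_of_forall_diff_eq_zero hKm hKΩ (fun x hx => by rw [zL x hx]; simp)
      hΩ.measurableSet, setLIntegral_eq_of_forall_diff_eq_zero hKm hKΩ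
      (fun x hx => by rw [zS x hx]; simp) hΩ.measurableSet,
      setLIntegral_eq_of_forall_diff_eq_zero hKm hKΩ (fun x hx => by rw [zR x hx]; simp)
      hΩ.measurableSet]
    exact h
  · obtain ⟨iL, hle⟩ := D.estimate_real hC0 h (iR.mono_set hKΩ) (iS.mono_set hKΩ)
    refine ⟨IntegrableOn.of_forall_sdiff_eq_zero iL hΩ.measurableSet zL, ?_⟩
    rw [setIntegral_eq_of_subset_of_forall_sdiff_eq_zero hΩ.measurableSet hKΩ zL,
      setIntegral_eq_of_subset_of_forall_sdiff_eq_zero hΩ.measurableSet hKΩ zR,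
      setIntegral_eq_of_subset_of_forall_sdiff_eq_zero hΩ.measurableSet hKΩ zS]
    exact hle

end SupSolution

/-! ### Integrability of the right-hand side for q = 0. -/

section IntegrabilityOfCutoff

variable {α E : Type*} [MeasurableSpace α] [NormedAddCommGroup E] {ν : Measure α}
  [IsFiniteMeasure ν] {p q g v φ : α → ℝ} {G Y : α → E} {P d Q cg cφ cY : ℝ}

theorem CaccioppoliData.integrable_norm_rpow
    (D : CaccioppoliData ν p q g v φ G Y P d Q cg cφ cY) :
    Integrable (fun x => ‖Y x‖ ^ p x) ν := by
  refine (integrable_const (cY ^ P)).mono'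
    (D.meas_Y.norm.aemeasurable.pow D.meas_p).aestronglyMeasurable ?_
  filter_upwards [D.norm_rpow_le] with x hx
  rwa [Real.norm_of_nonneg (by positivity)]

theorem CaccioppoliData.integrable_mul_rpow
    (D : CaccioppoliData ν p q g v φ G Y P d Q cg cφ cY) :
    Integrable (fun x => g x * φ x ^ p x) ν := by
  refine (integrable_const (cg * cφ ^ P)).mono'
    (D.meas_g.mul (D.meas_φ.pow D.meas_p)).aestronglyMeasurable ?_
  filter_upwards [D.ae] with x ⟨_, ⟨h2, h2'⟩, ⟨h3, h3'⟩, _, h5, h6, _, _⟩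
  have hcg : 0 ≤ cg := h3.trans h3'
  rw [Real.norm_of_nonneg (by positivity)]
  gcongr
  calc φ x ^ p x ≤ cφ ^ p x := by gcongr
    _ ≤ cφ ^ P := Real.rpow_le_rpow_of_exponent_le D.one_le_cφ h6

end IntegrabilityOfCutoff

/-! ### The main theorem. -/

theorem mainTheorem8 {n N : ℕ} {M : Type*} [TopologicalSpace M] [T2Space M]
    [SecondCountableTopology M] [ChartedSpace (EuclideanSpace ℝ (Fin n)) M]
    [IsManifold (𝓡 n) ∞ M] [MeasurableSpace M] [BorelSpace M]
    (μ : Measure M) (hμ : IsSmoothVolume (n := n) μ)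
    (X : Fin N → (x : M) → TangentSpace (𝓡 n) x)
    (hX : ∀ k, ContMDiff (𝓡 n) (𝓡 n).tangent ∞
      (fun x => (⟨x, X k x⟩ : TangentBundle (𝓡 n) M)))
    (Ω : Set M) (hΩ : IsOpen Ω)
    -- the exponent `p`, with `p⁻ = pm` and `p⁺ = pp`
    (p : M → ℝ) (hp : ContMDiffOn (𝓡 n) 𝓘(ℝ, ℝ) 1 p Ω) (hp1 : ∀ x ∈ Ω, 1 < p x)
    (hpbdd : BddAbove (p '' Ω))
    (pm pp : ℝ) (hpm : pm = essInf p (μ.restrict Ω)) (hpp : pp = essSup p (μ.restrict Ω))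
    (hpm1 : 1 < pm)
    -- the weight `g` and the parameter `lam`
    (g : M → ℝ) (hgm : AEMeasurable g (μ.restrict Ω)) (hg0 : ∀ x ∈ Ω, 0 ≤ g x)
    (hgbdd : BddAbove (g '' Ω)) (lam : ℝ)
    -- the positive sup-solution `v` with `∇_X v = G` and `∇_X v · ∇_X p = 0`
    (v : M → ℝ) (G : M → EuclideanSpace ℝ (Fin N))
    (hv : IsLocalSupSolution X μ Ω p g lam v G)
    (hvpos : ∀ᵐ x ∂(μ.restrict Ω), 0 < v x)
    (hvp : ∀ᵐ x ∂(μ.restrict Ω), inner ℝ (G x) (horizontalGradient X p x) = 0) :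
    -- the Caccioppoli estimate
    (∀ (q : M → ℝ), ContMDiffOn (𝓡 n) 𝓘(ℝ, ℝ) 1 q Ω → (∀ x ∈ Ω, q x < p x - 1) →
      BddAbove (q '' Ω) →
      (∀ᵐ x ∂(μ.restrict Ω), inner ℝ (G x) (horizontalGradient X q x) = 0) →
      ∀ qp : ℝ, qp = essSup q (μ.restrict Ω) → 0 < pm - qp - 1 →
      ∀ φ : M → ℝ, IsTestFunction n Ω φ → (∀ x, 0 ≤ φ x) →
        (pm - qp - 1 ≤ pp ∨ pm = pp →
          CaccioppoliEstimate X μ Ω p q g v G φ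
            ((pp / (pm - qp - 1)) ^ pp) (lam * pp / (pm - qp - 1))) ∧
        CaccioppoliEstimate X μ Ω p q g v G φ
          (max ((pp / (pm - qp - 1)) ^ pp) ((pp / (pm - qp - 1)) ^ pm))
          (lam * pp / (pm - qp - 1))) ∧
    -- the logarithmic Caccioppoli inequality (`q = 0`), where `∇_X log v = v⁻¹ ∇_X v`
    (∀ φ : M → ℝ, IsTestFunction n Ω φ → (∀ x, 0 ≤ φ x) →
      IntegrableOn (fun x => ‖φ x • ((v x)⁻¹ • G x)‖ ^ p x) Ω μ ∧
      ∫ x in Ω, ‖φ x • ((v x)⁻¹ • G x)‖ ^ p x ∂μ ≤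
        (pp / (pm - 1)) ^ pp * (∫ x in Ω, ‖horizontalGradient X φ x‖ ^ p x ∂μ) -
          lam * pp / (pm - 1) * ∫ x in Ω, g x * φ x ^ p x ∂μ) := by
  have hloc := hμ.isLocallyFiniteMeasure
  have hne : μ.restrict Ω ≠ 0 :=
    restrict_ne_zero_of_essInf_pos (f := p) (by rw [← hpm]; linarith)
  have hpP : ∀ᵐ x ∂(μ.restrict Ω), p x ≤ pp := by
    rw [hpp]; exact ae_restrict_le_essSup hΩ.measurableSet hpbdd
  have hpm' : ∀ᵐ x ∂(μ.restrict Ω), pm ≤ p x := by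
    rw [hpm]
    refine ae_restrict_essInf_le hΩ.measurableSet ⟨1, ?_⟩
    rintro _ ⟨x, hx, rfl⟩
    exact (hp1 x hx).le
  have hpmP : pm ≤ pp := by
    have : NeBot (ae (μ.restrict Ω)) := ae_neBot.2 hne
    obtain ⟨x, h1, h2⟩ := (hpm'.and hpP).exists
    exact h1.trans h2
  have hP1 : 1 < pp := hpm1.trans_le hpmP
  have main : ∀ (q : M → ℝ), ContMDiffOn (𝓡 n) 𝓘(ℝ, ℝ) 1 q Ω → (∀ x ∈ Ω, q x < p x - 1) →
      BddAbove (q '' Ω) →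
      (∀ᵐ x ∂(μ.restrict Ω), inner ℝ (G x) (horizontalGradient X q x) = 0) →
      ∀ qp : ℝ, qp = essSup q (μ.restrict Ω) → 0 < pm - qp - 1 →
      ∀ φ : M → ℝ, IsTestFunction n Ω φ → (∀ x, 0 ≤ φ x) →
        (pm - qp - 1 ≤ pp ∨ pm = pp →
          CaccioppoliEstimate X μ Ω p q g v G φ
            ((pp / (pm - qp - 1)) ^ pp) (lam * pp / (pm - qp - 1))) ∧
        CaccioppoliEstimate X μ Ω p q g v G φ
          (max ((pp / (pm - qp - 1)) ^ pp) ((pp / (pm - qp - 1)) ^ pm))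
          (lam * pp / (pm - qp - 1)) := by
    intro q hq hqp hqbdd hvq qp hqpS hd φ hφ hφ0
    have hqle : ∀ᵐ x ∂(μ.restrict Ω), q x ≤ qp := by
      rw [hqpS]; exact ae_restrict_le_essSup hΩ.measurableSet hqbdd
    have hqd : ∀ᵐ x ∂(μ.restrict Ω), pm - qp - 1 ≤ p x - q x - 1 := by
      filter_upwards [hqle, hpm'] with x h1 h2
      linarith
    obtain ⟨Q, cg, cφ, cY, D⟩ := hv.exists_caccioppoliData hX hΩ hp hp1 hpP hP1 hgm hg0 hgbdd
      hvpos hq hd hqd hφ hφ0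
    have hfin : IsFiniteMeasure (μ.restrict (tsupport φ)) :=
      ⟨by rw [Measure.restrict_apply_univ]; exact hφ.2.1.isCompact.measure_lt_top⟩
    have hle : μ.restrict (tsupport φ) ≤ μ.restrict Ω := Measure.restrict_mono hφ.2.2 le_rfl
    set d := pm - qp - 1 with hd_def
    have hb : 0 < pp / d := div_pos (by linarith) hd
    have key : ∀ C : ℝ, 0 < C → (∀ᵐ x ∂(μ.restrict Ω), (pp / d) ^ p x ≤ C) →
        CaccioppoliEstimate X μ Ω p q g v G φ C (lam * pp / d) := fun C hC0 hC =>
      caccioppoliEstimate_of_tsupport hΩ hp1 hφ hC0.le D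
        (D.estimate (ae_mono hle hC) hC0 fun ε hε =>
          hv.flux_inequality hX hΩ hp hp1 hpP hvpos hvp hq hqp hvq hφ hφ0 hε)
    have hCpos : 0 < (pp / d) ^ pp := Real.rpow_pos_of_pos hb _
    constructor
    -- If `d ≤ p⁺`, the base `p⁺ / d` is at least 1 and the largest exponent is worst; if `p⁻ = p⁺`,
    -- the exponent is a.e. constant. Without either, the base may be below 1 and `p⁻` may be the
    -- worst exponent.
    · rintro (h | h)
      · refine key _ hCpos ?_
        filter_upwards [hpP] with x hx
        exact Real.rpow_le_rpow_of_exponent_le ((one_le_div hd).2 h) hx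
      · refine key _ hCpos ?_
        filter_upwards [hpP, hpm'] with x hx hx'
        rw [le_antisymm hx (h ▸ hx')]
    · refine key _ (lt_max_of_lt_left hCpos) ?_
      filter_upwards [hpP, hpm'] with x hx hx'
      rcases le_total 1 (pp / d) with h | h
      · exact (Real.rpow_le_rpow_of_exponent_le h hx).trans (le_max_left _ _)
      · exact (Real.rpow_le_rpow_of_exponent_ge hb h hx').trans (le_max_right _ _)
  refine ⟨main, fun φ hφ hφ0 => ?_⟩
  have hq0 : ContMDiffOn (𝓡 n) 𝓘(ℝ, ℝ) 1 (fun _ : M => (0 : ℝ)) Ω := contMDiffOn_const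
  have hest := (main (fun _ => 0) hq0 (fun x hx => by linarith [hp1 x hx])
    ⟨0, by rintro _ ⟨x, _, rfl⟩; exact le_rfl⟩
    (Eventually.of_forall fun x => by rw [horizontalGradient_const, inner_zero_right])
    -- Here `d = p⁻ - 1 ≤ p⁺`, so the smaller constant applies. That `essSup` of the zero function
    -- is 0 uses that Ω is not null.
    0 (essSup_const 0 hne).symm (by linarith) φ hφ hφ0).1 (Or.inl (by linarith))
  obtain ⟨Q, cg, cφ, cY, D⟩ := hv.exists_caccioppoliData hX hΩ hp hp1 hpP hP1 hgm hg0 hgbdd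
    hvpos hq0 (d := pm - 1) (by linarith)
    (hpm'.mono fun x hx => by simpa using hx) hφ hφ0
  have hfin : IsFiniteMeasure (μ.restrict (tsupport φ)) :=
    ⟨by rw [Measure.restrict_apply_univ]; exact hφ.2.1.isCompact.measure_lt_top⟩
  have iR : IntegrableOn (fun x => ‖horizontalGradient X φ x‖ ^ p x) Ω μ := by
    refine IntegrableOn.of_forall_sdiff_eq_zero D.integrable_norm_rpow hΩ.measurableSet
      fun x hx => ?_
    rw [horizontalGradient_eq_zero_of_notMem_tsupport hx.2, norm_zero,
      Real.zero_rpow (by linarith [hp1 x hx.1])]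
  have iS : IntegrableOn (fun x => g x * φ x ^ p x) Ω μ := by
    refine IntegrableOn.of_forall_sdiff_eq_zero D.integrable_mul_rpow hΩ.measurableSet
      fun x hx => ?_
    rw [image_eq_zero_of_notMem_tsupport hx.2, Real.zero_rpow (by linarith [hp1 x hx.1]), mul_zero]
  have hfinal := hest.2 (by simpa only [Real.rpow_zero, one_mul] using iR)
    (by simpa only [Real.rpow_zero, mul_one] using iS)
  simp only [Real.rpow_zero, one_mul, mul_one, sub_zero] at hfinal
  have hlog : (fun x => v x ^ (0 - p x) * φ x ^ p x * ‖G x‖ ^ p x) =ᵐ[μ.restrict Ω]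
      fun x => ‖φ x • ((v x)⁻¹ • G x)‖ ^ p x := by
    filter_upwards [hvpos] with x hx
    rw [norm_smul, norm_smul, Real.norm_of_nonneg (hφ0 x), Real.norm_of_nonneg (inv_nonneg.2 hx.le),
      Real.mul_rpow (hφ0 x) (by positivity), Real.mul_rpow (by positivity) (norm_nonneg _),
      Real.inv_rpow hx.le, zero_sub, Real.rpow_neg hx.le]
    ring
  refine ⟨hfinal.1.congr_fun_ae hlog, ?_⟩
  rw [← integral_congr_ae hlog]
  exact hfinal.2
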